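/- **Conventions.** Let $\mathbb A=\mathbb C\;(=\mathbb R^2)$ or $\mathbb A=\mathbb R\subset\mathbb C$ (the real axis). *Linkages.* A marked linkage $\mathcal L=(L,\ell,W)$ is a finite graph $L$ without loops, with lengths $\ell(e)>0$ on the edges and an ordered set $W=(w_1,\dots,w_s)$ of distinct fixed vertices. For $Z\in\mathbb C^s$, the relative configuration space $C(\mathcal L,Z)$ is the set of maps $\phi$ from the vertices to $\mathbb C$ with $|\phi(v)-\phi(w)|^2=\ell[vw]^2$ for every edge $[vw]$ and $\phi(w_j)=z_j$ for all $j$. It is the set of real points of the scheme $\mathfrak C(\mathcal L,Z)$ defined by these equations together with, for every degenerate triangle $ABC$ of $L$ ($\ell[AC]=\ell[AB]+\ell[BC]$), the equation $\phi(B)=\frac{\ell[BC]}{\ell[AC]}\phi(A)+\frac{\ell[AB]}{\ell[AC]}\phi(C)$. "Scheme-theoretic" refers to $\mathfrak C(\mathcal L,Z)$ as a real analytic space, with local rings the rings of germs of real analytic functions modulo the ideal generated by these equations. The linkage is based if $W=(v_1,v_2)$ consists of the end points of an edge $e^*$; then one takes $Z=(0,\ell(e^*))$, and $\mathcal M(\mathcal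 L)=C(\mathcal L,Z)$ is its moduli space. *Functional linkages.* Let $F:\mathbb A^m\to\mathbb A^n$ and $\mathcal O\in\mathbb A^m$. An $\mathbb A$-functional linkage for $F$ at $\mathcal O$ is a pair $(\mathcal L,Z)$ with $m$ distinguished input vertices $P_1,\dots,P_m$ and $n$ further distinguished output vertices $Q_1,\dots,Q_n$ such that, with $p(\phi)=(\phi(P_i))_i$ and $q(\phi)=(\phi(Q_j))_j$ on $C(\mathcal L,Z)$: (1) $p$ takes values in $\mathbb A^m$, its image $Dom$ has nonempty interior, and $p$ is a regular topological branched covering of $Dom$ whose group consists of scheme-theoretic automorphisms: there is a finite group of homeomorphisms of $C(\mathcal L,Z)$, each induced by an automorphism of the analytic space $\mathfrak C(\mathcal L,Z)$ over $p$, whose orbits are the fibres of $p$, such that $Dom$ carries the quotient topology and the set of points fixed by some nontrivial element is nowhere dense. Moreover $\mathcal O\in Dom^*:=p(C^*)$, where $C^*$ is the set of points at which $p$ is a scheme-theoretic local analytic isomorphism to $\mathbb A^m$. (2) $q=F\circ p$ on $C(\mathcal L,Z)$, i.e. $q\circ p^{-1}=F|_{Dom}$. **Theorem A.** Let $m,n\ge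 0$, let $f:\mathbb A^m\to\mathbb A^n$ be a polynomial map with real coefficients ($\mathbb A=\mathbb C$ or $\mathbb R$), let $\mathcal O\in\mathbb A^m$ and $r>0$, and let $B_r(\mathcal O)$ be the closed Euclidean ball. Then there is a based $\mathbb A$-functional linkage $\mathcal L$ for $f$ at $\mathcal O$ such that $B_r(\mathcal O)\subset Dom^*$, $B_r(\mathcal O)$ lies in the interior of the image of $p$, and $p$ is an analytically trivial covering over $B_r(\mathcal O)$: $p^{-1}(B_r(\mathcal O))$ is contained in $C^*$, has finitely many connected components, and each of them is mapped by $p$ bijectively onto $B_r(\mathcal O)$ with real analytic inverse. If $f:\mathbb C^m\to\mathbb C^n$ is a polynomial map with arbitrary complex coefficients, $\mathcal O\in\mathbb C^m$ and $r>0$, then the same conclusion holds for some marked linkage $\mathcal L$ and some image $Z$ of its marking (with the relative configuration space $C(\mathcal L,Z)$ in place of the moduli space). -/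

import Mathlib

open Set Filter Topology

noncomputable section

namespace Linkage

/-! ### Analytic subspaces of a real vector space, possibly with nilpotents

A family `S` of real analytic (in practice polynomial) functions on a real normed space `E` defines
an analytic space whose points are the common zeros of `S` and whose local ring at a common zero `x`
is the ring of germs at `x` of real analytic functions, modulo the ideal `J_x` generated by `S`. -/

section AnalyticSpaces

variable {E F : Type*} [NormedAddCommGroup E] [NormedSpace ℝ E]
  [NormedAddCommGroup F] [NormedSpace ℝ F]

/-- The germ at `x` of the function `h` lies in the ideal `J_x` generated by the family `S` in the
ring of germs at `x` of real analytic functions. -/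
def MemIdealAt (S : Set (E → ℝ)) (x : E) (h : E → ℝ) : Prop :=
  ∃ (N : ℕ) (a g : Fin N → E → ℝ), (∀ i, AnalyticAt ℝ (a i) x) ∧ (∀ i, g i ∈ S) ∧
    h =ᶠ[𝓝 x] fun y => ∑ i, a i y * g i y

/-- Two vector valued maps agree at `x` modulo `J_x` (in every real coordinate). -/
def CongrAt (S : Set (E → ℝ)) (x : E) (u v : E → F) : Prop :=
  ∀ c : F →L[ℝ] ℝ, MemIdealAt S x fun y => c (u y - v y)

/-- The germ of `u` at `x` is an isomorphism of germs from the analytic space defined by `S` at `x`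
to the analytic space defined by `T` at `u x`: `u` is analytic, pulls the ideal of `T` back into the
ideal of `S`, and the induced homomorphism from the local ring at `u x` to the local ring at `x` is
surjective and injective. -/
structure IsIsoAt (S : Set (E → ℝ)) (T : Set (F → ℝ)) (x : E) (u : E → F) : Prop where
  analyticAt : AnalyticAt ℝ u x
  pullback : ∀ t ∈ T, MemIdealAt S x (t ∘ u)
  surjective : ∀ h : E → ℝ, AnalyticAt ℝ h x →
    ∃ g : F → ℝ, AnalyticAt ℝ g (u x) ∧ MemIdealAt S x fun y => h y - g (u y)
  injective : ∀ g : F → ℝ, AnalyticAt ℝ g (u x) → MemIdealAt S x (g ∘ u) → MemIdealAt T (u x) g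

/-- `σ : X → X` is induced by an automorphism over `p` of the analytic space with set of points `X`
that is defined by `S`. The automorphism is given by local lifts `s x`, defined near `x`, which agree
modulo the ideals where they overlap, are isomorphisms of germs, and commute with `p` modulo the
ideals. -/
def IsAutOver (S : Set (E → ℝ)) (X : Set E) (p : E → F) (σ : X ≃ₜ X) : Prop :=
  ∃ s : X → E → E, ∀ x : X,
    s x x = σ x ∧ IsIsoAt S S (x : E) (s x) ∧
    (∀ᶠ y : X in 𝓝 x, CongrAt S (y : E) (s x) (s y)) ∧
    CongrAt S (x : E) (p ∘ s x) p

/-- The restriction of `p` to `X ∩ p ⁻¹' B` is a finite analytically trivial covering of `B`: there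
are finitely many connected components, and each is mapped bijectively onto `B` with real analytic
inverse. -/
structure IsAnalyticallyTrivialOver (X : Set E) (p : E → F) (B : Set F) : Prop where
  analyticOn : AnalyticOn ℝ p (X ∩ p ⁻¹' B)
  finite : {K | ∃ x ∈ X ∩ p ⁻¹' B, K = connectedComponentIn (X ∩ p ⁻¹' B) x}.Finite
  iso : ∀ x ∈ X ∩ p ⁻¹' B, BijOn p (connectedComponentIn (X ∩ p ⁻¹' B) x) B ∧
    ∃ g : F → E, AnalyticOn ℝ g B ∧ ∀ y ∈ connectedComponentIn (X ∩ p ⁻¹' B) x, g (p y) = y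

end AnalyticSpaces

/-- `p` is a regular topological branched covering of its image with (finite) group `G` of deck
transformations: its fibres are the orbits of `G`, its image carries the quotient topology `X / G`,
and the set of points fixed by some nontrivial element of `G` is nowhere dense. Off that set `G` acts
freely and `p` is a covering. -/
structure IsRegularBranchedCovering {X Y : Type*} [TopologicalSpace X] [TopologicalSpace Y]
    (p : X → Y) (G : Subgroup (X ≃ₜ X)) : Prop where
  finite : Finite G
  isQuotientMap : IsQuotientMap (rangeFactorization p)
  orbit : ∀ x y, p x = p y ↔ ∃ σ ∈ G, σ x = y
  wall : IsNowhereDense {x | ∃ σ ∈ G, σ ≠ 1 ∧ σ x = x}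

/-! ### Linkages and their configuration spaces -/

/-- An abstract marked linkage with vertex set `V`: a graph, a positive length for each edge, and
`s` (ordered, distinct) fixed vertices. -/
structure MarkedLinkage (V : Type*) (s : ℕ) where
  graph : SimpleGraph V
  len : Sym2 V → ℝ
  len_pos : ∀ e ∈ graph.edgeSet, 0 < len e
  fixed : Fin s ↪ V

variable {V : Type*} {s m n : ℕ}

/-- The relative configuration space `C(L, Z)`: planar realizations with the fixed vertices at `Z`. -/
def configSpace (L : MarkedLinkage V s) (Z : Fin s → ℂ) : Set (V → ℂ) :=
  {φ | (∀ v w, L.graph.Adj v w → ‖φ v - φ w‖ ^ 2 = L.len s(v, w) ^ 2) ∧ ∀ j, φ (L.fixed j) = Z j}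

/-- Edge equations: squared distances are prescribed. -/
def edgeEqs (L : MarkedLinkage V s) : Set ((V → ℂ) → ℝ) :=
  {g | ∃ v w, L.graph.Adj v w ∧ g = fun φ => Complex.normSq (φ v - φ w) - L.len s(v, w) ^ 2}

/-- Marking equations: the fixed vertices have prescribed positions. -/
def fixedEqs (L : MarkedLinkage V s) (Z : Fin s → ℂ) : Set ((V → ℂ) → ℝ) :=
  {g | ∃ j, (g = fun φ => (φ (L.fixed j) - Z j).re) ∨ (g = fun φ => (φ (L.fixed j) - Z j).im)}

/-- `A, B, C` span a degenerate triangle with long side `[A C]`. -/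
def IsDegenerateTriangle (L : MarkedLinkage V s) (A B C : V) : Prop :=
  L.graph.Adj A B ∧ L.graph.Adj B C ∧ L.graph.Adj A C ∧
    L.len s(A, C) = L.len s(A, B) + L.len s(B, C)

/-- Degenerate triangle equations: in a degenerate triangle with long side `[A C]`, the vertex `B` is
the point of the bar `[A C]` at distance `ℓ[A B]` from `A` and `ℓ[B C]` from `C`. (These hold on the
configuration space, and together with the equation of `[A C]` they imply those of `[A B]`, `[B C]`.) -/
def triangleEqs (L : MarkedLinkage V s) : Set ((V → ℂ) → ℝ) :=
  {g | ∃ A B C, IsDegenerateTriangle L A B C ∧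
    ((g = fun φ => (φ B - ((L.len s(B, C) / L.len s(A, C)) • φ A +
        (L.len s(A, B) / L.len s(A, C)) • φ C)).re) ∨
     (g = fun φ => (φ B - ((L.len s(B, C) / L.len s(A, C)) • φ A +
        (L.len s(A, B) / L.len s(A, C)) • φ C)).im))}

/-- The equations of the configuration scheme, whose set of real points is `configSpace L Z`. -/
def schemeEqs (L : MarkedLinkage V s) (Z : Fin s → ℂ) : Set ((V → ℂ) → ℝ) :=
  edgeEqs L ∪ fixedEqs L Z ∪ triangleEqs L

/-- A based linkage: the marking consists of the two end points of an edge. -/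
def IsBased (L : MarkedLinkage V 2) : Prop := L.graph.Adj (L.fixed 0) (L.fixed 1)

/-- The image of the marking of a based linkage: the base vertices are placed at `0` and `ℓ(e)`, so
that `configSpace L (baseImage L)` is the moduli space of `L`. -/
def baseImage (L : MarkedLinkage V 2) : Fin 2 → ℂ := ![0, (L.len s(L.fixed 0, L.fixed 1) : ℂ)]

/-! ### Functional linkages

Below `𝕜` is `ℝ` or `ℂ`; the maps `RCLike.map 𝕜 ℂ` and `RCLike.map ℂ 𝕜` are the inclusion of `𝕜` in
the plane and the projection of the plane onto `𝕜` (both the identity if `𝕜 = ℂ`). -/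

variable (𝕜 : Type*) [RCLike 𝕜]

/-- The input map: positions of the input vertices. -/
def inputMap (P : Fin m → V) (φ : V → ℂ) : EuclideanSpace 𝕜 (Fin m) :=
  WithLp.toLp 2 fun i => RCLike.map ℂ 𝕜 (φ (P i))

/-- The domain `Dom(L, Z)`: the image of the input map. -/
def Dom (L : MarkedLinkage V s) (Z : Fin s → ℂ) (P : Fin m → V) :
    Set (EuclideanSpace 𝕜 (Fin m)) :=
  inputMap 𝕜 P '' configSpace L Z

variable [Fintype V]

/-- `C*(L, Z)`: the points of the configuration space at which the input map is a local isomorphism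
from the configuration scheme, as an analytic space, to `𝕜 ^ m`. -/
def regularPoints (L : MarkedLinkage V s) (Z : Fin s → ℂ) (P : Fin m → V) : Set (V → ℂ) :=
  {φ ∈ configSpace L Z |
    CongrAt (schemeEqs L Z) φ (fun ψ i => ψ (P i))
      (fun ψ i => RCLike.map 𝕜 ℂ (inputMap 𝕜 P ψ i)) ∧
    IsIsoAt (schemeEqs L Z) ∅ φ (inputMap 𝕜 P)}

/-- `Dom*(L, Z)`: the image of `C*(L, Z)` under the input map. -/
def DomStar (L : MarkedLinkage V s) (Z : Fin s → ℂ) (P : Fin m → V) :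
    Set (EuclideanSpace 𝕜 (Fin m)) :=
  inputMap 𝕜 P '' regularPoints 𝕜 L Z P

variable {𝕜}

/-- `(L, Z)` with input vertices `P` and output vertices `Q` is a `𝕜`-functional linkage for the germ
of `F` at `O`. -/
structure IsFunctional (L : MarkedLinkage V s) (Z : Fin s → ℂ) (P : Fin m → V) (Q : Fin n → V)
    (F : EuclideanSpace 𝕜 (Fin m) → EuclideanSpace 𝕜 (Fin n)) (O : EuclideanSpace 𝕜 (Fin m)) :
    Prop where
  /-- the input and output vertices are `m + n` distinct vertices -/
  distinct : Function.Injective (Sum.elim P Q)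
  /-- the input vertices stay in `𝕜` -/
  input_mem : ∀ φ ∈ configSpace L Z, ∀ i, φ (P i) = RCLike.map 𝕜 ℂ (inputMap 𝕜 P φ i)
  /-- the image of the input map has nonempty interior -/
  domain : (interior (Dom 𝕜 L Z P)).Nonempty
  /-- the input map is a regular branched covering of its domain, whose group consists of
  scheme-theoretic automorphisms -/
  covering : ∃ G : Subgroup (configSpace L Z ≃ₜ configSpace L Z),
    IsRegularBranchedCovering (fun φ : configSpace L Z => inputMap 𝕜 P φ) G ∧
    ∀ σ ∈ G, IsAutOver (schemeEqs L Z) (configSpace L Z) (inputMap 𝕜 P) σ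
  base_mem : O ∈ DomStar 𝕜 L Z P
  /-- the output map factors through the input map and induces `F` -/
  output : ∀ φ ∈ configSpace L Z, ∀ j, φ (Q j) = RCLike.map 𝕜 ℂ (F (inputMap 𝕜 P φ) j)

/-- `(L, Z)` is a `𝕜`-functional linkage for `F` at `O` that defines `F` on all of `B`, with input map
an analytically trivial covering (also scheme-theoretically) over `B`. -/
structure RealizesOver (L : MarkedLinkage V s) (Z : Fin s → ℂ) (P : Fin m → V) (Q : Fin n → V)
    (F : EuclideanSpace 𝕜 (Fin m) → EuclideanSpace 𝕜 (Fin n)) (O : EuclideanSpace 𝕜 (Fin m))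
    (B : Set (EuclideanSpace 𝕜 (Fin m))) : Prop where
  functional : IsFunctional L Z P Q F O
  subset_domStar : B ⊆ DomStar 𝕜 L Z P
  subset_interior : B ⊆ interior (Dom 𝕜 L Z P)
  trivial_covering : IsAnalyticallyTrivialOver (configSpace L Z) (inputMap 𝕜 P) B
  regular : configSpace L Z ∩ inputMap 𝕜 P ⁻¹' B ⊆ regularPoints 𝕜 L Z P

/-- The polynomial map `𝕜 ^ m → 𝕜 ^ n` with components `f j`, with coefficients in `R = ℝ` or `𝕜`. -/
def polyMap (𝕜 : Type*) [RCLike 𝕜] {R : Type*} [CommSemiring R] [Algebra R 𝕜]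
    (f : Fin n → MvPolynomial (Fin m) R) (x : EuclideanSpace 𝕜 (Fin m)) :
    EuclideanSpace 𝕜 (Fin n) :=
  WithLp.toLp 2 fun j => MvPolynomial.aeval (fun i => x i) (f j)

end Linkage

end

/-! The proof follows Kempe, but keeps the linkages under such control that the whole configuration
space, nilpotents included, is known. Vertices are of two kinds. The position of a core vertex is an
analytic function of the inputs, modulo the ideal of the equations. A labelled vertex is determined
by the core up to a mirror image: its label carries a sign and an axis through two core vertices.
Hence the configurations over a given input are indexed by families of signs, and the group of such
families acts by reflections, simply transitively on the fibres off a closed set of inputs, the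
wall. `Mechanism` records this, and `realizesOver_of_sections` turns it into a branched covering
with scheme-theoretic deck transformations.

Each input is the hand of a two-bar arm with unequal bars that hangs from a fixed vertex. It sweeps
out an annulus, which is compact, and the elbow straightens only over the two boundary circles,
which form the wall. The annuli are chosen so that the ball of the theorem lies inside them and off
the wall.

A single gadget does all the computing. A Peaucellier inversor attached at core vertices `A`, `B`
yields a new core vertex at `A + ρ / conj (B - A)`. If `A ≠ B` and `|B - A| ^ 2 ≠ ρ` on the compact
domain, its bars can be chosen so that it stays nondegenerate for all inputs; thus the wall does not
grow. A bar between two midpoints forces the rhombus of the inversor to be a parallelogram, and a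
two-bar chain keeps its elbows on opposite sides of the axis.

Two inversions with the same centre compose to a homothety; homotheties with distant real centres
give translations, real multiples and sums; the inversion at `0` gives `1 / conj f`; and `1 / conj
(f - K) - 1 / conj (f + K) = 2 K / conj (f ^ 2 - K ^ 2)` gives squares, hence products. So all
polynomials are constructible from the available constants (`IsConstructible.aeval`). A third fixed
vertex at `I` supplies the complex constants.

The scheme structure rests on two facts. Two circles that cross at a point not collinear with their
centres determine the point modulo the ideal (`two_circles`), and congruences may be substituted
into analytic functions (`CongrAt.comp_left`, by Hadamard's lemma). Off the wall, a section
therefore inverts the input map in the local rings.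

For real inputs, one more input is pinned by two bars to one of the points `± h * I`, and every
other input is inverted around it. The image lies on the circle of radius `h` around `0` exactly
when the input is real, so one further bar for each input confines it to the real axis. Complex
conjugation exchanges the two pinned positions and completes the group. -/

noncomputable section

namespace Linkage

open ComplexConjugate

/-! ### Hadamard's lemma for real analytic maps between normed spaces. -/

section Hadamard

variable {E G : Type*} [NormedAddCommGroup E] [NormedSpace ℝ E]
  [NormedAddCommGroup G] [NormedSpace ℝ G]

/-- The multilinear divided difference of `q`: on the diagonal it satisfies
`dividedDifference q z (z.1 - z.2) = q z.1 - q z.2`. -/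
def dividedDifference {n : ℕ} (q : E [×(n + 1)]→L[ℝ] G) : (E × E) [×n]→L[ℝ] (E →L[ℝ] G) :=
  ∑ k : Fin (n + 1), ((q.curryMid k).flipMultilinear).compContinuousLinearMap
    fun i : Fin n => if i.castSucc < k then ContinuousLinearMap.fst ℝ E E
      else ContinuousLinearMap.snd ℝ E E

/-- A telescoping sum: the arguments are exchanged one at a time, the `k`-th summand having `z.1` in
the slots before `k`, `z.2` in those after `k`, and the increment in the slot `k`. -/
theorem dividedDifference_apply {n : ℕ} (q : E [×(n + 1)]→L[ℝ] G) (z : E × E) :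
    dividedDifference q (fun _ => z) (z.1 - z.2) = q (fun _ => z.1) - q (fun _ => z.2) := by
  have h := q.toMultilinearMap.map_sub_map_piecewise (fun _ => z.1) (fun _ => z.2) Finset.univ
  rw [Finset.piecewise_univ] at h
  refine Eq.trans ?_ h.symm
  simp only [dividedDifference, sum_apply,
    ContinuousMultilinearMap.compContinuousLinearMap_apply,
    ContinuousLinearMap.flipMultilinear_apply_apply, ContinuousMultilinearMap.curryMid_apply]
  refine Finset.sum_congr rfl fun k _ => ?_
  refine congrArg q (funext fun j => ?_)
  rcases Fin.eq_self_or_eq_succAbove k j with rfl | ⟨l, rfl⟩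
  · simp
  · simp only [Fin.insertNth_apply_succAbove, Finset.mem_univ, forall_const,
      (Fin.succAbove_ne k l).symm, if_false]
    by_cases hl : l.castSucc < k
    · simp [hl, Fin.succAbove_of_castSucc_lt _ _ hl]
    · have h2 := Fin.succAbove_of_le_castSucc _ _ (not_lt.1 hl)
      have : ¬ l.succ < k := fun h => hl (lt_trans Fin.castSucc_lt_succ h)
      simp [hl, h2, this]

/-- There are `n + 1` summands, each of norm at most `‖q‖`. A factor that is only linear in `n`
leaves a positive radius of convergence. -/
theorem norm_dividedDifference_le {n : ℕ} (q : E [×(n + 1)]→L[ℝ] G) :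
    ‖dividedDifference q‖ ≤ (n + 1) * ‖q‖ := by
  unfold dividedDifference
  refine (norm_sum_le (E := (E × E) [×n]→L[ℝ] (E →L[ℝ] G)) _ _).trans ?_
  refine (Finset.sum_le_card_nsmul _ _ ‖q‖ fun k _ => ?_).trans (by simp)
  refine (ContinuousMultilinearMap.norm_compContinuousLinearMap_le _ _).trans ?_
  have h1 : ‖(q.curryMid k).flipMultilinear‖ ≤ ‖q‖ := by
    refine ContinuousMultilinearMap.opNorm_le_bound (norm_nonneg _) fun m => ?_
    refine ContinuousLinearMap.opNorm_le_bound _ (by positivity) fun x => ?_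
    have := q.norm_map_insertNth_le (i := k) x m
    calc _ ≤ ‖q‖ * ‖x‖ * ∏ i, ‖m i‖ := this
      _ = _ := by ring
  have h2 : ∏ i : Fin n, ‖(if i.castSucc < k then ContinuousLinearMap.fst ℝ E E
      else ContinuousLinearMap.snd ℝ E E)‖ ≤ 1 := by
    refine Finset.prod_le_one (fun _ _ => norm_nonneg _) fun i _ => ?_
    split_ifs
    · exact ContinuousLinearMap.norm_fst_le ..
    · exact ContinuousLinearMap.norm_snd_le ..
  calc _ ≤ ‖q‖ * 1 := by gcongr
    _ = _ := mul_one _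

/-- Hadamard's lemma for analytic functions. -/
theorem exists_analyticAt_sub_eq [CompleteSpace G] {h : E → G} {x : E} (hh : AnalyticAt ℝ h x) :
    ∃ A : E × E → (E →L[ℝ] G), AnalyticAt ℝ A (x, x) ∧
      ∀ᶠ z in 𝓝 (x, x), h z.1 - h z.2 = A z (z.1 - z.2) := by
  obtain ⟨p, hp⟩ := hh
  obtain ⟨R, hR⟩ := hp
  obtain ⟨r, hr0, hrR⟩ := ENNReal.lt_iff_exists_nnreal_btwn.1 hR.r_pos
  have hr0' : (0 : ℝ) < r := by exact_mod_cast hr0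
  obtain ⟨C, hC0, hC⟩ := p.norm_mul_pow_le_of_lt_radius (hrR.trans_le hR.r_le)
  set P : FormalMultilinearSeries ℝ (E × E) (E →L[ℝ] G) := fun n => dividedDifference (p (n + 1))
  -- Halving the radius absorbs the factor `n + 1 ≤ 2 ^ n` in the norms of the divided differences.
  have hPr : ((r / 2 : NNReal) : ENNReal) ≤ P.radius := by
    refine P.le_radius_of_bound (C / r) fun n => ?_
    have h1 := norm_dividedDifference_le (p (n + 1))
    have h2 := hC (n + 1)
    have h3 : ((n : ℝ) + 1) ≤ 2 ^ n := by exact_mod_cast Nat.lt_two_pow_self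
    rw [le_div_iff₀ hr0']
    calc ‖P n‖ * ((r / 2 : NNReal) : ℝ) ^ n * r
        ≤ ((n + 1) * ‖p (n + 1)‖) * (r / 2) ^ n * r := by
          push_cast; gcongr
      _ = ((n + 1) / 2 ^ n) * (‖p (n + 1)‖ * r ^ (n + 1)) := by
          rw [div_pow]; ring
      _ ≤ 1 * C := by
          gcongr
          rw [div_le_one (by positivity)]; exact h3
      _ = C := one_mul _
  have hr2 : (0 : ENNReal) < ((r / 2 : NNReal) : ENNReal) := by
    simpa [pos_iff_ne_zero] using hr0.ne'
  have hPpos : 0 < P.radius := hr2.trans_le hPr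
  have hP := P.hasFPowerSeriesOnBall hPpos
  refine ⟨fun z => P.sum (z - (x, x)), ?_, ?_⟩
  · have := hP.analyticAt
    refine AnalyticAt.fun_comp (g := P.sum) ?_ (by fun_prop)
    simpa using this
  · have hb : Metric.eball ((x, x) : E × E) (r / 2 : NNReal) ∈ 𝓝 (x, x) :=
      Metric.eball_mem_nhds _ hr2
    filter_upwards [hb] with z hz
    have hlt : ((r / 2 : NNReal) : ENNReal) ≤ R := by
      refine le_trans ?_ hrR.le
      exact_mod_cast half_le_self (zero_le (a := r))
    have hz' : z - (x, x) ∈ Metric.eball (0 : E × E) (r / 2 : NNReal) := by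
      simpa [Metric.mem_eball, edist_eq_enorm_sub] using hz
    have hz1 : z.1 - x ∈ Metric.eball (0 : E) R := by
      refine Metric.eball_subset_eball hlt ?_
      rw [Metric.mem_eball, edist_zero_right] at hz' ⊢
      exact lt_of_le_of_lt (by
        simpa [enorm_eq_nnnorm, ← NNReal.coe_le_coe] using norm_fst_le (z - (x, x))) hz'
    have hz2 : z.2 - x ∈ Metric.eball (0 : E) R := by
      refine Metric.eball_subset_eball hlt ?_
      rw [Metric.mem_eball, edist_zero_right] at hz' ⊢
      exact lt_of_le_of_lt (by
        simpa [enorm_eq_nnnorm, ← NNReal.coe_le_coe] using norm_snd_le (z - (x, x))) hz'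
    have s1 := (hR.hasSum hz1).sub (hR.hasSum hz2)
    simp only [add_sub_cancel] at s1
    -- The constant terms of the two expansions cancel; the shift by one matches the degree that the
    -- divided differences lose.
    have s1' := (hasSum_nat_add_iff' 1).2 s1
    have s2 := (hP.hasSum (Metric.eball_subset_eball hPr hz'))
    have s3 := (ContinuousLinearMap.apply ℝ G (z.1 - z.2)).hasSum s2
    have e1 : HasSum (fun n => p (n + 1) (fun _ => z.1 - x) - p (n + 1) (fun _ => z.2 - x))
        (h z.1 - h z.2) := by
      convert s1' using 1
      simp [Subsingleton.elim (fun i : Fin 0 => z.1 - x) (fun _ => z.2 - x)]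
    have e2 : HasSum (fun n => p (n + 1) (fun _ => z.1 - x) - p (n + 1) (fun _ => z.2 - x))
        (P.sum (z - (x, x)) (z.1 - z.2)) := by
      convert s3 using 1
      · funext n
        have := dividedDifference_apply (p (n + 1)) (z - (x, x))
        simp only [Prod.fst_sub, Prod.snd_sub, sub_sub_sub_cancel_right] at this
        exact this.symm
      · simp
    exact e1.unique e2

end Hadamard

/-! ### Real analyticity of conjugation, real and imaginary parts and evaluation. -/

section ComplexAnalytic

variable {E : Type*} [NormedAddCommGroup E] [NormedSpace ℝ E] {f : E → ℂ} {x : E}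

@[fun_prop]
theorem analyticAt_conj (hf : AnalyticAt ℝ f x) : AnalyticAt ℝ (fun y => conj (f y)) x :=
  (Complex.conjCLE.toContinuousLinearMap.analyticAt (f x)).fun_comp hf

@[fun_prop]
theorem analyticAt_re (hf : AnalyticAt ℝ f x) : AnalyticAt ℝ (fun y => (f y).re) x :=
  (Complex.reCLM.analyticAt (f x)).fun_comp hf

@[fun_prop]
theorem analyticAt_im (hf : AnalyticAt ℝ f x) : AnalyticAt ℝ (fun y => (f y).im) x :=
  (Complex.imCLM.analyticAt (f x)).fun_comp hf

@[fun_prop]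
theorem analyticAt_ofReal {g : E → ℝ} (hg : AnalyticAt ℝ g x) :
    AnalyticAt ℝ (fun y => (g y : ℂ)) x :=
  (Complex.ofRealCLM.analyticAt (g x)).fun_comp hg

@[fun_prop]
theorem analyticAt_normSq (hf : AnalyticAt ℝ f x) :
    AnalyticAt ℝ (fun y => Complex.normSq (f y)) x := by
  simp only [Complex.normSq_apply]
  fun_prop

theorem analyticAt_eval {V : Type*} [Fintype V] {G : Type*} [NormedAddCommGroup G]
    [NormedSpace ℝ G] (v : V) (φ : V → G) :
    AnalyticAt ℝ (fun ψ : V → G => ψ v) φ :=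
  (ContinuousLinearMap.proj (R := ℝ) (φ := fun _ : V => G) v).analyticAt φ

end ComplexAnalytic

/-! ### Ideals of analytic germs and congruence of maps. -/

section Ideals

variable {E F G : Type*} [NormedAddCommGroup E] [NormedSpace ℝ E]
  [NormedAddCommGroup F] [NormedSpace ℝ F] [NormedAddCommGroup G] [NormedSpace ℝ G]
  {S T : Set (E → ℝ)} {x : E} {h k : E → ℝ}

namespace MemIdealAt

theorem congr (hh : MemIdealAt S x h) (hk : k =ᶠ[𝓝 x] h) : MemIdealAt S x k := by
  obtain ⟨N, a, g, ha, hg, e⟩ := hh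
  exact ⟨N, a, g, ha, hg, hk.trans e⟩

theorem zero : MemIdealAt S x fun _ => 0 :=
  ⟨0, Fin.elim0, Fin.elim0, fun i => i.elim0, fun i => i.elim0, by simp⟩

theorem of_eventually_eq_zero (hh : ∀ᶠ y in 𝓝 x, h y = 0) : MemIdealAt S x h :=
  zero.congr hh

theorem of_mem (hh : h ∈ S) : MemIdealAt S x h :=
  ⟨1, fun _ _ => 1, fun _ => h, fun _ => analyticAt_const, fun _ => hh, by simp⟩

theorem add (hh : MemIdealAt S x h) (hk : MemIdealAt S x k) :
    MemIdealAt S x fun y => h y + k y := by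
  obtain ⟨N, a, g, ha, hg, e⟩ := hh
  obtain ⟨M, b, l, hb, hl, e'⟩ := hk
  refine ⟨N + M, Fin.append a b, Fin.append g l, fun i => ?_, fun i => ?_, ?_⟩
  · refine Fin.addCases (fun i => ?_) (fun i => ?_) i <;> simp [ha, hb]
  · refine Fin.addCases (fun i => ?_) (fun i => ?_) i <;> simp [hg, hl]
  · filter_upwards [e, e'] with y h1 h2
    simp [Fin.sum_univ_add, h1, h2]

theorem mul_left {a : E → ℝ} (ha : AnalyticAt ℝ a x) (hh : MemIdealAt S x h) :
    MemIdealAt S x fun y => a y * h y := by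
  obtain ⟨N, b, g, hb, hg, e⟩ := hh
  refine ⟨N, fun i y => a y * b i y, g, fun i => ha.mul (hb i), hg, ?_⟩
  filter_upwards [e] with y h1
  simp [h1, Finset.mul_sum, mul_assoc]

theorem neg (hh : MemIdealAt S x h) : MemIdealAt S x fun y => - h y :=
  (hh.mul_left (a := fun _ => -1) analyticAt_const).congr (by simp)

theorem sub (hh : MemIdealAt S x h) (hk : MemIdealAt S x k) :
    MemIdealAt S x fun y => h y - k y :=
  (hh.add hk.neg).congr (by simp [sub_eq_add_neg])

theorem sum {ι : Type*} (s : Finset ι) {h : ι → E → ℝ} (hh : ∀ i ∈ s, MemIdealAt S x (h i)) :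
    MemIdealAt S x fun y => ∑ i ∈ s, h i y := by
  classical
  induction s using Finset.induction_on with
  | empty => simpa using zero
  | insert i s hi ih =>
    simp only [Finset.sum_insert hi]
    exact (hh i (by simp)).add (ih fun j hj => hh j (by simp [hj]))

theorem comp {S' : Set (F → ℝ)} {x' : F} {u : F → E} (hh : MemIdealAt S (u x') h)
    (hu : AnalyticAt ℝ u x') (hS : ∀ g ∈ S, MemIdealAt S' x' (g ∘ u)) :
    MemIdealAt S' x' (h ∘ u) := by
  obtain ⟨N, a, g, ha, hg, e⟩ := hh
  refine MemIdealAt.congr (h := fun y => ∑ i, a i (u y) * g i (u y))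
    (sum _ fun i _ => (hS _ (hg i)).mul_left ((ha i).fun_comp hu)) ?_
  exact hu.continuousAt.eventually e

theorem mono (hh : MemIdealAt S x h) (hST : S ⊆ T) : MemIdealAt T x h := by
  obtain ⟨N, a, g, ha, hg, e⟩ := hh
  exact ⟨N, a, g, ha, fun i => hST (hg i), e⟩

theorem eq_zero (hh : MemIdealAt S x h) (hx : ∀ g ∈ S, g x = 0) : h x = 0 := by
  obtain ⟨N, a, g, ha, hg, e⟩ := hh
  rw [e.self_of_nhds]
  exact Finset.sum_eq_zero fun i _ => by rw [hx _ (hg i), mul_zero]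

end MemIdealAt

/-- The real and imaginary parts of `u` lie in the ideal generated by `S`. -/
def CMem (S : Set (E → ℝ)) (x : E) (u : E → ℂ) : Prop :=
  MemIdealAt S x (fun y => (u y).re) ∧ MemIdealAt S x fun y => (u y).im

namespace CMem

variable {u v a : E → ℂ}

theorem congr (hu : CMem S x u) (h : v =ᶠ[𝓝 x] u) : CMem S x v :=
  ⟨hu.1.congr (h.fun_comp Complex.re), hu.2.congr (h.fun_comp Complex.im)⟩

theorem zero : CMem S x fun _ => 0 := ⟨MemIdealAt.zero, MemIdealAt.zero⟩

theorem of_eventually_eq_zero (hh : ∀ᶠ y in 𝓝 x, u y = 0) : CMem S x u :=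
  zero.congr hh

theorem add (hu : CMem S x u) (hv : CMem S x v) : CMem S x fun y => u y + v y :=
  ⟨by simpa using hu.1.add hv.1, by simpa using hu.2.add hv.2⟩

theorem sub (hu : CMem S x u) (hv : CMem S x v) : CMem S x fun y => u y - v y :=
  ⟨by simpa using hu.1.sub hv.1, by simpa using hu.2.sub hv.2⟩

theorem neg (hu : CMem S x u) : CMem S x fun y => - u y :=
  ⟨by simpa using hu.1.neg, by simpa using hu.2.neg⟩

theorem mul_left (ha : AnalyticAt ℝ a x) (hu : CMem S x u) : CMem S x fun y => a y * u y := by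
  constructor
  · simp only [Complex.mul_re]
    exact (hu.1.mul_left (by fun_prop)).sub (hu.2.mul_left (by fun_prop))
  · simp only [Complex.mul_im]
    exact (hu.2.mul_left (by fun_prop)).add (hu.1.mul_left (by fun_prop))

theorem conjugate (hu : CMem S x u) : CMem S x fun y => conj (u y) :=
  ⟨by simpa using hu.1, by simpa using hu.2.neg⟩

theorem mono (hu : CMem S x u) (hST : S ⊆ T) : CMem T x u :=
  ⟨hu.1.mono hST, hu.2.mono hST⟩

theorem comp {S' : Set (F → ℝ)} {x' : F} {w : F → E} (hu : CMem S (w x') u)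
    (hw : AnalyticAt ℝ w x') (hS : ∀ g ∈ S, MemIdealAt S' x' (g ∘ w)) :
    CMem S' x' (u ∘ w) :=
  ⟨hu.1.comp hw hS, hu.2.comp hw hS⟩

theorem eq_zero (hu : CMem S x u) (hx : ∀ g ∈ S, g x = 0) : u x = 0 :=
  Complex.ext (hu.1.eq_zero hx) (hu.2.eq_zero hx)

theorem symm (hu : CMem S x fun y => u y - v y) : CMem S x fun y => v y - u y :=
  hu.neg.congr (.of_forall fun y => by simp)

theorem trans {w : E → ℂ} (hu : CMem S x fun y => u y - v y) (hv : CMem S x fun y => v y - w y) :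
    CMem S x fun y => u y - w y :=
  (hu.add hv).congr (.of_forall fun y => by simp)

/-- The difference of the squared norms is the real part of `conj (u + v) * (u - v)`. -/
theorem normSq_sub (hu : AnalyticAt ℝ u x) (hv : AnalyticAt ℝ v x)
    (h : CMem S x fun y => u y - v y) :
    MemIdealAt S x fun y => Complex.normSq (u y) - Complex.normSq (v y) := by
  have := (h.mul_left (a := fun y => conj (u y + v y)) (by fun_prop)).1
  refine this.congr (.of_forall fun y => ?_)
  simp [Complex.normSq_apply]
  ring

end CMem

theorem MemIdealAt.ofReal (hh : MemIdealAt S x h) : CMem S x fun y => (h y : ℂ) :=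
  ⟨by simpa using hh, by simpa using zero⟩

theorem congrAt_complex_iff {u v : E → ℂ} :
    CongrAt S x u v ↔ CMem S x fun y => u y - v y := by
  constructor
  · intro h
    exact ⟨h Complex.reCLM, h Complex.imCLM⟩
  · intro h c
    have e : ∀ z : ℂ, c z = c 1 * z.re + c Complex.I * z.im := by
      intro z
      conv_lhs => rw [← Complex.re_add_im z]
      have : ((z.re : ℂ) + z.im * Complex.I) = z.re • (1 : ℂ) + z.im • Complex.I := by simp
      rw [this, map_add, map_smul, map_smul]
      simp [mul_comm]
    refine ((h.1.mul_left (a := fun _ => c 1) analyticAt_const).add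
      (h.2.mul_left (a := fun _ => c Complex.I) analyticAt_const)).congr (.of_forall fun y => ?_)
    exact e _

theorem congrAt_pi_iff {V : Type*} [Fintype V] {u v : E → V → ℂ} :
    CongrAt S x u v ↔ ∀ i, CMem S x fun y => u y i - v y i := by
  classical
  constructor
  · intro h i
    refine congrAt_complex_iff.1 fun c => ?_
    exact h (c.comp (ContinuousLinearMap.proj (R := ℝ) (φ := fun _ : V => ℂ) i))
  · intro h c
    refine (MemIdealAt.sum Finset.univ fun i _ => congrAt_complex_iff.2 (h i)
      (c.comp (ContinuousLinearMap.single ℝ (fun _ : V => ℂ) i))).congr (.of_forall fun y => ?_)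
    simp only [ContinuousLinearMap.comp_apply, ← map_sum]
    congr 1
    exact (Finset.univ_sum_single (u y - v y)).symm

theorem CongrAt.of_eventuallyEq {u v : E → F} (h : u =ᶠ[𝓝 x] v) : CongrAt S x u v := fun c =>
  MemIdealAt.of_eventually_eq_zero (h.mono fun y hy => by simp [hy])

theorem CongrAt.mono {u v : E → F} (h : CongrAt S x u v) (hST : S ⊆ T) : CongrAt T x u v :=
  fun c => (h c).mono hST

theorem CongrAt.prod {u v : E → F} {u' v' : E → G} (h : CongrAt S x u v) (h' : CongrAt S x u' v') :
    CongrAt S x (fun y => (u y, u' y)) fun y => (v y, v' y) := fun c =>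
  ((h (c.comp (ContinuousLinearMap.inl ℝ F G))).add
    (h' (c.comp (ContinuousLinearMap.inr ℝ F G)))).congr (.of_forall fun y => by
      simp [← map_add])

/-- Congruent maps have congruent compositions with analytic maps. -/
theorem CongrAt.comp_left [FiniteDimensional ℝ F] {u v : E → F} (huv : CongrAt S x u v)
    (hu : AnalyticAt ℝ u x) (hv : AnalyticAt ℝ v x) (hx : u x = v x) {h : F → G}
    (hh : AnalyticAt ℝ h (u x)) : CongrAt S x (fun y => h (u y)) fun y => h (v y) := by
  intro c
  have hc : AnalyticAt ℝ (fun z => c (h z)) (u x) := (c.analyticAt _).fun_comp hh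
  -- Hadamard's lemma writes the difference as `A (u, v) (u - v)`. In a basis of `F` this is a
  -- combination of the coordinates of `u - v`, which lie in the ideal, with analytic coefficients.
  obtain ⟨A, hA, e⟩ := exists_analyticAt_sub_eq hc
  let b := Module.finBasis ℝ F
  have hA' : AnalyticAt ℝ (fun y => A (u y, v y)) x := by
    refine AnalyticAt.fun_comp (g := A) ?_ (hu.prod hv)
    rw [← hx]; exact hA
  have h1 : ∀ i, MemIdealAt S x fun y => A (u y, v y) (b i) * (b.coord i).toContinuousLinearMap
      (u y - v y) := fun i =>
    (huv (b.coord i).toContinuousLinearMap).mul_left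
      (((ContinuousLinearMap.apply ℝ ℝ (b i)).analyticAt _).fun_comp hA')
  refine (MemIdealAt.sum Finset.univ fun i _ => h1 i).congr ?_
  have ht : Tendsto (fun y => (u y, v y)) (𝓝 x) (𝓝 (u x, u x)) := by
    have := hu.continuousAt.prodMk hv.continuousAt
    rw [ContinuousAt, ← hx] at this
    exact this
  filter_upwards [ht.eventually e] with y hy
  rw [map_sub, hy]
  conv_lhs => rw [← b.sum_repr (u y - v y)]
  simp [mul_comm]

/-- A point is determined, modulo the ideal, by its distances to two points with which it is not
collinear. -/
theorem two_circles {u v A B : E → ℂ} (hu : AnalyticAt ℝ u x) (hv : AnalyticAt ℝ v x)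
    (hA : AnalyticAt ℝ A x) (hB : AnalyticAt ℝ B x) (hx : u x = v x)
    (h1 : MemIdealAt S x fun y => Complex.normSq (u y - A y) - Complex.normSq (v y - A y))
    (h2 : MemIdealAt S x fun y => Complex.normSq (u y - B y) - Complex.normSq (v y - B y))
    (hind : ((u x - A x) * conj (u x - B x)).im ≠ 0) : CMem S x fun y => u y - v y := by
  -- The two hypotheses concern the real parts of `conj p * (u - v)` and `conj q * (u - v)`. They
  -- form a linear system for `u - v` and its conjugate, and Cramer's rule solves it, with
  -- determinant `w`. At `x` the determinant is a nonzero multiple of the imaginary part in `hind`.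
  set p : E → ℂ := fun y => (u y - A y) + (v y - A y) with hp
  set q : E → ℂ := fun y => (u y - B y) + (v y - B y) with hq
  have hpa : AnalyticAt ℝ p x := by fun_prop
  have hqa : AnalyticAt ℝ q x := by fun_prop
  set w : E → ℂ := fun y => conj (p y) * q y - p y * conj (q y) with hw
  have hwa : AnalyticAt ℝ w x := by fun_prop
  have hwx : w x ≠ 0 := by
    have : w x = -8 * Complex.I * (((u x - A x) * conj (u x - B x)).im : ℂ) := by
      simp only [hw, hp, hq, ← hx]
      apply Complex.ext <;> simp <;> ring
    rw [this]
    exact mul_ne_zero (by simp) (Complex.ofReal_ne_zero.2 hind)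
  have key := ((h1.ofReal.mul_left (a := fun y => 2 * q y) (by fun_prop)).sub
    (h2.ofReal.mul_left (a := fun y => 2 * p y) (by fun_prop))).mul_left
    (a := fun y => (w y)⁻¹) (hwa.inv hwx)
  refine key.congr ?_
  filter_upwards [hwa.continuousAt.eventually_ne hwx] with y hy
  rw [eq_inv_mul_iff_mul_eq₀ hy]
  simp only [hw, hp, hq]
  apply Complex.ext <;> simp [Complex.normSq_apply] <;> ring

end Ideals

/-! ### Points and equations of configuration schemes. -/

section Equations

variable {V : Type*} {s : ℕ} {L : MarkedLinkage V s} {Z : Fin s → ℂ} {φ : V → ℂ}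

theorem mem_configSpace_iff : φ ∈ configSpace L Z ↔
    (∀ v w, L.graph.Adj v w → Complex.normSq (φ v - φ w) = L.len s(v, w) ^ 2) ∧
      ∀ j, φ (L.fixed j) = Z j := by
  simp only [configSpace, mem_ofPred_eq, Complex.normSq_eq_norm_sq]

/-- A point at distances `p`, `q` from two points at distance `p + q` lies between them. -/
theorem eq_of_degenerate_triangle {a b c : ℂ} {p q : ℝ} (hp : 0 < p) (hq : 0 < q)
    (h1 : Complex.normSq (a - b) = p ^ 2) (h2 : Complex.normSq (b - c) = q ^ 2)
    (h3 : Complex.normSq (a - c) = (p + q) ^ 2) :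
    b = (q / (p + q)) • a + (p / (p + q)) • c := by
  have h0 : Complex.normSq (q • (b - a) - p • (c - b)) = 0 := by
    have e : Complex.normSq (q • (b - a) - p • (c - b)) =
        q ^ 2 * Complex.normSq (a - b) + p ^ 2 * Complex.normSq (b - c)
          - p * q * (Complex.normSq (a - c) - Complex.normSq (a - b) - Complex.normSq (b - c)) := by
      simp [Complex.normSq_apply]; ring
    rw [e, h1, h2, h3]; ring
  rw [Complex.normSq_eq_zero] at h0
  have hpq : (p : ℂ) + q ≠ 0 := by exact_mod_cast (add_pos hp hq).ne'
  simp only [Complex.real_smul] at h0 ⊢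
  push_cast
  field_simp
  linear_combination h0

/-- The triangle equations do not change the set of points: they follow from the equations of the
three sides by equality in the triangle inequality. -/
theorem schemeEqs_eq_zero (hφ : φ ∈ configSpace L Z) {g : (V → ℂ) → ℝ}
    (hg : g ∈ schemeEqs L Z) : g φ = 0 := by
  rw [mem_configSpace_iff] at hφ
  rcases hg with (⟨v, w, hvw, rfl⟩ | ⟨j, rfl | rfl⟩) | ⟨A, B, C, ⟨h1, h2, h3, h4⟩, h⟩
  · simp [hφ.1 v w hvw]
  · simp [hφ.2 j]
  · simp [hφ.2 j]
  · have key := eq_of_degenerate_triangle (L.len_pos _ h1) (L.len_pos _ h2) (hφ.1 _ _ h1)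
      (hφ.1 _ _ h2) ((hφ.1 _ _ h3).trans (by rw [h4]))
    rw [← h4] at key
    rcases h with rfl | rfl <;> simp only [← key, sub_self] <;> simp

theorem mem_configSpace_of_eqs (h1 : ∀ g ∈ edgeEqs L, g φ = 0)
    (h2 : ∀ g ∈ fixedEqs L Z, g φ = 0) : φ ∈ configSpace L Z := by
  rw [mem_configSpace_iff]
  constructor
  · intro v w hvw
    have := h1 _ ⟨v, w, hvw, rfl⟩
    linarith
  · intro j
    refine sub_eq_zero.1 (Complex.ext (h2 _ ⟨j, Or.inl rfl⟩) (h2 _ ⟨j, Or.inr rfl⟩))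

theorem edgeEqs_subset : edgeEqs L ⊆ schemeEqs L Z := fun _ h => Or.inl (Or.inl h)

theorem fixedEqs_subset : fixedEqs L Z ⊆ schemeEqs L Z := fun _ h => Or.inl (Or.inr h)

theorem triangleEqs_subset : triangleEqs L ⊆ schemeEqs L Z := fun _ h => Or.inr h

end Equations

/-! ### Analyticity of the input map. -/

section InputMap

variable {V : Type*} {m : ℕ} (𝕜 : Type*) [RCLike 𝕜] (P : Fin m → V)

/-- The input map as a continuous linear map. -/
def inputCLM : (V → ℂ) →L[ℝ] EuclideanSpace 𝕜 (Fin m) :=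
  (PiLp.continuousLinearEquiv 2 ℝ (fun _ : Fin m => 𝕜)).symm.toContinuousLinearMap.comp
    (ContinuousLinearMap.pi fun i => (RCLike.map ℂ 𝕜).comp
      (ContinuousLinearMap.proj (R := ℝ) (φ := fun _ : V => ℂ) (P i)))

theorem continuous_inputMap : Continuous (inputMap 𝕜 P) :=
  (inputCLM 𝕜 P).continuous

theorem analyticAt_inputMap [Fintype V] (φ : V → ℂ) : AnalyticAt ℝ (inputMap 𝕜 P) φ :=
  (inputCLM 𝕜 P).analyticAt φ

end InputMap

/-! ### Connected components of a finite disjoint union. -/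

section Components

/-- The components of a finite disjoint union of connected closed sets. -/
theorem connectedComponentIn_eq_of_iUnion {X Λ : Type*} [TopologicalSpace X] [Finite Λ]
    {C : Λ → Set X} (hC : ∀ i, IsClosed (C i)) (hc : ∀ i, IsPreconnected (C i))
    (hd : ∀ i j, i ≠ j → Disjoint (C i) (C j)) {i : Λ} {x : X} (hx : x ∈ C i) :
    connectedComponentIn (⋃ i, C i) x = C i := by
  apply subset_antisymm
  · have hpre := isPreconnected_connectedComponentIn (F := ⋃ i, C i) (x := x)
    rw [isPreconnected_iff_subset_of_disjoint_closed] at hpre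
    have hxT : x ∈ ⋃ i, C i := mem_iUnion_of_mem i hx
    have hdis : Disjoint (C i) (⋃ j : {j // j ≠ i}, C j) :=
      disjoint_iUnion_right.2 fun j => hd _ _ j.2.symm
    have hcov : connectedComponentIn (⋃ i, C i) x ⊆ C i ∪ ⋃ j : {j // j ≠ i}, C j := by
      refine (connectedComponentIn_subset _ _).trans (iUnion_subset fun j => ?_)
      by_cases hj : j = i
      · subst hj; exact subset_union_left
      · exact (subset_iUnion (fun j : {j // j ≠ i} => C j) ⟨j, hj⟩).trans subset_union_right
    rcases hpre (C i) (⋃ j : {j // j ≠ i}, C j) (hC i) (isClosed_iUnion_of_finite fun j => hC j)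
      hcov (by rw [hdis.inter_eq, inter_empty]) with h | h
    · exact h
    · exact absurd (h (mem_connectedComponentIn hxT)) (disjoint_left.1 hdis hx)
  · exact (hc i).subset_connectedComponentIn hx (subset_iUnion C i)

end Components

/-! ### Actions on the scheme, families of sections, and the criterion for realization. -/

section Action

variable {V : Type*} [Fintype V] {s m n : ℕ} {L : MarkedLinkage V s} {Z : Fin s → ℂ}
  {𝕜 : Type*} [RCLike 𝕜] {P : Fin m → V} {Γ : Type*} [Group Γ]

/-- An action of a group on the ambient space by maps that preserve the configuration scheme. -/
structure IsSchemeAction (L : MarkedLinkage V s) (Z : Fin s → ℂ)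
    (act : Γ → (V → ℂ) → V → ℂ) : Prop where
  one : ∀ φ, act 1 φ = φ
  mul : ∀ γ γ' φ, act (γ * γ') φ = act γ (act γ' φ)
  analyticAt : ∀ γ, ∀ φ ∈ configSpace L Z, AnalyticAt ℝ (act γ) φ
  pullback : ∀ γ, ∀ φ ∈ configSpace L Z, ∀ g ∈ schemeEqs L Z,
    MemIdealAt (schemeEqs L Z) φ (g ∘ act γ)

variable {act : Γ → (V → ℂ) → V → ℂ}

namespace IsSchemeAction

/-- The pulled back equations lie in the ideal at `φ`, hence vanish at `φ`. -/
theorem mapsTo (h : IsSchemeAction L Z act) (γ : Γ) {φ : V → ℂ} (hφ : φ ∈ configSpace L Z) :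
    act γ φ ∈ configSpace L Z :=
  mem_configSpace_of_eqs
    (fun g hg => (h.pullback γ φ hφ g (edgeEqs_subset hg)).eq_zero
      fun _ hg' => schemeEqs_eq_zero hφ hg')
    (fun g hg => (h.pullback γ φ hφ g (fixedEqs_subset hg)).eq_zero
      fun _ hg' => schemeEqs_eq_zero hφ hg')

theorem inv_act (h : IsSchemeAction L Z act) (γ : Γ) (φ : V → ℂ) : act γ⁻¹ (act γ φ) = φ := by
  rw [← h.mul, inv_mul_cancel, h.one]

theorem act_inv (h : IsSchemeAction L Z act) (γ : Γ) (φ : V → ℂ) : act γ (act γ⁻¹ φ) = φ := by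
  rw [← h.mul, mul_inv_cancel, h.one]

/-- The homomorphism from the group to the homeomorphisms of the configuration space. -/
def toHomeo (h : IsSchemeAction L Z act) : Γ →* (configSpace L Z ≃ₜ configSpace L Z) where
  toFun γ :=
    { toFun := fun φ => ⟨act γ φ, h.mapsTo γ φ.2⟩
      invFun := fun φ => ⟨act γ⁻¹ φ, h.mapsTo γ⁻¹ φ.2⟩
      left_inv := fun φ => Subtype.ext (h.inv_act γ φ)
      right_inv := fun φ => Subtype.ext (h.act_inv γ φ)
      continuous_toFun := by
        refine Continuous.subtype_mk (continuous_iff_continuousAt.2 fun φ => ?_) _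
        exact (h.analyticAt γ φ φ.2).continuousAt.comp continuousAt_subtype_val
      continuous_invFun := by
        refine Continuous.subtype_mk (continuous_iff_continuousAt.2 fun φ => ?_) _
        exact (h.analyticAt γ⁻¹ φ φ.2).continuousAt.comp continuousAt_subtype_val }
  map_one' := by ext φ : 2; exact h.one φ
  map_mul' γ γ' := by ext φ : 2; exact h.mul γ γ' φ

/-- The group law holds on the whole ambient space and not only modulo the ideals, so composition
with `act γ⁻¹` inverts the homomorphism of local rings on the level of functions. -/
theorem isIsoAt (h : IsSchemeAction L Z act) (γ : Γ) {φ : V → ℂ} (hφ : φ ∈ configSpace L Z) :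
    IsIsoAt (schemeEqs L Z) (schemeEqs L Z) φ (act γ) where
  analyticAt := h.analyticAt γ φ hφ
  pullback := h.pullback γ φ hφ
  surjective k hk := by
    refine ⟨k ∘ act γ⁻¹, ?_, ?_⟩
    · refine AnalyticAt.comp ?_ (h.analyticAt γ⁻¹ _ (h.mapsTo γ hφ))
      rwa [h.inv_act]
    · exact MemIdealAt.of_eventually_eq_zero (.of_forall fun y => by simp [h.inv_act])
  injective g _ hg := by
    have := MemIdealAt.comp (x' := act γ φ) (u := act γ⁻¹) (h := g ∘ act γ)
      (S := schemeEqs L Z) (by rwa [h.inv_act])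
      (h.analyticAt γ⁻¹ _ (h.mapsTo γ hφ)) (h.pullback γ⁻¹ _ (h.mapsTo γ hφ))
    refine this.congr (.of_forall fun y => ?_)
    simp [h.act_inv]

theorem isAutOver (h : IsSchemeAction L Z act) {F : Type*} [NormedAddCommGroup F]
    [NormedSpace ℝ F] {p : (V → ℂ) → F} (hp : ∀ γ φ, p (act γ φ) = p φ) (γ : Γ) :
    IsAutOver (schemeEqs L Z) (configSpace L Z) p (h.toHomeo γ) :=
  ⟨fun _ => act γ, fun φ => ⟨rfl, h.isIsoAt γ φ.2,
    .of_forall fun _ => CongrAt.of_eventuallyEq (EventuallyEq.refl _ _),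
    CongrAt.of_eventuallyEq (.of_forall fun y => hp γ y)⟩⟩

end IsSchemeAction

/-- Sections of the input map over `K`, analytic off the wall `W`, that sweep out the configuration
space. -/
structure IsSectionFamily (L : MarkedLinkage V s) (Z : Fin s → ℂ) {F Λ : Type*}
    [NormedAddCommGroup F] [NormedSpace ℝ F] (p : (V → ℂ) → F) (K W : Set F)
    (Φ : Λ → F → V → ℂ) : Prop where
  mem : ∀ i, ∀ x ∈ K, Φ i x ∈ configSpace L Z
  proj : ∀ i, ∀ x ∈ K, p (Φ i x) = x
  cont : ∀ i, ContinuousOn (Φ i) K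
  analyticAt : ∀ i, ∀ x ∈ K \ W, AnalyticAt ℝ (Φ i) x
  exists_eq : ∀ φ ∈ configSpace L Z, p φ ∈ K ∧ ∃ i, φ = Φ i (p φ)
  inj : ∀ x ∈ K \ W, ∀ i j, Φ i x = Φ j x → i = j
  congrAt : ∀ i, ∀ x ∈ K \ W, CongrAt (schemeEqs L Z) (Φ i x) (fun ψ => ψ) fun ψ => Φ i (p ψ)

namespace IsSectionFamily

variable {F Λ : Type*} [NormedAddCommGroup F] [NormedSpace ℝ F] {p : (V → ℂ) → F} {K W : Set F}
  {Φ : Λ → F → V → ℂ}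

theorem isCompact (h : IsSectionFamily L Z p K W Φ) [Finite Λ] (hK : IsCompact K) :
    IsCompact (configSpace L Z) := by
  have : configSpace L Z = ⋃ i, Φ i '' K := by
    ext φ
    simp only [mem_iUnion, mem_image]
    constructor
    · intro hφ
      obtain ⟨h1, i, hi⟩ := h.exists_eq φ hφ
      exact ⟨i, _, h1, hi.symm⟩
    · rintro ⟨i, x, hx, rfl⟩
      exact h.mem i x hx
  rw [this]
  exact isCompact_iUnion fun i => hK.image_of_continuousOn (h.cont i)

theorem image_eq [Nonempty Λ] (h : IsSectionFamily L Z p K W Φ) : p '' configSpace L Z = K := by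
  ext x
  constructor
  · rintro ⟨φ, hφ, rfl⟩
    exact (h.exists_eq φ hφ).1
  · intro hx
    exact ⟨Φ (Classical.arbitrary Λ) x, h.mem _ x hx, h.proj _ x hx⟩

/-- The section `Φ i` through `φ` is the inverse of `p`. Surjectivity: `k` is congruent to `k ∘ Φ i
∘ p`, because the identity is congruent to `Φ i ∘ p`. Injectivity: restriction to the image of `Φ i`
kills the ideal and turns `g ∘ p` into `g`, on a neighbourhood because `p φ` is interior to `K`. -/
theorem isIsoAt (h : IsSectionFamily L Z p K W Φ) (hp : ∀ φ, AnalyticAt ℝ p φ)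
    {φ : V → ℂ} (hφ : φ ∈ configSpace L Z) (hK : p φ ∈ interior K) (hW : p φ ∉ W) :
    IsIsoAt (schemeEqs L Z) ∅ φ p := by
  have hKW : p φ ∈ K \ W := ⟨interior_subset hK, hW⟩
  obtain ⟨-, i, hi⟩ := h.exists_eq φ hφ
  have han := h.analyticAt i _ hKW
  refine ⟨hp φ, fun t ht => ht.elim, fun k hk => ?_, fun g hg hgp => ?_⟩
  · refine ⟨k ∘ Φ i, AnalyticAt.comp (by rwa [← hi]) han, ?_⟩
    have hc := h.congrAt i _ hKW
    rw [← hi] at hc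
    have := hc.comp_left (h := k) analyticAt_id (han.fun_comp (hp φ)) hi hk
    exact this (ContinuousLinearMap.id ℝ ℝ)
  · obtain ⟨N, a, l, ha, hl, e⟩ := hgp
    refine MemIdealAt.of_eventually_eq_zero ?_
    have hc : Tendsto (Φ i) (𝓝 (p φ)) (𝓝 φ) := by
      have := han.continuousAt.tendsto
      rwa [← hi] at this
    filter_upwards [hc.eventually e, mem_interior_iff_mem_nhds.1 hK] with x hx hxK
    simp only [Function.comp_apply, h.proj i x hxK] at hx
    rw [hx]
    exact Finset.sum_eq_zero fun j _ => by
      rw [schemeEqs_eq_zero (h.mem i x hxK) (hl j), mul_zero]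

/-- The preimage of `B` is the union of the finitely many compact connected sets `Φ i '' B`, which
are disjoint because different sections never meet off the wall. These are therefore the components.
-/
theorem isAnalyticallyTrivialOver (h : IsSectionFamily L Z p K W Φ) [Finite Λ]
    (hp : ∀ φ, AnalyticAt ℝ p φ) {B : Set F} (hB : IsCompact B) (hBc : IsPreconnected B)
    (hBK : B ⊆ K) (hBW : Disjoint B W) : IsAnalyticallyTrivialOver (configSpace L Z) p B := by
  have hKW : ∀ x ∈ B, x ∈ K \ W := fun x hx => ⟨hBK hx, disjoint_left.1 hBW hx⟩
  have hU : configSpace L Z ∩ p ⁻¹' B = ⋃ i, Φ i '' B := by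
    ext φ
    simp only [mem_iUnion, mem_image]
    constructor
    · rintro ⟨hφ, hφB⟩
      obtain ⟨-, i, hi⟩ := h.exists_eq φ hφ
      exact ⟨i, _, hφB, hi.symm⟩
    · rintro ⟨i, x, hx, rfl⟩
      exact ⟨h.mem i x (hBK hx), by simpa [h.proj i x (hBK hx)] using hx⟩
  have hcomp : ∀ {i : Λ} {φ : V → ℂ}, φ ∈ Φ i '' B →
      connectedComponentIn (configSpace L Z ∩ p ⁻¹' B) φ = Φ i '' B := by
    intro i φ hφ
    rw [hU]
    refine connectedComponentIn_eq_of_iUnion (C := fun i => Φ i '' B) (fun j => ?_) (fun j => ?_)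
      (fun j k hjk => ?_) hφ
    · exact (hB.image_of_continuousOn ((h.cont j).mono hBK)).isClosed
    · exact hBc.image _ ((h.cont j).mono hBK)
    · refine disjoint_left.2 ?_
      rintro _ ⟨x, hx, rfl⟩ ⟨y, hy, hxy⟩
      have : y = x := by rw [← h.proj j x (hBK hx), ← hxy, h.proj k y (hBK hy)]
      subst this
      exact hjk (h.inj y (hKW y hx) _ _ hxy.symm)
  refine ⟨fun φ _ => (hp φ).analyticWithinAt, ?_, fun φ hφ => ?_⟩
  · refine (finite_range fun i : Λ => Φ i '' B).subset ?_
    rintro _ ⟨φ, hφ, rfl⟩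
    rw [hU] at hφ
    obtain ⟨i, hi⟩ := mem_iUnion.1 hφ
    exact ⟨i, (hcomp hi).symm⟩
  · rw [hU] at hφ
    obtain ⟨i, hi⟩ := mem_iUnion.1 hφ
    rw [hcomp hi]
    refine ⟨⟨?_, ?_, ?_⟩, Φ i, fun x hx => (h.analyticAt i x (hKW x hx)).analyticWithinAt, ?_⟩
    · rintro _ ⟨x, hx, rfl⟩
      rwa [h.proj i x (hBK hx)]
    · rintro _ ⟨x, hx, rfl⟩ _ ⟨y, hy, rfl⟩ hxy
      rw [h.proj i x (hBK hx), h.proj i y (hBK hy)] at hxy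
      rw [hxy]
    · exact fun x hx => ⟨Φ i x, ⟨x, hx, rfl⟩, h.proj i x (hBK hx)⟩
    · rintro _ ⟨x, hx, rfl⟩
      rw [h.proj i x (hBK hx)]

/-- The quotient topology comes from compactness of the configuration space. Fixed points of
nontrivial elements lie over `W`, and the closed preimage of `W` has no interior: from any point, a
continuous section leads to nearby configurations over `K \ W`. -/
theorem isRegularBranchedCovering (h : IsSectionFamily L Z p K W Φ) [Finite Λ] [Finite Γ]
    (hp : Continuous p) (hK : IsCompact K) (hW : IsClosed W) (hd : K ⊆ closure (K \ W))
    (ha : IsSchemeAction L Z act) (hpa : ∀ γ φ, p (act γ φ) = p φ)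
    (horb : ∀ φ ∈ configSpace L Z, ∀ ψ ∈ configSpace L Z, p φ = p ψ → ∃ γ, act γ φ = ψ)
    (hfree : ∀ γ, ∀ φ ∈ configSpace L Z, p φ ∉ W → act γ φ = φ → γ = 1) :
    IsRegularBranchedCovering (fun φ : configSpace L Z => p φ) ha.toHomeo.range := by
  have hcont : Continuous (fun φ : configSpace L Z => p φ) := hp.comp continuous_subtype_val
  refine ⟨Set.finite_range ha.toHomeo, ?_, fun φ ψ => ⟨fun e => ?_, ?_⟩, ?_⟩
  · have : CompactSpace (configSpace L Z) := isCompact_iff_compactSpace.1 (h.isCompact hK)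
    have hc : Continuous (rangeFactorization fun φ : configSpace L Z => p φ) :=
      hcont.subtype_mk _
    exact hc.isClosedMap.isQuotientMap hc rangeFactorization_surjective
  · obtain ⟨γ, hγ⟩ := horb φ φ.2 ψ ψ.2 e
    exact ⟨ha.toHomeo γ, ⟨γ, rfl⟩, Subtype.ext hγ⟩
  · rintro ⟨_, ⟨γ, rfl⟩, rfl⟩
    exact (hpa γ φ).symm
  · have hsub : {φ : configSpace L Z | ∃ σ ∈ ha.toHomeo.range, σ ≠ 1 ∧ σ φ = φ} ⊆
        {φ : configSpace L Z | p φ ∈ W} := by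
      rintro φ ⟨_, ⟨γ, rfl⟩, hne, hφ⟩
      by_contra hw
      refine hne ?_
      rw [hfree γ φ φ.2 hw (congrArg Subtype.val hφ), map_one]
    refine IsNowhereDense.mono hsub ?_
    have hcl : IsClosed {φ : configSpace L Z | p φ ∈ W} := hW.preimage hcont
    rw [hcl.isNowhereDense_iff, ← not_nonempty_iff_eq_empty]
    rintro ⟨φ, hφ⟩
    obtain ⟨hx, i, hi⟩ := h.exists_eq φ φ.2
    obtain ⟨U, hU, hUo, hφU⟩ := mem_interior.1 hφ
    obtain ⟨O, hO, rfl⟩ := isOpen_induced_iff.1 hUo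
    have hφO : Φ i (p φ) ∈ O := by rw [← hi]; exact hφU
    have hev : ∀ᶠ x in 𝓝[K] (p φ), Φ i x ∈ O := h.cont i _ hx (hO.mem_nhds hφO)
    have hfr : ∃ᶠ x in 𝓝 (p φ), x ∈ K \ W := mem_closure_iff_frequently.1 (hd hx)
    obtain ⟨x, hxKW, hxO⟩ := (hfr.and_eventually (eventually_nhdsWithin_iff.1 hev)).exists
    have hxU : (⟨Φ i x, h.mem i x hxKW.1⟩ : configSpace L Z) ∈ Subtype.val ⁻¹' O := hxO hxKW.1
    have := hU hxU
    rw [mem_ofPred_eq, h.proj i x hxKW.1] at this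
    exact hxKW.2 this

end IsSectionFamily

/-- Both halves of the theorem are reduced to this list: finitely many sections over a compact set,
and a finite group that is transitive on the fibres and free off the wall. -/
theorem realizesOver_of_sections {Q : Fin n → V}
    {F : EuclideanSpace 𝕜 (Fin m) → EuclideanSpace 𝕜 (Fin n)} {O : EuclideanSpace 𝕜 (Fin m)}
    {r : ℝ} (hr : 0 < r) {Λ : Type*} [Finite Λ] [Nonempty Λ] [Finite Γ]
    {K W : Set (EuclideanSpace 𝕜 (Fin m))} {Φ : Λ → EuclideanSpace 𝕜 (Fin m) → V → ℂ}
    (h : IsSectionFamily L Z (inputMap 𝕜 P) K W Φ)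
    (hK : IsCompact K) (hW : IsClosed W) (hd : K ⊆ closure (K \ W))
    (ha : IsSchemeAction L Z act) (hpa : ∀ γ φ, inputMap 𝕜 P (act γ φ) = inputMap 𝕜 P φ)
    (horb : ∀ φ ∈ configSpace L Z, ∀ ψ ∈ configSpace L Z, inputMap 𝕜 P φ = inputMap 𝕜 P ψ →
      ∃ γ, act γ φ = ψ)
    (hfree : ∀ γ, ∀ φ ∈ configSpace L Z, inputMap 𝕜 P φ ∉ W → act γ φ = φ → γ = 1)
    (hBK : Metric.closedBall O r ⊆ interior K) (hBW : Disjoint (Metric.closedBall O r) W)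
    (hdist : Function.Injective (Sum.elim P Q))
    (hin : ∀ φ ∈ configSpace L Z, ∀ i, φ (P i) = RCLike.map 𝕜 ℂ (inputMap 𝕜 P φ i))
    (hout : ∀ φ ∈ configSpace L Z, ∀ j, φ (Q j) = RCLike.map 𝕜 ℂ (F (inputMap 𝕜 P φ) j)) :
    RealizesOver L Z P Q F O (Metric.closedBall O r) := by
  have hO : O ∈ Metric.closedBall O r := Metric.mem_closedBall_self hr.le
  have hDom : Dom 𝕜 L Z P = K := h.image_eq
  have hreg : configSpace L Z ∩ inputMap 𝕜 P ⁻¹' Metric.closedBall O r ⊆ regularPoints 𝕜 L Z P := by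
    rintro φ ⟨hφ, hφB⟩
    have hφW := disjoint_left.1 hBW hφB
    refine ⟨hφ, congrAt_pi_iff.2 fun i => ?_, h.isIsoAt (analyticAt_inputMap 𝕜 P) hφ (hBK hφB) hφW⟩
    obtain ⟨hφK, k, hk⟩ := h.exists_eq φ hφ
    -- Scheme-theoretically the inputs lie in `𝕜` because `ψ` is congruent to `Φ k` of its input,
    -- which is a configuration for all `ψ` near `φ`.
    have hc := congrAt_pi_iff.1 (h.congrAt k _ ⟨hφK, hφW⟩) (P i)
    rw [← hk] at hc
    refine hc.congr ?_
    filter_upwards [(analyticAt_inputMap 𝕜 P φ).continuousAt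
      (mem_interior_iff_mem_nhds.1 (hBK hφB))] with ψ hψ
    rw [hin _ (h.mem k _ hψ) i, h.proj k _ hψ]
  have hstar : Metric.closedBall O r ⊆ DomStar 𝕜 L Z P := by
    intro x hx
    have hxK : x ∈ Dom 𝕜 L Z P := by rw [hDom]; exact interior_subset (hBK hx)
    obtain ⟨φ, hφ, rfl⟩ := hxK
    exact ⟨φ, hreg ⟨hφ, hx⟩, rfl⟩
  refine ⟨⟨hdist, hin, ?_, ?_, hstar hO, hout⟩, hstar, ?_, ?_, hreg⟩
  · rw [hDom]; exact ⟨O, hBK hO⟩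
  · refine ⟨_, h.isRegularBranchedCovering (continuous_inputMap 𝕜 P) hK hW hd ha hpa horb hfree, ?_⟩
    rintro _ ⟨γ, rfl⟩
    exact ha.isAutOver hpa γ
  · rw [hDom]; exact hBK
  · have : ProperSpace (EuclideanSpace 𝕜 (Fin m)) := FiniteDimensional.proper 𝕜 _
    exact h.isAnalyticallyTrivialOver (analyticAt_inputMap 𝕜 P) (isCompact_closedBall O r)
      (convex_closedBall O r).isPreconnected (hBK.trans interior_subset) hBW

end Action

/-! ### Reflections in the line through two points. -/

section Reflection

/-- Reflection of `z` in the line through `a` and `b` (the identity if `a = b`). -/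
def refl (a b z : ℂ) : ℂ :=
  open Classical in if a = b then z else a + (b - a) / conj (b - a) * conj (z - a)

theorem refl_of_ne {a b : ℂ} (h : a ≠ b) (z : ℂ) :
    refl a b z = a + (b - a) / conj (b - a) * conj (z - a) := if_neg h

theorem conj_sub_ne_zero {a b : ℂ} (h : a ≠ b) : conj b - conj a ≠ 0 := by
  exact sub_ne_zero.2 fun e => h ((starRingEnd ℂ).injective e).symm

/-- In coordinates relative to the segment from `a` to `b`, the reflection is complex conjugation.
All cells are described in these coordinates. -/
theorem refl_add_mul (a b z : ℂ) (h : a ≠ b) :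
    refl a b (a + (b - a) * z) = a + (b - a) * conj z := by
  have h1 := conj_sub_ne_zero h
  rw [refl_of_ne h]
  simp only [map_sub, map_mul, add_sub_cancel_left]
  field_simp

theorem refl_left (a b : ℂ) : refl a b a = a := by
  by_cases h : a = b
  · simp [refl, h]
  · simp [refl_of_ne h]

theorem refl_right (a b : ℂ) : refl a b b = b := by
  by_cases h : a = b
  · simp [refl, h]
  · simpa using refl_add_mul a b 1 h

theorem refl_refl (a b z : ℂ) : refl a b (refl a b z) = z := by
  by_cases h : a = b
  · simp [refl, h]
  · have hz : z = a + (b - a) * ((z - a) / (b - a)) := by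
      have : b - a ≠ 0 := sub_ne_zero.2 (Ne.symm h)
      field_simp
      ring
    rw [hz, refl_add_mul _ _ _ h, refl_add_mul _ _ _ h, Complex.conj_conj]

theorem refl_sub_refl {a b : ℂ} (h : a ≠ b) (z w : ℂ) :
    refl a b z - refl a b w = (b - a) / conj (b - a) * conj (z - w) := by
  simp only [refl_of_ne h, map_sub]
  ring

theorem normSq_refl_sub (a b z w : ℂ) :
    Complex.normSq (refl a b z - refl a b w) = Complex.normSq (z - w) := by
  by_cases h : a = b
  · simp [refl, h]
  · rw [refl_sub_refl h]
    have : Complex.normSq (b - a) ≠ 0 := by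
      simpa [sub_eq_zero] using Ne.symm h
    simp only [Complex.normSq_mul, Complex.normSq_div, Complex.normSq_conj]
    field_simp

theorem refl_affine (a b z w : ℂ) {p q : ℝ} (hpq : p + q = 1) :
    refl a b (p • z + q • w) = p • refl a b z + q • refl a b w := by
  by_cases h : a = b
  · simp [refl, h]
  · have : (p : ℂ) + q = 1 := by exact_mod_cast hpq
    simp only [refl_of_ne h, Complex.real_smul, map_sub, map_add, map_mul, Complex.conj_ofReal]
    linear_combination (a - (b - a) / (conj b - conj a) * conj a) * (-this)

theorem conj_refl (a b z : ℂ) : conj (refl a b z) = refl (conj a) (conj b) (conj z) := by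
  by_cases h : a = b
  · simp [refl, h]
  · have h' : conj a ≠ conj b := fun e => h (star_injective e)
    simp [refl_of_ne h, refl_of_ne h']

variable {E : Type*} [NormedAddCommGroup E] [NormedSpace ℝ E] {S : Set (E → ℝ)} {x : E}
  {a b z w : E → ℂ}

theorem refl_eventuallyEq (ha : AnalyticAt ℝ a x) (hb : AnalyticAt ℝ b x) (h : a x ≠ b x)
    (z : E → ℂ) : (fun y => refl (a y) (b y) (z y)) =ᶠ[𝓝 x]
      fun y => a y + (b y - a y) / conj (b y - a y) * conj (z y - a y) := by
  filter_upwards [ha.continuousAt.ne_iff_eventually_ne hb.continuousAt |>.1 h] with y hy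
  exact refl_of_ne hy _

theorem analyticAt_refl (ha : AnalyticAt ℝ a x) (hb : AnalyticAt ℝ b x) (hz : AnalyticAt ℝ z x)
    (h : a x ≠ b x) : AnalyticAt ℝ (fun y => refl (a y) (b y) (z y)) x := by
  refine AnalyticAt.congr ?_ (refl_eventuallyEq ha hb h z).symm
  have hne : conj (b x - a x) ≠ 0 := by
    rw [map_sub]; exact conj_sub_ne_zero h
  have h1 : AnalyticAt ℝ (fun y => conj (b y - a y)) x := by fun_prop
  exact ha.add (((hb.sub ha).div h1 hne).mul (analyticAt_conj (hz.sub ha)))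

theorem CMem.refl (ha : AnalyticAt ℝ a x) (hb : AnalyticAt ℝ b x) (h : a x ≠ b x)
    (hzw : CMem S x fun y => z y - w y) :
    CMem S x fun y => refl (a y) (b y) (z y) - refl (a y) (b y) (w y) := by
  have hne : conj (b x - a x) ≠ 0 := by
    rw [map_sub]; exact conj_sub_ne_zero h
  have h1 : AnalyticAt ℝ (fun y => conj (b y - a y)) x := by fun_prop
  refine (hzw.conjugate.mul_left (a := fun y => (b y - a y) / conj (b y - a y))
    ((hb.sub ha).div h1 hne)).congr ?_
  filter_upwards [ha.continuousAt.ne_iff_eventually_ne hb.continuousAt |>.1 h] with y hy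
  exact refl_sub_refl hy _ _

/-- The identity or the reflection in the line through `a` and `b`. -/
def twist (δ : ℤˣ) (a b z : ℂ) : ℂ := if δ = 1 then z else refl a b z

theorem twist_one (a b z : ℂ) : twist 1 a b z = z := if_pos rfl

theorem twist_mul (δ δ' : ℤˣ) (a b z : ℂ) :
    twist (δ * δ') a b z = twist δ a b (twist δ' a b z) := by
  rcases Int.units_eq_one_or δ with rfl | rfl <;> rcases Int.units_eq_one_or δ' with rfl | rfl <;>
    simp [twist, refl_refl]

theorem twist_affine (δ : ℤˣ) (a b z w : ℂ) {p q : ℝ} (hpq : p + q = 1) :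
    twist δ a b (p • z + q • w) = p • twist δ a b z + q • twist δ a b w := by
  unfold twist
  split_ifs
  · rfl
  · exact refl_affine a b z w hpq

theorem normSq_twist_sub (δ : ℤˣ) (a b z w : ℂ) :
    Complex.normSq (twist δ a b z - twist δ a b w) = Complex.normSq (z - w) := by
  unfold twist
  split_ifs
  · rfl
  · exact normSq_refl_sub a b z w

theorem conj_twist (δ : ℤˣ) (a b z : ℂ) :
    conj (twist δ a b z) = twist δ (conj a) (conj b) (conj z) := by
  unfold twist
  split_ifs
  · rfl
  · exact conj_refl a b z

theorem analyticAt_twist (δ : ℤˣ) (ha : AnalyticAt ℝ a x) (hb : AnalyticAt ℝ b x)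
    (hz : AnalyticAt ℝ z x) (h : a x ≠ b x) :
    AnalyticAt ℝ (fun y => twist δ (a y) (b y) (z y)) x := by
  unfold twist
  split_ifs
  · exact hz
  · exact analyticAt_refl ha hb hz h

theorem CMem.twist (δ : ℤˣ) (ha : AnalyticAt ℝ a x) (hb : AnalyticAt ℝ b x) (h : a x ≠ b x)
    (hzw : CMem S x fun y => z y - w y) :
    CMem S x fun y => twist δ (a y) (b y) (z y) - twist δ (a y) (b y) (w y) := by
  unfold Linkage.twist
  split_ifs
  · exact hzw
  · exact hzw.refl ha hb h

theorem CMem.twist_sub_self (δ : ℤˣ)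
    (h : CMem S x fun y => Linkage.refl (a y) (b y) (z y) - z y) :
    CMem S x fun y => Linkage.twist δ (a y) (b y) (z y) - z y := by
  unfold Linkage.twist
  split_ifs
  · exact CMem.of_eventually_eq_zero (by simp)
  · exact h

end Reflection

/-! ### The group of signs acting by reflections of labelled vertices. -/

section LabelAction

variable {V κ : Type*} {label : V → Option κ} {ax bx : κ → V}

/-- Each vertex with label `k` is reflected in the line through the vertices `ax k` and `bx k`, if
the `k`-th sign is negative. -/
def labelAct (label : V → Option κ) (ax bx : κ → V) (δ : κ → ℤˣ) (φ : V → ℂ) (v : V) : ℂ :=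
  (label v).elim (φ v) fun k => twist (δ k) (φ (ax k)) (φ (bx k)) (φ v)

theorem labelAct_none (δ : κ → ℤˣ) (φ : V → ℂ) {v : V} (h : label v = none) :
    labelAct label ax bx δ φ v = φ v := by simp [labelAct, h]

theorem labelAct_some (δ : κ → ℤˣ) (φ : V → ℂ) {v : V} {k : κ} (h : label v = some k) :
    labelAct label ax bx δ φ v = twist (δ k) (φ (ax k)) (φ (bx k)) (φ v) := by
  simp [labelAct, h]

variable {s : ℕ} [Fintype V]

/-- The labels define reflections that preserve the configuration scheme. -/
structure IsReflective (L : MarkedLinkage V s) (Z : Fin s → ℂ) (label : V → Option κ)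
    (ax bx : κ → V) : Prop where
  label_ax : ∀ k, label (ax k) = none
  label_bx : ∀ k, label (bx k) = none
  label_fixed : ∀ j, label (L.fixed j) = none
  axis_ne : ∀ φ ∈ configSpace L Z, ∀ k, φ (ax k) ≠ φ (bx k)
  label_adj : ∀ v w, L.graph.Adj v w → ∀ k l, label v = some k → label w = some l → k = l
  onAxis : ∀ φ ∈ configSpace L Z, ∀ v w k, L.graph.Adj v w → label v = none → label w = some k →
    CMem (schemeEqs L Z) φ fun ψ => refl (ψ (ax k)) (ψ (bx k)) (ψ v) - ψ v

variable {L : MarkedLinkage V s} {Z : Fin s → ℂ}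

namespace IsReflective

theorem analyticAt_labelAct (h : IsReflective L Z label ax bx) (δ : κ → ℤˣ) {φ : V → ℂ}
    (hφ : φ ∈ configSpace L Z) : AnalyticAt ℝ (labelAct label ax bx δ) φ := by
  refine AnalyticAt.pi fun v => ?_
  rcases hv : label v with _ | k
  · simp only [labelAct_none δ _ hv]
    exact analyticAt_eval v φ
  · simp only [labelAct_some δ _ hv]
    exact analyticAt_twist _ (analyticAt_eval _ φ) (analyticAt_eval _ φ) (analyticAt_eval _ φ)
      (h.axis_ne φ hφ k)

/-- Near a vertex with label `k` the action is a single reflection modulo the ideal: labelled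
neighbours have the same label, and unlabelled neighbours lie on the axis, so that reflecting them
changes nothing. -/
theorem labelAct_congr (h : IsReflective L Z label ax bx) (δ : κ → ℤˣ) {φ : V → ℂ}
    (hφ : φ ∈ configSpace L Z) {v w : V} {k : κ} (hvw : v = w ∨ L.graph.Adj v w)
    (hw : label w = some k) : CMem (schemeEqs L Z) φ fun ψ =>
      labelAct label ax bx δ ψ v - twist (δ k) (ψ (ax k)) (ψ (bx k)) (ψ v) := by
  rcases hvw with rfl | hvw
  · simp only [labelAct_some δ _ hw, sub_self]
    exact CMem.zero
  · rcases hv : label v with _ | l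
    · simp only [labelAct_none δ _ hv]
      exact ((h.onAxis φ hφ v w k hvw hv hw).twist_sub_self (δ k)).symm
    · obtain rfl := h.label_adj v w hvw l k hv hw
      simp only [labelAct_some δ _ hv, sub_self]
      exact CMem.zero

/-- By `labelAct_congr` both ends of an edge with a labelled end undergo the same isometry modulo
the ideal. -/
theorem pullback_edge (h : IsReflective L Z label ax bx) (δ : κ → ℤˣ) {φ : V → ℂ}
    (hφ : φ ∈ configSpace L Z) {v w : V} (hvw : L.graph.Adj v w) :
    MemIdealAt (schemeEqs L Z) φ fun ψ => Complex.normSq (labelAct label ax bx δ ψ v -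
      labelAct label ax bx δ ψ w) - L.len s(v, w) ^ 2 := by
  have h0 : MemIdealAt (schemeEqs L Z) φ fun ψ =>
      Complex.normSq (ψ v - ψ w) - L.len s(v, w) ^ 2 :=
    MemIdealAt.of_mem (edgeEqs_subset ⟨v, w, hvw, rfl⟩)
  have hev : ∀ v, AnalyticAt ℝ (fun ψ : V → ℂ => ψ v) φ := fun v => analyticAt_eval v φ
  have hact : ∀ v, AnalyticAt ℝ (fun ψ : V → ℂ => labelAct label ax bx δ ψ v) φ := fun v =>
    (analyticAt_eval v _).fun_comp (h.analyticAt_labelAct δ hφ)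
  have key : ∀ k, (label v = some k ∨ label w = some k) → MemIdealAt (schemeEqs L Z) φ fun ψ =>
      Complex.normSq (labelAct label ax bx δ ψ v - labelAct label ax bx δ ψ w) -
        L.len s(v, w) ^ 2 := by
    intro k hk
    have ht : ∀ v, AnalyticAt ℝ (fun ψ : V → ℂ => twist (δ k) (ψ (ax k)) (ψ (bx k)) (ψ v)) φ :=
      fun v => analyticAt_twist _ (hev _) (hev _) (hev _) (h.axis_ne φ hφ k)
    have hc : ∀ u, (u = v ∨ u = w) → CMem (schemeEqs L Z) φ fun ψ =>
        labelAct label ax bx δ ψ u - twist (δ k) (ψ (ax k)) (ψ (bx k)) (ψ u) := by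
      intro u hu
      rcases hk with hk | hk
      · refine h.labelAct_congr δ hφ (w := v) ?_ hk
        rcases hu with rfl | rfl
        · exact Or.inl rfl
        · exact Or.inr hvw.symm
      · refine h.labelAct_congr δ hφ (w := w) ?_ hk
        rcases hu with rfl | rfl
        · exact Or.inr hvw
        · exact Or.inl rfl
    have hd : CMem (schemeEqs L Z) φ fun ψ =>
        (labelAct label ax bx δ ψ v - labelAct label ax bx δ ψ w) -
        (twist (δ k) (ψ (ax k)) (ψ (bx k)) (ψ v) - twist (δ k) (ψ (ax k)) (ψ (bx k)) (ψ w)) :=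
      ((hc v (Or.inl rfl)).sub (hc w (Or.inr rfl))).congr (.of_forall fun ψ => by simp; ring)
    refine ((CMem.normSq_sub ((hact v).sub (hact w)) ((ht v).sub (ht w)) hd).add h0).congr
      (.of_forall fun ψ => ?_)
    simp [normSq_twist_sub]
  rcases hv : label v with _ | k
  · rcases hw : label w with _ | k
    · simpa only [labelAct_none δ _ hv, labelAct_none δ _ hw] using h0
    · exact key k (Or.inr hw)
  · exact key k (Or.inl hv)

/-- The three vertices are mutually adjacent, so one reflection applies to all of them if any is
labelled; and reflections are affine. -/
theorem pullback_triangle (h : IsReflective L Z label ax bx) (δ : κ → ℤˣ) {φ : V → ℂ}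
    (hφ : φ ∈ configSpace L Z) {A B C : V} (hT : IsDegenerateTriangle L A B C) :
    CMem (schemeEqs L Z) φ fun ψ => labelAct label ax bx δ ψ B -
      ((L.len s(B, C) / L.len s(A, C)) • labelAct label ax bx δ ψ A +
        (L.len s(A, B) / L.len s(A, C)) • labelAct label ax bx δ ψ C) := by
  have h0 : CMem (schemeEqs L Z) φ fun ψ => ψ B - ((L.len s(B, C) / L.len s(A, C)) • ψ A +
        (L.len s(A, B) / L.len s(A, C)) • ψ C) :=
    ⟨MemIdealAt.of_mem (triangleEqs_subset ⟨A, B, C, hT, Or.inl rfl⟩),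
      MemIdealAt.of_mem (triangleEqs_subset ⟨A, B, C, hT, Or.inr rfl⟩)⟩
  obtain ⟨hAB, hBC, hAC, hlen⟩ := hT
  have hsum : L.len s(B, C) / L.len s(A, C) + L.len s(A, B) / L.len s(A, C) = 1 := by
    have := L.len_pos s(A, C) hAC
    rw [← add_div, div_eq_one_iff_eq this.ne', hlen, add_comm]
  set p := L.len s(B, C) / L.len s(A, C)
  set q := L.len s(A, B) / L.len s(A, C)
  have key : ∀ k, (label A = some k ∨ label B = some k ∨ label C = some k) →
      CMem (schemeEqs L Z) φ fun ψ => labelAct label ax bx δ ψ B -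
      (p • labelAct label ax bx δ ψ A + q • labelAct label ax bx δ ψ C) := by
    intro k hk
    have hc : ∀ u, (u = A ∨ u = B ∨ u = C) → CMem (schemeEqs L Z) φ fun ψ =>
        labelAct label ax bx δ ψ u - twist (δ k) (ψ (ax k)) (ψ (bx k)) (ψ u) := by
      intro u hu
      obtain ⟨w, hw, hkw⟩ : ∃ w, (u = w ∨ L.graph.Adj u w) ∧ label w = some k := by
        rcases hk with hk | hk | hk
        · refine ⟨A, ?_, hk⟩
          rcases hu with rfl | rfl | rfl
          exacts [Or.inl rfl, Or.inr hAB.symm, Or.inr hAC.symm]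
        · refine ⟨B, ?_, hk⟩
          rcases hu with rfl | rfl | rfl
          exacts [Or.inr hAB, Or.inl rfl, Or.inr hBC.symm]
        · refine ⟨C, ?_, hk⟩
          rcases hu with rfl | rfl | rfl
          exacts [Or.inr hAC, Or.inr hBC, Or.inl rfl]
      exact h.labelAct_congr δ hφ hw hkw
    have h1 := (h0.twist (δ k) (analyticAt_eval (ax k) φ) (analyticAt_eval (bx k) φ)
      (h.axis_ne φ hφ k))
    simp only [twist_affine _ _ _ _ _ hsum] at h1
    have hA := (hc A (by simp)).mul_left (a := fun _ => (p : ℂ)) analyticAt_const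
    have hC := (hc C (by simp)).mul_left (a := fun _ => (q : ℂ)) analyticAt_const
    refine ((h1.add (hc B (by simp))).sub (hA.add hC)).congr (.of_forall fun ψ => ?_)
    simp only [Complex.real_smul]
    ring
  rcases hA : label A with _ | k
  · rcases hB : label B with _ | k
    · rcases hC : label C with _ | k
      · simpa only [labelAct_none δ _ hA, labelAct_none δ _ hB, labelAct_none δ _ hC] using h0
      · exact key k (by simp [hC])
    · exact key k (by simp [hB])
  · exact key k (by simp [hA])

/-- The action is multiplicative because the axes are spanned by unlabelled vertices, which do not
move. -/
theorem isSchemeAction (h : IsReflective L Z label ax bx) :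
    IsSchemeAction L Z (labelAct label ax bx) where
  one φ := by
    funext v
    rcases hv : label v with _ | k
    · exact labelAct_none _ _ hv
    · rw [labelAct_some _ _ hv, Pi.one_apply, twist_one]
  mul γ γ' φ := by
    funext v
    rcases hv : label v with _ | k
    · simp only [labelAct_none _ _ hv]
    · simp only [labelAct_some _ _ hv, labelAct_none _ _ (h.label_ax k),
        labelAct_none _ _ (h.label_bx k), Pi.mul_apply, twist_mul]
  analyticAt γ φ hφ := h.analyticAt_labelAct γ hφ
  pullback γ φ hφ g hg := by
    rcases hg with (⟨v, w, hvw, rfl⟩ | ⟨j, hj⟩) | ⟨A, B, C, hT, hg⟩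
    · exact h.pullback_edge γ hφ hvw
    · have : g ∘ labelAct label ax bx γ = g := by
        rcases hj with rfl | rfl <;> funext ψ <;>
          simp [labelAct_none _ _ (h.label_fixed j)]
      rw [this]
      exact MemIdealAt.of_mem (fixedEqs_subset ⟨j, hj⟩)
    · rcases hg with rfl | rfl
      exacts [(h.pullback_triangle γ hφ hT).1, (h.pullback_triangle γ hφ hT).2]

end IsReflective

end LabelAction

/-! ### The two positions of an elbow over a segment. -/

section Elbow

/-- The position of an elbow with arms `R`, `q` over the segment from `0` to `1`, if the unit is
`√t`. -/
def elbow (R q t : ℝ) (η : ℤˣ) : ℂ :=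
  ⟨(t + R ^ 2 - q ^ 2) / (2 * t),
    ((η : ℤ) : ℝ) * Real.sqrt (R ^ 2 / t - ((t + R ^ 2 - q ^ 2) / (2 * t)) ^ 2)⟩

variable {R q t : ℝ}

/-- The factored form exhibits the triangle inequalities: the squared height is nonnegative
precisely for `t` between `(R - q) ^ 2` and `(R + q) ^ 2`, if `R` and `q` are positive. -/
theorem elbow_radicand (ht : 0 < t) : R ^ 2 / t - ((t + R ^ 2 - q ^ 2) / (2 * t)) ^ 2 =
    ((R + q) ^ 2 - t) * (t - (R - q) ^ 2) / (4 * t ^ 2) := by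
  field_simp
  ring

theorem elbow_spec (ht : 0 < t) (h1 : (R - q) ^ 2 ≤ t) (h2 : t ≤ (R + q) ^ 2) (η : ℤˣ) :
    Complex.normSq (elbow R q t η) * t = R ^ 2 ∧
      Complex.normSq (elbow R q t η - 1) * t = q ^ 2 := by
  have h0 : 0 ≤ R ^ 2 / t - ((t + R ^ 2 - q ^ 2) / (2 * t)) ^ 2 := by
    rw [elbow_radicand ht]
    exact div_nonneg (mul_nonneg (by linarith) (by linarith)) (by positivity)
  have hs := Real.mul_self_sqrt h0
  have hη : (((η : ℤ) : ℝ)) * ((η : ℤ) : ℝ) = 1 := by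
    rcases Int.units_eq_one_or η with rfl | rfl <;> simp
  set y := Real.sqrt (R ^ 2 / t - ((t + R ^ 2 - q ^ 2) / (2 * t)) ^ 2)
  have e1 : Complex.normSq (elbow R q t η) = R ^ 2 / t := by
    simp only [Complex.normSq_apply, elbow]
    linear_combination hs + y * y * hη
  have e2 : Complex.normSq (elbow R q t η - 1) = Complex.normSq (elbow R q t η) -
      2 * ((t + R ^ 2 - q ^ 2) / (2 * t)) + 1 := by
    simp [Complex.normSq_apply, elbow]
    ring
  rw [e2, e1]
  constructor <;> field_simp
  ring

theorem exists_eq_elbow {z : ℂ} (ht : 0 < t) (h1 : Complex.normSq z * t = R ^ 2)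
    (h2 : Complex.normSq (z - 1) * t = q ^ 2) : ∃ η, z = elbow R q t η := by
  have hre : z.re = (t + R ^ 2 - q ^ 2) / (2 * t) := by
    rw [eq_div_iff (by positivity), ← h1, ← h2]
    simp [Complex.normSq_apply]
    ring
  have him : z.im ^ 2 = R ^ 2 / t - ((t + R ^ 2 - q ^ 2) / (2 * t)) ^ 2 := by
    rw [← hre, ← h1, mul_div_cancel_right₀ _ ht.ne', Complex.normSq_apply]
    ring
  have hs : Real.sqrt (R ^ 2 / t - ((t + R ^ 2 - q ^ 2) / (2 * t)) ^ 2) = |z.im| := by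
    rw [← him, Real.sqrt_sq_eq_abs]
  rcases abs_choice z.im with h | h
  · exact ⟨1, Complex.ext hre (by simp [elbow, hs, h])⟩
  · exact ⟨-1, Complex.ext hre (by simp [elbow, hs, h])⟩

/-- The squared height `z.im ^ 2` is nonnegative, so its two factors cannot have opposite signs;
both cannot be negative since `(R - q) ^ 2 < (R + q) ^ 2`. -/
theorem elbow_range {z : ℂ} (hR : 0 < R) (hq : 0 < q) (ht : 0 < t)
    (h1 : Complex.normSq z * t = R ^ 2) (h2 : Complex.normSq (z - 1) * t = q ^ 2) :
    (R - q) ^ 2 ≤ t ∧ t ≤ (R + q) ^ 2 := by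
  have hre : z.re = (t + R ^ 2 - q ^ 2) / (2 * t) := by
    rw [eq_div_iff (by positivity), ← h1, ← h2]
    simp [Complex.normSq_apply]
    ring
  have him : z.im ^ 2 = R ^ 2 / t - ((t + R ^ 2 - q ^ 2) / (2 * t)) ^ 2 := by
    rw [← hre, ← h1, mul_div_cancel_right₀ _ ht.ne', Complex.normSq_apply]
    ring
  rw [elbow_radicand ht] at him
  have h0 : 0 ≤ ((R + q) ^ 2 - t) * (t - (R - q) ^ 2) := by
    rw [eq_div_iff (by positivity)] at him
    rw [← him]; positivity
  have hlt : (R - q) ^ 2 < (R + q) ^ 2 := by nlinarith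
  constructor <;> by_contra! hc
  · nlinarith
  · nlinarith

theorem elbow_im_sqrt_pos (ht : 0 < t) (h1 : (R - q) ^ 2 < t) (h2 : t < (R + q) ^ 2) :
    0 < R ^ 2 / t - ((t + R ^ 2 - q ^ 2) / (2 * t)) ^ 2 := by
  rw [elbow_radicand ht]
  exact div_pos (mul_pos (by linarith) (by linarith)) (by positivity)

theorem elbow_im_ne_zero (ht : 0 < t) (h1 : (R - q) ^ 2 < t) (h2 : t < (R + q) ^ 2) (η : ℤˣ) :
    (elbow R q t η).im ≠ 0 := by
  have := Real.sqrt_pos.2 (elbow_im_sqrt_pos ht h1 h2)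
  rcases Int.units_eq_one_or η with rfl | rfl <;> simp [elbow] <;> exact this.ne'

theorem conj_elbow (η : ℤˣ) : conj (elbow R q t η) = elbow R q t (-η) := by
  apply Complex.ext <;> simp [elbow]

theorem elbow_re (η : ℤˣ) : (elbow R q t η).re = (t + R ^ 2 - q ^ 2) / (2 * t) := rfl

theorem elbow_injective (ht : 0 < t) (h1 : (R - q) ^ 2 < t) (h2 : t < (R + q) ^ 2) :
    Function.Injective (elbow R q t) := by
  intro η η' h
  have hp := Real.sqrt_pos.2 (elbow_im_sqrt_pos ht h1 h2)
  have := congrArg Complex.im h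
  simp only [elbow] at this
  have := mul_right_cancel₀ hp.ne' this
  exact Units.ext (by exact_mod_cast this)

theorem elbow_mul (δ η : ℤˣ) : elbow R q t (δ * η) =
    if δ = 1 then elbow R q t η else conj (elbow R q t η) := by
  rcases Int.units_eq_one_or δ with rfl | rfl
  · simp
  · rw [if_neg (by decide), conj_elbow, neg_one_mul]

/-- Continuity persists where the elbow straightens and the square root ceases to be analytic. This
is what is needed over the wall. -/
theorem continuousAt_elbow (ht : 0 < t) (η : ℤˣ) : ContinuousAt (fun t => elbow R q t η) t := by
  have h : (fun t => elbow R q t η) = fun t => (((t + R ^ 2 - q ^ 2) / (2 * t) : ℝ) : ℂ) +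
      ((((η : ℤ) : ℝ) * Real.sqrt (R ^ 2 / t - ((t + R ^ 2 - q ^ 2) / (2 * t)) ^ 2) : ℝ) : ℂ) *
        Complex.I := by
    funext t
    exact Complex.mk_eq_add_mul_I _ _
  rw [h]
  have h2 : 2 * t ≠ 0 := by positivity
  have h3 := ht.ne'
  fun_prop (disch := assumption)

theorem analyticAt_elbow (ht : 0 < t) (h1 : (R - q) ^ 2 < t) (h2 : t < (R + q) ^ 2) (η : ℤˣ) :
    AnalyticAt ℝ (fun t => elbow R q t η) t := by
  have h : (fun t => elbow R q t η) = fun t => (((t + R ^ 2 - q ^ 2) / (2 * t) : ℝ) : ℂ) +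
      ((((η : ℤ) : ℝ) * Real.sqrt (R ^ 2 / t - ((t + R ^ 2 - q ^ 2) / (2 * t)) ^ 2) : ℝ) : ℂ) *
        Complex.I := by
    funext t
    exact Complex.mk_eq_add_mul_I _ _
  rw [h]
  have h2' : 2 * t ≠ 0 := by positivity
  have h3 := ht.ne'
  have hs : AnalyticAt ℝ
      (fun t => Real.sqrt (R ^ 2 / t - ((t + R ^ 2 - q ^ 2) / (2 * t)) ^ 2)) t := by
    refine (Real.contDiffAt_sqrt (n := ⊤) (elbow_im_sqrt_pos ht h1 h2).ne').analyticAt.fun_comp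
      (g := Real.sqrt)
      (f := fun t => R ^ 2 / t - ((t + R ^ 2 - q ^ 2) / (2 * t)) ^ 2) ?_
    fun_prop (disch := assumption)
  fun_prop (disch := assumption)

end Elbow

/-! ### Maps of linkages and the pullback of congruences. -/

section Morphisms

variable {V V' : Type*} {s : ℕ} {L : MarkedLinkage V s} {L' : MarkedLinkage V' s} {Z : Fin s → ℂ}

/-- A map of vertices that preserves edges, lengths and the marking. -/
structure IsLinkageMap (L : MarkedLinkage V s) (L' : MarkedLinkage V' s) (e : V → V') : Prop where
  adj : ∀ v w, L.graph.Adj v w → L'.graph.Adj (e v) (e w)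
  len : ∀ v w, L.graph.Adj v w → L'.len s(e v, e w) = L.len s(v, w)
  fixed : ∀ j, e (L.fixed j) = L'.fixed j

namespace IsLinkageMap

variable {e : V → V'}

theorem comp_mem_configSpace (h : IsLinkageMap L L' e) {φ : V' → ℂ}
    (hφ : φ ∈ configSpace L' Z) : φ ∘ e ∈ configSpace L Z := by
  rw [mem_configSpace_iff] at hφ ⊢
  refine ⟨fun v w hvw => ?_, fun j => ?_⟩
  · rw [← h.len v w hvw]
    exact hφ.1 _ _ (h.adj v w hvw)
  · rw [Function.comp_apply, h.fixed, hφ.2]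

/-- Degenerate triangles go to degenerate triangles, so generators pull back to generators and
congruences persist in larger linkages. -/
theorem comp_mem_schemeEqs (h : IsLinkageMap L L' e) {g : (V → ℂ) → ℝ}
    (hg : g ∈ schemeEqs L Z) : (g ∘ fun φ : V' → ℂ => φ ∘ e) ∈ schemeEqs L' Z := by
  rcases hg with (⟨v, w, hvw, rfl⟩ | ⟨j, hj⟩) | ⟨A, B, C, ⟨h1, h2, h3, h4⟩, hg⟩
  · refine edgeEqs_subset ⟨e v, e w, h.adj v w hvw, ?_⟩
    rw [h.len v w hvw]; rfl
  · refine fixedEqs_subset ⟨j, ?_⟩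
    rw [← h.fixed]
    rcases hj with rfl | rfl
    exacts [Or.inl rfl, Or.inr rfl]
  · refine triangleEqs_subset ⟨e A, e B, e C, ⟨h.adj _ _ h1, h.adj _ _ h2, h.adj _ _ h3, ?_⟩, ?_⟩
    · rw [h.len _ _ h1, h.len _ _ h2, h.len _ _ h3, h4]
    · rw [h.len _ _ h1, h.len _ _ h2, h.len _ _ h3]
      rcases hg with rfl | rfl
      exacts [Or.inl rfl, Or.inr rfl]

theorem analyticAt_precomp [Fintype V] [Fintype V'] (e : V → V') (φ : V' → ℂ) :
    AnalyticAt ℝ (fun φ : V' → ℂ => φ ∘ e) φ :=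
  AnalyticAt.pi fun v => analyticAt_eval (e v) φ

theorem cmem [Fintype V] [Fintype V'] (h : IsLinkageMap L L' e) {φ : V' → ℂ} {u : (V → ℂ) → ℂ}
    (hu : CMem (schemeEqs L Z) (φ ∘ e) u) : CMem (schemeEqs L' Z) φ fun ψ => u (ψ ∘ e) :=
  CMem.comp (w := fun φ : V' → ℂ => φ ∘ e) hu (analyticAt_precomp e φ)
    fun _ hg => MemIdealAt.of_mem (h.comp_mem_schemeEqs hg)

end IsLinkageMap

end Morphisms

/-! ### Cells described relative to the segment to which they are attached. -/

section Cells

/-- A system of bars that can be attached to two vertices `A`, `B` of a linkage: the new vertices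
are `W`, and lengths equal to zero mean that there is no bar. -/
structure Cell (W κ₀ : Type) where
  toA : W → ℝ
  toB : W → ℝ
  btw : W → W → ℝ
  label : W → Option κ₀
  toA_nonneg : ∀ w, 0 ≤ toA w
  toB_nonneg : ∀ w, 0 ≤ toB w
  btw_nonneg : ∀ w w', 0 ≤ btw w w'
  btw_comm : ∀ w w', btw w w' = btw w' w
  btw_self : ∀ w, btw w w = 0

variable {W κ₀ : Type}

/-- The position `a + (b - a) g(|b - a|²)`, relative to the segment from `a` to `b`. -/
def relPos (g : ℝ → ℂ) (a b : ℂ) : ℂ := a + (b - a) * g (Complex.normSq (b - a))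

/-- The bars have the right lengths when the cell is attached to points at distance `√t`, and `z`
are the positions of the new vertices in units of the segment. -/
structure Cell.Solves (c : Cell W κ₀) (t : ℝ) (z : W → ℂ) : Prop where
  toA : ∀ w, c.toA w ≠ 0 → Complex.normSq (z w) * t = c.toA w ^ 2
  toB : ∀ w, c.toB w ≠ 0 → Complex.normSq (z w - 1) * t = c.toB w ^ 2
  btw : ∀ w w', c.btw w w' ≠ 0 → Complex.normSq (z w - z w') * t = c.btw w w' ^ 2

/-- The equations of a cell with new vertices `ω`, attached at `a` and `b`, hold modulo the ideal
generated by `S`. -/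
structure Cell.EqsMem (c : Cell W κ₀) {E : Type*} [NormedAddCommGroup E] [NormedSpace ℝ E]
    (S : Set (E → ℝ)) (x : E) (a b : E → ℂ) (ω : W → E → ℂ) : Prop where
  toA : ∀ w, c.toA w ≠ 0 →
    MemIdealAt S x fun y => Complex.normSq (a y - ω w y) - c.toA w ^ 2
  toB : ∀ w, c.toB w ≠ 0 →
    MemIdealAt S x fun y => Complex.normSq (b y - ω w y) - c.toB w ^ 2
  btw : ∀ w w', c.btw w w' ≠ 0 →
    MemIdealAt S x fun y => Complex.normSq (ω w y - ω w' y) - c.btw w w' ^ 2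
  midB : ∀ w w', c.toB w ≠ 0 → c.btw w w' = c.toB w → c.toB w' = 2 * c.toB w →
    CMem S x fun y => ω w y - (b y + ω w' y) / 2
  mid : ∀ w₁ w₂ w₃, c.btw w₁ w₂ ≠ 0 → c.btw w₂ w₃ = c.btw w₁ w₂ → c.btw w₁ w₃ = 2 * c.btw w₁ w₂ →
    CMem S x fun y => ω w₂ y - (ω w₁ y + ω w₃ y) / 2

/-- The cell is solved by the analytic functions `g η`, for squared distances in `I`, and only by
them, also modulo ideals; a change of sign of `η` amounts to a reflection. -/
structure Cell.IsGood (c : Cell W κ₀) (I : Set ℝ) (g : (κ₀ → ℤˣ) → W → ℝ → ℂ) : Prop where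
  isOpen : IsOpen I
  pos : ∀ t ∈ I, 0 < t
  analyticAt : ∀ η w, ∀ t ∈ I, AnalyticAt ℝ (g η w) t
  solves : ∀ η, ∀ t ∈ I, c.Solves t fun w => g η w t
  complete : ∀ t ∈ I, ∀ z, c.Solves t z → ∃ η, ∀ w, z w = g η w t
  inj : ∀ t ∈ I, ∀ η η', (∀ w, g η w t = g η' w t) → η = η'
  mul_none : ∀ t ∈ I, ∀ δ η w, c.label w = none → g (δ * η) w t = g η w t
  mul_some : ∀ t ∈ I, ∀ δ η w k, c.label w = some k →
    g (δ * η) w t = if δ k = 1 then g η w t else conj (g η w t)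
  real : ∀ t ∈ I, ∀ η w, c.label w = none → conj (g η w t) = g η w t
  core_toA : ∀ w, c.label w = none → c.toA w = 0
  core_toB : ∀ w, c.label w = none → c.toB w = 0
  core_btw : ∀ w w', c.label w = none → c.label w' = none → c.btw w w' = 0
  label_adj : ∀ w w' k l, c.btw w w' ≠ 0 → c.label w = some k → c.label w' = some l → k = l
  congr : ∀ (E : Type) [NormedAddCommGroup E] [NormedSpace ℝ E] (S : Set (E → ℝ)) (x : E)
    (a b : E → ℂ) (ω : W → E → ℂ) (η : κ₀ → ℤˣ), AnalyticAt ℝ a x → AnalyticAt ℝ b x →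
    (∀ w, AnalyticAt ℝ (ω w) x) → Complex.normSq (b x - a x) ∈ I →
    (∀ w, ω w x = relPos (g η w) (a x) (b x)) → c.EqsMem S x a b ω →
    ∀ w, CMem S x fun y => ω w y - relPos (g η w) (a y) (b y)

theorem relPos_sub_left (g : ℝ → ℂ) (a b : ℂ) : Complex.normSq (a - relPos g a b) =
    Complex.normSq (g (Complex.normSq (b - a))) * Complex.normSq (b - a) := by
  have : a - relPos g a b = - ((b - a) * g (Complex.normSq (b - a))) := by
    simp only [relPos]; ring
  rw [this, Complex.normSq_neg, Complex.normSq_mul, mul_comm]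

theorem relPos_sub_right (g : ℝ → ℂ) (a b : ℂ) : Complex.normSq (b - relPos g a b) =
    Complex.normSq (g (Complex.normSq (b - a)) - 1) * Complex.normSq (b - a) := by
  have : b - relPos g a b = - ((b - a) * (g (Complex.normSq (b - a)) - 1)) := by
    simp only [relPos]; ring
  rw [this, Complex.normSq_neg, Complex.normSq_mul, mul_comm]

theorem relPos_sub_relPos (g h : ℝ → ℂ) (a b : ℂ) :
    Complex.normSq (relPos g a b - relPos h a b) =
    Complex.normSq (g (Complex.normSq (b - a)) - h (Complex.normSq (b - a))) *
      Complex.normSq (b - a) := by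
  have : relPos g a b - relPos h a b =
      (b - a) * (g (Complex.normSq (b - a)) - h (Complex.normSq (b - a))) := by
    simp only [relPos]; ring
  rw [this, Complex.normSq_mul, mul_comm]

theorem analyticAt_relPos {E : Type*} [NormedAddCommGroup E] [NormedSpace ℝ E] {x : E}
    {g : ℝ → ℂ} {a b : E → ℂ} (ha : AnalyticAt ℝ a x) (hb : AnalyticAt ℝ b x)
    (hg : AnalyticAt ℝ g (Complex.normSq (b x - a x))) :
    AnalyticAt ℝ (fun y => relPos g (a y) (b y)) x := by
  unfold relPos
  exact ha.add ((hb.sub ha).mul (hg.fun_comp (f := fun y => Complex.normSq (b y - a y))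
    (by fun_prop)))

end Cells

/-! ### Attaching a cell to two vertices of a linkage. -/

section Attach

variable {V W κ₀ : Type} {s : ℕ}

/-- Length of the bar from an old vertex to a new one. -/
def Cell.side (c : Cell W κ₀) (A B v : V) (w : W) : ℝ :=
  open Classical in if v = A then c.toA w else if v = B then c.toB w else 0

theorem Cell.side_left (c : Cell W κ₀) (A B : V) (w : W) : c.side A B A w = c.toA w := if_pos rfl

theorem Cell.side_right (c : Cell W κ₀) {A B : V} (h : A ≠ B) (w : W) :
    c.side A B B w = c.toB w := by simp [Cell.side, h.symm]

theorem Cell.eq_or_eq_of_side_ne_zero (c : Cell W κ₀) {A B v : V} {w : W}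
    (h : c.side A B v w ≠ 0) : v = A ∨ v = B := by
  by_contra! hne
  simp [Cell.side, hne.1, hne.2] at h

theorem Cell.side_nonneg (c : Cell W κ₀) (A B v : V) (w : W) : 0 ≤ c.side A B v w := by
  unfold Cell.side
  split_ifs
  exacts [c.toA_nonneg w, c.toB_nonneg w, le_rfl]

/-- Adjacency in the linkage with an attached cell. -/
def attachAdj (L : MarkedLinkage V s) (c : Cell W κ₀) (A B : V) : V ⊕ W → V ⊕ W → Prop
  | .inl v, .inl w => L.graph.Adj v w
  | .inl v, .inr w => c.side A B v w ≠ 0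
  | .inr w, .inl v => c.side A B v w ≠ 0
  | .inr w, .inr w' => c.btw w w' ≠ 0

/-- Lengths in the linkage with an attached cell. -/
def attachLen (L : MarkedLinkage V s) (c : Cell W κ₀) (A B : V) : V ⊕ W → V ⊕ W → ℝ
  | .inl v, .inl w => L.len s(v, w)
  | .inl v, .inr w => c.side A B v w
  | .inr w, .inl v => c.side A B v w
  | .inr w, .inr w' => c.btw w w'

/-- The linkage obtained by attaching the cell `c` at the vertices `A` and `B`. -/
def attachLinkage (L : MarkedLinkage V s) (c : Cell W κ₀) (A B : V) :
    MarkedLinkage (V ⊕ W) s where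
  graph :=
    { Adj := attachAdj L c A B
      symm := ⟨by
        rintro (v | v) (w | w) h
        · exact L.graph.adj_symm h
        · exact h
        · exact h
        · simpa only [attachAdj, c.btw_comm w v] using h⟩
      loopless := ⟨by
        rintro (v | v) h
        · exact L.graph.loopless.irrefl v h
        · exact h (c.btw_self v)⟩ }
  len := Sym2.lift ⟨attachLen L c A B, by
    rintro (v | v) (w | w)
    · simp only [attachLen, Sym2.eq_swap]
    · rfl
    · rfl
    · exact c.btw_comm v w⟩
  len_pos := by
    intro e
    induction e using Sym2.ind with
    | _ x y =>
      rcases x with v | v <;> rcases y with w | w <;> intro h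
      · exact L.len_pos s(v, w) h
      · exact lt_of_le_of_ne (c.side_nonneg A B v w) (Ne.symm h)
      · exact lt_of_le_of_ne (c.side_nonneg A B w v) (Ne.symm h)
      · exact lt_of_le_of_ne (c.btw_nonneg v w) (Ne.symm h)
  fixed := L.fixed.trans Function.Embedding.inl

variable {L : MarkedLinkage V s} {c : Cell W κ₀} {A B : V} {Z : Fin s → ℂ}

theorem isLinkageMap_inl : IsLinkageMap L (attachLinkage L c A B) Sum.inl where
  adj _ _ h := h
  len _ _ _ := rfl
  fixed _ := rfl

theorem mem_attach_configSpace_iff (hAB : A ≠ B) {φ : V ⊕ W → ℂ} :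
    φ ∈ configSpace (attachLinkage L c A B) Z ↔ φ ∘ Sum.inl ∈ configSpace L Z ∧
      (∀ w, c.toA w ≠ 0 → Complex.normSq (φ (.inl A) - φ (.inr w)) = c.toA w ^ 2) ∧
      (∀ w, c.toB w ≠ 0 → Complex.normSq (φ (.inl B) - φ (.inr w)) = c.toB w ^ 2) ∧
      ∀ w w', c.btw w w' ≠ 0 → Complex.normSq (φ (.inr w) - φ (.inr w')) = c.btw w w' ^ 2 := by
  constructor
  · intro h
    refine ⟨isLinkageMap_inl.comp_mem_configSpace h, ?_⟩
    rw [mem_configSpace_iff] at h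
    refine ⟨fun w hw => ?_, fun w hw => ?_, fun w w' hw => h.1 (.inr w) (.inr w') hw⟩
    · rw [← c.side_left A B] at hw ⊢
      exact h.1 (.inl A) (.inr w) hw
    · rw [← c.side_right hAB] at hw ⊢
      exact h.1 (.inl B) (.inr w) hw
  · rintro ⟨h, hA, hB, hW⟩
    rw [mem_configSpace_iff] at h ⊢
    have hs : ∀ v w, c.side A B v w ≠ 0 →
        Complex.normSq (φ (.inl v) - φ (.inr w)) = c.side A B v w ^ 2 := by
      intro v w hvw
      rcases c.eq_or_eq_of_side_ne_zero hvw with rfl | rfl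
      · rw [c.side_left] at hvw ⊢; exact hA w hvw
      · rw [c.side_right hAB] at hvw ⊢; exact hB w hvw
    refine ⟨?_, h.2⟩
    rintro (v | v) (w | w) hvw
    · exact h.1 v w hvw
    · exact hs v w hvw
    · rw [← neg_sub, Complex.normSq_neg]; exact hs w v hvw
    · exact hW v w hvw

/-- The midpoint equations are those of degenerate triangles with two equal short sides; all others
are edge equations. -/
theorem attach_eqsMem (hAB : A ≠ B) [Fintype V] [Fintype W] (φ : V ⊕ W → ℂ) :
    c.EqsMem (schemeEqs (attachLinkage L c A B) Z) φ (fun ψ => ψ (.inl A)) (fun ψ => ψ (.inl B))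
      fun w ψ => ψ (.inr w) := by
  have hedge : ∀ x y, (attachLinkage L c A B).graph.Adj x y →
      MemIdealAt (schemeEqs (attachLinkage L c A B) Z) φ fun ψ =>
        Complex.normSq (ψ x - ψ y) - (attachLinkage L c A B).len s(x, y) ^ 2 :=
    fun x y h => MemIdealAt.of_mem (edgeEqs_subset ⟨x, y, h, rfl⟩)
  have hmid : ∀ x y z (l : ℝ), l ≠ 0 → (attachLinkage L c A B).graph.Adj x y →
      (attachLinkage L c A B).graph.Adj y z → (attachLinkage L c A B).graph.Adj x z →
      (attachLinkage L c A B).len s(x, y) = l → (attachLinkage L c A B).len s(y, z) = l →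
      (attachLinkage L c A B).len s(x, z) = 2 * l →
      CMem (schemeEqs (attachLinkage L c A B) Z) φ fun ψ => ψ y - (ψ x + ψ z) / 2 := by
    intro x y z l hl h1 h2 h3 e1 e2 e3
    have hT : IsDegenerateTriangle (attachLinkage L c A B) x y z :=
      ⟨h1, h2, h3, by rw [e1, e2, e3]; ring⟩
    have : CMem (schemeEqs (attachLinkage L c A B) Z) φ fun ψ => ψ y -
        ((l / (2 * l)) • ψ x + (l / (2 * l)) • ψ z) := by
      refine ⟨MemIdealAt.of_mem (triangleEqs_subset ⟨x, y, z, hT, Or.inl ?_⟩),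
        MemIdealAt.of_mem (triangleEqs_subset ⟨x, y, z, hT, Or.inr ?_⟩)⟩ <;> rw [e1, e2, e3]
    refine this.congr (.of_forall fun ψ => ?_)
    have hl2 : l / (2 * l) = 1 / 2 := by field_simp
    simp only [hl2, Complex.real_smul]
    push_cast
    ring
  refine ⟨fun w hw => ?_, fun w hw => ?_, fun w w' hw => hedge (.inr w) (.inr w') hw,
    fun w w' hw h1 h2 => ?_, fun w₁ w₂ w₃ h0 h1 h2 => ?_⟩
  · rw [← c.side_left A B] at hw ⊢
    exact hedge (.inl A) (.inr w) hw
  · rw [← c.side_right hAB] at hw ⊢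
    exact hedge (.inl B) (.inr w) hw
  · refine hmid (.inl B) (.inr w) (.inr w') (c.toB w) hw ?_ ?_ ?_ (c.side_right hAB w) h1
      ((c.side_right hAB w').trans h2)
    · exact fun h => hw ((c.side_right hAB w).symm.trans h)
    · exact fun h => hw (h1.symm.trans h)
    · refine fun h => hw ?_
      have := (c.side_right hAB w').symm.trans h
      linarith
  · refine hmid (.inr w₁) (.inr w₂) (.inr w₃) (c.btw w₁ w₂) h0 h0 ?_ ?_ rfl h1 h2
    · exact fun h => h0 (h1.symm.trans h)
    · refine fun h => h0 ?_
      have h : c.btw w₁ w₃ = 0 := h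
      linarith

end Attach

/-! ### Mechanisms and their extension by cells. -/

section Mechanisms

variable {ι : Type} [Fintype ι] {s : ℕ}

/-- A linkage with free inputs `y ∈ D`, whose vertices are core vertices, at analytic functions of
`y`, and labelled vertices, whose positions depend on `y` and on a family of signs. Changes of signs
amount to reflections. -/
structure Mechanism (ι : Type) [Fintype ι] {s : ℕ} (Z : Fin s → ℂ) (D Wall : Set (ι → ℂ)) where
  V : Type
  [fintypeV : Fintype V]
  κ : Type
  [finiteκ : Finite κ]
  L : MarkedLinkage V s
  label : V → Option κ
  ax : κ → V
  bx : κ → V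
  inp : ι → V
  F : V → (ι → ℂ) → ℂ
  sec : (κ → ℤˣ) → (ι → ℂ) → V → ℂ
  reflective : IsReflective L Z label ax bx
  inp_injective : Function.Injective inp
  label_inp : ∀ i, label (inp i) = none
  F_inp : ∀ i y, F (inp i) y = y i
  F_analyticAt : ∀ v, label v = none → ∀ y ∈ D, AnalyticAt ℝ (F v) y
  core_congr : ∀ φ ∈ configSpace L Z, ∀ v, label v = none →
    CMem (schemeEqs L Z) φ fun ψ => ψ v - F v (ψ ∘ inp)
  core_adj : ∀ v w, L.graph.Adj v w → label v = none → label w = none →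
    v ∈ range L.fixed ∧ w ∈ range L.fixed
  sections : IsSectionFamily L Z (fun φ => φ ∘ inp) D Wall sec
  sec_mul : ∀ δ ε, ∀ y ∈ D, labelAct label ax bx δ (sec ε y) = sec (δ * ε) y

attribute [instance] Mechanism.fintypeV Mechanism.finiteκ

variable {Z : Fin s → ℂ} {D Wall : Set (ι → ℂ)}

namespace Mechanism

/-- An extension of mechanisms. -/
structure Hom (M M' : Mechanism ι Z D Wall) where
  e : M.V → M'.V
  injective : Function.Injective e
  isLinkageMap : IsLinkageMap M.L M'.L e
  map_inp : ∀ i, e (M.inp i) = M'.inp i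
  label_eq : ∀ v, M.label v = none → M'.label (e v) = none
  F_eq : ∀ v, M'.F (e v) = M.F v

/-- The identity extension. -/
def Hom.refl (M : Mechanism ι Z D Wall) : Hom M M :=
  ⟨id, fun _ _ h => h, ⟨fun _ _ h => h, fun _ _ _ => rfl, fun _ => rfl⟩, fun _ => rfl,
    fun _ h => h, fun _ => rfl⟩

/-- Composition of extensions. -/
def Hom.trans {M M' M'' : Mechanism ι Z D Wall} (f : Hom M M') (g : Hom M' M'') : Hom M M'' where
  e := g.e ∘ f.e
  injective := g.injective.comp f.injective
  isLinkageMap :=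
    ⟨fun v w h => g.isLinkageMap.adj _ _ (f.isLinkageMap.adj v w h),
      fun v w h => (g.isLinkageMap.len _ _ (f.isLinkageMap.adj v w h)).trans
        (f.isLinkageMap.len v w h),
      fun j => by rw [Function.comp_apply, f.isLinkageMap.fixed, g.isLinkageMap.fixed]⟩
  map_inp i := by rw [Function.comp_apply, f.map_inp, g.map_inp]
  label_eq v h := g.label_eq _ (f.label_eq v h)
  F_eq v := by rw [Function.comp_apply, g.F_eq, f.F_eq]

theorem core_eq (M : Mechanism ι Z D Wall) {φ : M.V → ℂ} (hφ : φ ∈ configSpace M.L Z) {v : M.V}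
    (hv : M.label v = none) : φ v = M.F v (φ ∘ M.inp) :=
  sub_eq_zero.1 ((M.core_congr φ hφ v hv).eq_zero fun _ hg => schemeEqs_eq_zero hφ hg)

theorem sec_core (M : Mechanism ι Z D Wall) (ε : M.κ → ℤˣ) {y : ι → ℂ} (hy : y ∈ D) {v : M.V}
    (hv : M.label v = none) : M.sec ε y v = M.F v y := by
  rw [M.core_eq (M.sections.mem ε y hy) hv, M.sections.proj ε y hy]

theorem inp_mem (M : Mechanism ι Z D Wall) {φ : M.V → ℂ} (hφ : φ ∈ configSpace M.L Z) :
    φ ∘ M.inp ∈ D := (M.sections.exists_eq φ hφ).1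

variable {W κ₀ : Type} {c : Cell W κ₀} {I : Set ℝ}
  {g : (κ₀ → ℤˣ) → W → ℝ → ℂ}

/-- The sections of a mechanism with an attached cell. -/
def attachSec (M : Mechanism ι Z D Wall) (g : (κ₀ → ℤˣ) → W → ℝ → ℂ) (A B : M.V)
    (ε : M.κ ⊕ κ₀ → ℤˣ) (y : ι → ℂ) : M.V ⊕ W → ℂ :=
  Sum.elim (M.sec (ε ∘ Sum.inl) y) fun w => relPos (g (ε ∘ Sum.inr) w) (M.F A y) (M.F B y)

/-- The labels of a mechanism with an attached cell. -/
def attachLabel (M : Mechanism ι Z D Wall) (c : Cell W κ₀) : M.V ⊕ W → Option (M.κ ⊕ κ₀) :=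
  Sum.elim (fun v => (M.label v).map Sum.inl) fun w => (c.label w).map Sum.inr

variable (M : Mechanism ι Z D Wall) {A B : M.V}

/-- The cell determines its vertices relative to the actual positions of `A` and `B`. These are
congruent to functions of the inputs, which may be substituted by `CongrAt.comp_left`. -/
theorem attach_core_congr [Fintype W] (hg : c.IsGood I g) (hA : M.label A = none) (hB : M.label B = none)
    (hAB : A ≠ B) (hI : ∀ y ∈ D, Complex.normSq (M.F B y - M.F A y) ∈ I) {φ : M.V ⊕ W → ℂ}
    (hφ : φ ∈ configSpace (attachLinkage M.L c A B) Z) (η : κ₀ → ℤˣ)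
    (hη : ∀ w, φ (.inr w) = relPos (g η w) (φ (.inl A)) (φ (.inl B))) (w : W) :
    CMem (schemeEqs (attachLinkage M.L c A B) Z) φ
      (fun ψ => ψ (.inr w) - relPos (g η w) (ψ (.inl A)) (ψ (.inl B))) ∧
    CMem (schemeEqs (attachLinkage M.L c A B) Z) φ (fun ψ => ψ (.inr w) -
      relPos (g η w) (M.F A (ψ ∘ Sum.inl ∘ M.inp)) (M.F B (ψ ∘ Sum.inl ∘ M.inp))) := by
  have hφ' := (isLinkageMap_inl (L := M.L) (c := c) (A := A) (B := B)).comp_mem_configSpace hφ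
  have hy := M.inp_mem hφ'
  have eA := M.core_eq hφ' hA
  have eB := M.core_eq hφ' hB
  simp only [Function.comp_apply] at eA eB
  have hI' := hI _ hy
  have hIφ : Complex.normSq (φ (.inl B) - φ (.inl A)) ∈ I := by rw [eA, eB]; exact hI'
  have h1 := hg.congr (M.V ⊕ W → ℂ) (schemeEqs (attachLinkage M.L c A B) Z) φ
    (fun ψ => ψ (.inl A)) (fun ψ => ψ (.inl B)) (fun w ψ => ψ (.inr w)) η (analyticAt_eval _ _)
    (analyticAt_eval _ _) (fun w => analyticAt_eval _ _) hIφ hη (attach_eqsMem hAB φ) w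
  refine ⟨h1, h1.trans ?_⟩
  have cA := isLinkageMap_inl (c := c) (A := A) (B := B) |>.cmem (M.core_congr _ hφ' A hA)
  have cB := isLinkageMap_inl (c := c) (A := A) (B := B) |>.cmem (M.core_congr _ hφ' B hB)
  have anF : ∀ v, M.label v = none → AnalyticAt ℝ
      (fun ψ : M.V ⊕ W → ℂ => M.F v (ψ ∘ Sum.inl ∘ M.inp)) φ := fun v hv =>
    (M.F_analyticAt v hv _ hy).fun_comp (g := M.F v)
      (f := fun ψ : M.V ⊕ W → ℂ => ψ ∘ Sum.inl ∘ M.inp)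
      (IsLinkageMap.analyticAt_precomp (Sum.inl ∘ M.inp) φ)
  have hpair : CongrAt (schemeEqs (attachLinkage M.L c A B) Z) φ
      (fun ψ => (ψ (.inl A), ψ (.inl B))) fun ψ => (M.F A (ψ ∘ Sum.inl ∘ M.inp),
        M.F B (ψ ∘ Sum.inl ∘ M.inp)) :=
    (congrAt_complex_iff.2 cA).prod (congrAt_complex_iff.2 cB)
  refine congrAt_complex_iff.1 (hpair.comp_left (h := fun ab => relPos (g η w) ab.1 ab.2)
    ((analyticAt_eval _ _).prod (analyticAt_eval _ _)) ((anF A hA).prod (anF B hB))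
    (Prod.ext eA eB) ?_)
  exact analyticAt_relPos analyticAt_fst analyticAt_snd (hg.analyticAt η w _ hIφ)

/-- The coordinates `(z - a) / (b - a)` reduce the cell at `a`, `b` to the normalized segment from
`0` to `1`, for which `IsGood` lists all solutions. -/
theorem attach_exists (hg : c.IsGood I g) (hA : M.label A = none) (hB : M.label B = none)
    (hAB : A ≠ B) (hI : ∀ y ∈ D, Complex.normSq (M.F B y - M.F A y) ∈ I) {φ : M.V ⊕ W → ℂ}
    (hφ : φ ∈ configSpace (attachLinkage M.L c A B) Z) :
    ∃ η : κ₀ → ℤˣ, ∀ w, φ (.inr w) = relPos (g η w) (φ (.inl A)) (φ (.inl B)) := by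
  obtain ⟨hφ', h1, h2, h3⟩ := (mem_attach_configSpace_iff hAB).1 hφ
  have eA := M.core_eq hφ' hA
  have eB := M.core_eq hφ' hB
  simp only [Function.comp_apply] at eA eB
  have hIφ : Complex.normSq (φ (.inl B) - φ (.inl A)) ∈ I := by
    rw [eA, eB]; exact hI _ (M.inp_mem hφ')
  have hba : φ (.inl B) - φ (.inl A) ≠ 0 := Complex.normSq_pos.1 (hg.pos _ hIφ)
  set a := φ (.inl A)
  set b := φ (.inl B)
  have hz : ∀ w, φ (.inr w) = relPos (fun _ => (φ (.inr w) - a) / (b - a)) a b := by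
    intro w
    simp only [relPos]
    field_simp
    ring
  obtain ⟨η, hη⟩ := hg.complete _ hIφ (fun w => (φ (.inr w) - a) / (b - a))
    ⟨fun w hw => by
        have := h1 w hw
        rw [hz w, relPos_sub_left] at this
        exact this,
      fun w hw => by
        have := h2 w hw
        rw [hz w, relPos_sub_right] at this
        exact this,
      fun w w' hw => by
        have := h3 w w' hw
        rw [hz w, hz w', relPos_sub_relPos] at this
        exact this⟩
  refine ⟨η, fun w => ?_⟩
  rw [hz w]
  simp only [relPos, hη w]

theorem attachLabel_inl {v : M.V} (h : M.label v = none) :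
    M.attachLabel c (.inl v) = none := by simp [attachLabel, h]

/-- The new axes pass through `A` and `B`. The old neighbours of new vertices are `A` and `B`
themselves; an unlabelled new vertex has a real coordinate relative to them, so it lies on the axis.
-/
theorem attach_reflective [Fintype W] (hg : c.IsGood I g) (hA : M.label A = none) (hB : M.label B = none)
    (hAB : A ≠ B) (hI : ∀ y ∈ D, Complex.normSq (M.F B y - M.F A y) ∈ I) :
    IsReflective (attachLinkage M.L c A B) Z (M.attachLabel c)
      (Sum.elim (Sum.inl ∘ M.ax) fun _ => Sum.inl A)
      (Sum.elim (Sum.inl ∘ M.bx) fun _ => Sum.inl B) where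
  label_ax k := by
    rcases k with k | k
    · exact M.attachLabel_inl (M.reflective.label_ax k)
    · exact M.attachLabel_inl hA
  label_bx k := by
    rcases k with k | k
    · exact M.attachLabel_inl (M.reflective.label_bx k)
    · exact M.attachLabel_inl hB
  label_fixed j := M.attachLabel_inl (M.reflective.label_fixed j)
  axis_ne φ hφ k := by
    have hφ' := isLinkageMap_inl.comp_mem_configSpace hφ
    rcases k with k | k
    · exact M.reflective.axis_ne _ hφ' k
    · have eA := M.core_eq hφ' hA
      have eB := M.core_eq hφ' hB
      simp only [Function.comp_apply] at eA eB
      simp only [Sum.elim_inr, eA, eB]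
      exact (sub_ne_zero.1 (Complex.normSq_pos.1 (hg.pos _ (hI _ (M.inp_mem hφ'))))).symm
  label_adj x y hxy k l hk hl := by
    have haux : ∀ v w, c.side A B v w ≠ 0 → M.attachLabel c (.inl v) = none := by
      intro v w hvw
      rcases c.eq_or_eq_of_side_ne_zero hvw with rfl | rfl
      exacts [M.attachLabel_inl hA, M.attachLabel_inl hB]
    rcases x with v | v <;> rcases y with w | w
    · simp only [attachLabel, Sum.elim_inl, Option.map_eq_some_iff] at hk hl
      obtain ⟨k', hk', rfl⟩ := hk
      obtain ⟨l', hl', rfl⟩ := hl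
      rw [M.reflective.label_adj v w hxy k' l' hk' hl']
    · rw [haux v w hxy] at hk; cases hk
    · rw [haux w v hxy] at hl; cases hl
    · simp only [attachLabel, Sum.elim_inr, Option.map_eq_some_iff] at hk hl
      obtain ⟨k', hk', rfl⟩ := hk
      obtain ⟨l', hl', rfl⟩ := hl
      rw [hg.label_adj v w k' l' hxy hk' hl']
  onAxis φ hφ x y k hxy hx hy := by
    have hφ' := isLinkageMap_inl.comp_mem_configSpace hφ
    rcases x with v | v <;> rcases y with w | w
    · simp only [attachLabel, Sum.elim_inl, Option.map_eq_some_iff, Option.map_eq_none_iff] at hx hy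
      obtain ⟨k', hk', rfl⟩ := hy
      exact isLinkageMap_inl.cmem (M.reflective.onAxis _ hφ' v w k' hxy hx hk')
    · simp only [attachLabel, Sum.elim_inr, Option.map_eq_some_iff] at hy
      obtain ⟨k', hk', rfl⟩ := hy
      rcases c.eq_or_eq_of_side_ne_zero (v := v) (w := w) hxy with rfl | rfl
      · exact CMem.of_eventually_eq_zero (.of_forall fun ψ => by simp [Linkage.refl_left])
      · exact CMem.of_eventually_eq_zero (.of_forall fun ψ => by simp [Linkage.refl_right])
    · have : M.attachLabel c (.inl w) = none := by
        rcases c.eq_or_eq_of_side_ne_zero (v := w) (w := v) hxy with rfl | rfl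
        exacts [M.attachLabel_inl hA, M.attachLabel_inl hB]
      rw [this] at hy; cases hy
    · simp only [attachLabel, Sum.elim_inr, Option.map_eq_some_iff, Option.map_eq_none_iff] at hx hy
      obtain ⟨k', hk', rfl⟩ := hy
      -- The vertex is congruent to its relative position, which is exactly fixed by the reflection
      -- because its coordinate is real for all nearby distances. The reflection preserves the
      -- congruence, so the vertex is congruent to its mirror image.
      obtain ⟨η, hη⟩ := M.attach_exists hg hA hB hAB hI hφ
      have h1 := (M.attach_core_congr hg hA hB hAB hI hφ η hη v).1
      have eA := M.core_eq hφ' hA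
      have eB := M.core_eq hφ' hB
      simp only [Function.comp_apply] at eA eB
      have hIφ : Complex.normSq (φ (.inl B) - φ (.inl A)) ∈ I := by
        rw [eA, eB]; exact hI _ (M.inp_mem hφ')
      have hne : φ (.inl A) ≠ φ (.inl B) :=
        (sub_ne_zero.1 (Complex.normSq_pos.1 (hg.pos _ hIφ))).symm
      have h2 := h1.refl (a := fun ψ => ψ (.inl A)) (b := fun ψ => ψ (.inl B))
        (analyticAt_eval _ _) (analyticAt_eval _ _) hne
      have h3 : CMem (schemeEqs (attachLinkage M.L c A B) Z) φ fun ψ =>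
          Linkage.refl (ψ (.inl A)) (ψ (.inl B)) (relPos (g η v) (ψ (.inl A)) (ψ (.inl B))) -
            relPos (g η v) (ψ (.inl A)) (ψ (.inl B)) := by
        have hev : ∀ᶠ ψ in 𝓝 φ, Complex.normSq (ψ (.inl B) - ψ (.inl A)) ∈ I := by
          have : ContinuousAt (fun ψ : M.V ⊕ W → ℂ => Complex.normSq (ψ (.inl B) - ψ (.inl A))) φ :=
            (analyticAt_normSq ((analyticAt_eval _ _).sub (analyticAt_eval _ _))).continuousAt
          exact this (hg.isOpen.mem_nhds hIφ)
        refine CMem.of_eventually_eq_zero (hev.mono fun ψ hψ => ?_)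
        have hne : ψ (.inl A) ≠ ψ (.inl B) :=
          (sub_ne_zero.1 (Complex.normSq_pos.1 (hg.pos _ hψ))).symm
        rw [relPos, refl_add_mul _ _ _ hne, hg.real _ hψ η v hx, sub_self]
      exact ((h2.add h3).add h1.symm).congr (.of_forall fun ψ => by simp)

/-- The wall stays the same, since the squared distance of `A` and `B` remains in the open set `I`,
on which the cell is analytic and its solutions are distinct. -/
theorem attach_sections [Fintype W] (hg : c.IsGood I g) (hA : M.label A = none)
    (hB : M.label B = none) (hAB : A ≠ B)
    (hI : ∀ y ∈ D, Complex.normSq (M.F B y - M.F A y) ∈ I) :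
    IsSectionFamily (attachLinkage M.L c A B) Z (fun φ => φ ∘ Sum.inl ∘ M.inp) D Wall
      (M.attachSec g A B) where
  mem ε y hy := by
    rw [mem_attach_configSpace_iff hAB]
    have hs := hg.solves (ε ∘ Sum.inr) _ (hI y hy)
    refine ⟨M.sections.mem _ y hy, fun w hw => ?_, fun w hw => ?_, fun w w' hw => ?_⟩ <;>
      simp only [attachSec, Sum.elim_inl, Sum.elim_inr, M.sec_core _ hy hA, M.sec_core _ hy hB]
    · rw [relPos_sub_left]; exact hs.toA w hw
    · rw [relPos_sub_right]; exact hs.toB w hw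
    · rw [relPos_sub_relPos]; exact hs.btw w w' hw
  proj ε y hy := M.sections.proj _ y hy
  cont ε := by
    refine continuousOn_pi.2 fun x => ?_
    rcases x with v | w
    · exact continuousOn_pi.1 (M.sections.cont (ε ∘ Sum.inl)) v
    · intro y hy
      exact (analyticAt_relPos (M.F_analyticAt A hA y hy) (M.F_analyticAt B hB y hy)
        (hg.analyticAt _ w _ (hI y hy))).continuousAt.continuousWithinAt
  analyticAt ε y hy := by
    refine AnalyticAt.pi fun x => ?_
    rcases x with v | w
    · exact (analyticAt_eval v _).fun_comp (M.sections.analyticAt (ε ∘ Sum.inl) y hy)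
    · exact analyticAt_relPos (M.F_analyticAt A hA y hy.1) (M.F_analyticAt B hB y hy.1)
        (hg.analyticAt _ w _ (hI y hy.1))
  exists_eq φ hφ := by
    have hφ' := isLinkageMap_inl.comp_mem_configSpace hφ
    obtain ⟨hy, ε, hε⟩ := M.sections.exists_eq _ hφ'
    obtain ⟨η, hη⟩ := M.attach_exists hg hA hB hAB hI hφ
    refine ⟨hy, Sum.elim ε η, ?_⟩
    funext x
    rcases x with v | w
    · exact congrFun hε v
    · rw [hη w]
      have eA := M.core_eq hφ' hA
      have eB := M.core_eq hφ' hB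
      simp only [Function.comp_apply] at eA eB
      rw [eA, eB]
      rfl
  inj y hy ε ε' h := by
    have h1 : ε ∘ Sum.inl = ε' ∘ Sum.inl :=
      M.sections.inj y hy _ _ (funext fun v => congrFun h (.inl v))
    have h2 : ε ∘ Sum.inr = ε' ∘ Sum.inr := by
      refine hg.inj _ (hI y hy.1) _ _ fun w => ?_
      have hw := congrFun h (.inr w)
      simp only [attachSec, Sum.elim_inr, relPos, add_right_inj] at hw
      exact mul_left_cancel₀ (Complex.normSq_pos.1 (hg.pos _ (hI y hy.1))) hw
    funext k
    rcases k with k | k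
    exacts [congrFun h1 k, congrFun h2 k]
  congrAt ε y hy := by
    refine congrAt_pi_iff.2 fun x => ?_
    have hmem : M.attachSec g A B ε y ∈ configSpace (attachLinkage M.L c A B) Z := by
      rw [mem_attach_configSpace_iff hAB]
      have hs := hg.solves (ε ∘ Sum.inr) _ (hI y hy.1)
      refine ⟨M.sections.mem _ y hy.1, fun w hw => ?_, fun w hw => ?_, fun w w' hw => ?_⟩ <;>
        simp only [attachSec, Sum.elim_inl, Sum.elim_inr, M.sec_core _ hy.1 hA,
          M.sec_core _ hy.1 hB]
      · rw [relPos_sub_left]; exact hs.toA w hw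
      · rw [relPos_sub_right]; exact hs.toB w hw
      · rw [relPos_sub_relPos]; exact hs.btw w w' hw
    rcases x with v | w
    · have := congrAt_pi_iff.1 (M.sections.congrAt (ε ∘ Sum.inl) y hy) v
      exact isLinkageMap_inl.cmem (φ := M.attachSec g A B ε y) this
    · refine (M.attach_core_congr hg hA hB hAB hI hmem (ε ∘ Sum.inr) (fun w => ?_) w).2
      simp only [attachSec, Sum.elim_inl, Sum.elim_inr, M.sec_core _ hy.1 hA,
          M.sec_core _ hy.1 hB]

/-- The mechanism obtained by attaching a cell at two core vertices that never coincide. -/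
def attach [Fintype W] [Finite κ₀] (hg : c.IsGood I g) (hA : M.label A = none)
    (hB : M.label B = none) (hAB : A ≠ B)
    (hI : ∀ y ∈ D, Complex.normSq (M.F B y - M.F A y) ∈ I) : Mechanism ι Z D Wall where
  V := M.V ⊕ W
  κ := M.κ ⊕ κ₀
  L := attachLinkage M.L c A B
  label := M.attachLabel c
  ax := Sum.elim (Sum.inl ∘ M.ax) fun _ => Sum.inl A
  bx := Sum.elim (Sum.inl ∘ M.bx) fun _ => Sum.inl B
  inp := Sum.inl ∘ M.inp
  -- The signs `1` are an arbitrary choice: the positions of unlabelled vertices do not depend on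
  -- them, and for labelled vertices `F` is a default value.
  F := Sum.elim M.F fun w y => relPos (g 1 w) (M.F A y) (M.F B y)
  sec := M.attachSec g A B
  reflective := M.attach_reflective hg hA hB hAB hI
  inp_injective := Sum.inl_injective.comp M.inp_injective
  label_inp i := M.attachLabel_inl (M.label_inp i)
  F_inp i y := M.F_inp i y
  F_analyticAt x hx y hy := by
    rcases x with v | w
    · simp only [attachLabel, Sum.elim_inl, Option.map_eq_none_iff] at hx
      exact M.F_analyticAt v hx y hy
    · exact analyticAt_relPos (M.F_analyticAt A hA y hy) (M.F_analyticAt B hB y hy)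
        (hg.analyticAt _ w _ (hI y hy))
  core_congr φ hφ x hx := by
    rcases x with v | w
    · simp only [attachLabel, Sum.elim_inl, Option.map_eq_none_iff] at hx
      exact isLinkageMap_inl.cmem
        (M.core_congr _ (isLinkageMap_inl.comp_mem_configSpace hφ) v hx)
    · simp only [attachLabel, Sum.elim_inr, Option.map_eq_none_iff] at hx
      obtain ⟨η, hη⟩ := M.attach_exists hg hA hB hAB hI hφ
      have hφ' := isLinkageMap_inl.comp_mem_configSpace hφ
      have hd : ContinuousAt (fun ψ : M.V ⊕ W → ℂ => Complex.normSq
          (M.F B (ψ ∘ Sum.inl ∘ M.inp) - M.F A (ψ ∘ Sum.inl ∘ M.inp))) φ := by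
        have hf : ∀ v, M.label v = none → ContinuousAt (fun ψ : M.V ⊕ W → ℂ =>
            M.F v (ψ ∘ Sum.inl ∘ M.inp)) φ := fun v hv =>
          ContinuousAt.comp (g := M.F v) (f := fun ψ : M.V ⊕ W → ℂ => ψ ∘ Sum.inl ∘ M.inp)
            (M.F_analyticAt v hv _ (M.inp_mem hφ')).continuousAt
            (IsLinkageMap.analyticAt_precomp (Sum.inl ∘ M.inp) φ).continuousAt
        exact Complex.continuous_normSq.continuousAt.comp ((hf B hB).sub (hf A hA))
      refine ((M.attach_core_congr hg hA hB hAB hI hφ η hη w).2).congr ?_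
      filter_upwards [hd (hg.isOpen.mem_nhds (hI _ (M.inp_mem hφ')))] with ψ hψ
      -- Changing the signs `1` into `η` does not move an unlabelled vertex.
      have := hg.mul_none _ hψ η 1 w hx
      rw [mul_one] at this
      simp only [Sum.elim_inr, relPos, this]
  -- This keeps the edges among core vertices under control, so that the bars added in the real case
  -- never duplicate an existing edge.
  core_adj x y hxy hx hy := by
    rcases x with v | v <;> rcases y with w | w <;>
      simp only [attachLabel, Sum.elim_inl, Sum.elim_inr, Option.map_eq_none_iff] at hx hy
    · obtain ⟨⟨j, rfl⟩, k, rfl⟩ := M.core_adj v w hxy hx hy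
      exact ⟨⟨j, rfl⟩, k, rfl⟩
    · refine absurd ?_ (show c.side A B v w ≠ 0 from hxy)
      simp [Cell.side, hg.core_toA w hy, hg.core_toB w hy]
    · refine absurd ?_ (show c.side A B w v ≠ 0 from hxy)
      simp [Cell.side, hg.core_toA v hx, hg.core_toB v hx]
    · exact absurd (hg.core_btw v w hx hy) hxy
  sections := M.attach_sections hg hA hB hAB hI
  sec_mul δ ε y hy := by
    funext x
    rcases x with v | w
    · have := congrFun (M.sec_mul (δ ∘ Sum.inl) (ε ∘ Sum.inl) y hy) v
      refine Eq.trans ?_ this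
      rcases hv : M.label v with _ | k
      · rw [labelAct_none _ _ hv, labelAct_none _ _ (M.attachLabel_inl hv)]
        rfl
      · rw [labelAct_some _ _ hv, labelAct_some (k := Sum.inl k) _ _ (by simp [attachLabel, hv])]
        rfl
    · have hne : M.F A y ≠ M.F B y :=
        (sub_ne_zero.1 (Complex.normSq_pos.1 (hg.pos _ (hI y hy)))).symm
      rcases hw : c.label w with _ | k
      · rw [labelAct_none _ _ (by simp [attachLabel, hw])]
        simp only [attachSec, Sum.elim_inr, relPos]
        rw [← hg.mul_none _ (hI y hy) (δ ∘ Sum.inr) _ w hw]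
        rfl
      · rw [labelAct_some (k := Sum.inr k) _ _ (by simp [attachLabel, hw])]
        simp only [attachSec, Sum.elim_inr, Sum.elim_inl, M.sec_core _ hy hA, M.sec_core _ hy hB]
        have := hg.mul_some _ (hI y hy) (δ ∘ Sum.inr) (ε ∘ Sum.inr) w k hw
        have e : (δ * ε) ∘ Sum.inr = (δ ∘ Sum.inr) * (ε ∘ (Sum.inr : κ₀ → M.κ ⊕ κ₀)) := rfl
        simp only [relPos, e, this, twist, Function.comp_apply]
        split_ifs
        · rfl
        · exact refl_add_mul _ _ _ hne

/-- The extension given by attaching a cell. -/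
def attachHom [Fintype W] [Finite κ₀] (hg : c.IsGood I g) (hA : M.label A = none)
    (hB : M.label B = none) (hAB : A ≠ B)
    (hI : ∀ y ∈ D, Complex.normSq (M.F B y - M.F A y) ∈ I) :
    Hom M (M.attach hg hA hB hAB hI) where
  e := Sum.inl
  injective := Sum.inl_injective
  isLinkageMap := isLinkageMap_inl
  map_inp _ := rfl
  label_eq _ h := M.attachLabel_inl (c := c) h
  F_eq _ := rfl

end Mechanism

end Mechanisms

/-! ### The Peaucellier inversor is a good cell. -/

section Peaucellier

/-- The Peaucellier inversor. Vertices `0`, `1` are the elbows, `2` is the image point, `3`, `4` are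
midpoints that make the rhombus rigid, and `5` is the elbow of a chain that bounds the distance
from `A` to the image point, which keeps the elbows apart. -/
def peaucellier (R q h : ℝ) (hR : 0 < R) (hq : 0 < q) (hh : 0 < h) : Cell (Fin 6) (Fin 2) where
  toA := ![R, R, 0, 0, 0, h]
  toB := ![q, q, 0, q / 2, 0, 0]
  btw := ![![0, 0, q, q / 2, 0, 0], ![0, 0, q, 0, q / 2, 0], ![q, q, 0, 0, q / 2, h],
    ![q / 2, 0, 0, 0, q, 0], ![0, q / 2, q / 2, q, 0, 0], ![0, 0, h, 0, 0, 0]]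
  label := ![some 0, some 0, none, some 0, some 0, some 1]
  toA_nonneg w := by fin_cases w <;> simp <;> positivity
  toB_nonneg w := by fin_cases w <;> simp <;> positivity
  btw_nonneg w w' := by fin_cases w <;> fin_cases w' <;> simp <;> positivity
  btw_comm w w' := by fin_cases w <;> fin_cases w' <;> rfl
  btw_self w := by fin_cases w <;> rfl

/-- Positions of the vertices of the inversor. -/
def peaucellierPos (R q h : ℝ) (η : Fin 2 → ℤˣ) (w : Fin 6) (t : ℝ) : ℂ :=
  ![elbow R q t (η 0), conj (elbow R q t (η 0)), ((R ^ 2 - q ^ 2) / t : ℝ),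
    (1 + elbow R q t (η 0)) / 2, (conj (elbow R q t (η 0)) + ((R ^ 2 - q ^ 2) / t : ℝ)) / 2,
    ((R ^ 2 - q ^ 2) / t : ℝ) * elbow h h ((R ^ 2 - q ^ 2) ^ 2 / t) (η 1)] w

/-- Squared distances at which the inversor works. -/
def peaucellierRange (R q h : ℝ) : Set ℝ :=
  {t | 0 < t ∧ (R - q) ^ 2 < t ∧ t < (R + q) ^ 2 ∧ (R ^ 2 - q ^ 2) ^ 2 / t < (2 * h) ^ 2 ∧
    (2 * h) ^ 2 < 2 * R ^ 2 + 2 * q ^ 2 - t ∧ t ≠ R ^ 2 - q ^ 2}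

variable {R q h : ℝ}

theorem isOpen_peaucellierRange : IsOpen (peaucellierRange R q h) := by
  rw [isOpen_iff_mem_nhds]
  rintro t ⟨h0, h1, h2, h3, h4, h5⟩
  have hc : ContinuousAt (fun t : ℝ => (R ^ 2 - q ^ 2) ^ 2 / t) t :=
    continuousAt_const.div continuousAt_id h0.ne'
  have hc' : ContinuousAt (fun t : ℝ => 2 * R ^ 2 + 2 * q ^ 2 - t) t := by fun_prop
  filter_upwards [lt_mem_nhds h0, lt_mem_nhds h1, gt_mem_nhds h2, hc.eventually (gt_mem_nhds h3),
    hc'.eventually (lt_mem_nhds h4), isOpen_ne.mem_nhds h5] with u a b c d e f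
  exact ⟨a, b, c, d, e, f⟩

/-- Two vectors of the same length whose sum has twice that length are equal. -/
theorem eq_of_normSq_add {u v : ℂ} {k : ℝ} (hu : Complex.normSq u = k) (hv : Complex.normSq v = k)
    (huv : Complex.normSq (u + v) = 4 * k) : u = v := by
  have : Complex.normSq (u - v) = 0 := by
    have e : Complex.normSq (u - v) =
        2 * Complex.normSq u + 2 * Complex.normSq v - Complex.normSq (u + v) := by
      simp [Complex.normSq_apply]; ring
    rw [e, hu, hv, huv]; ring
  exact sub_eq_zero.1 (Complex.normSq_eq_zero.1 this)

/-- A line meets a circle in at most two points. -/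
theorem eq_zero_of_normSq_add {w d : ℂ} {k : ℝ} (h0 : Complex.normSq w = k)
    (h1 : Complex.normSq (w + d) = k) (h2 : Complex.normSq (w + d / 2) = k) : d = 0 := by
  have : Complex.normSq d = 0 := by
    have e : Complex.normSq d =
        2 * Complex.normSq w + 2 * Complex.normSq (w + d) - 4 * Complex.normSq (w + d / 2) := by
      simp [Complex.normSq_apply]; ring
    rw [e, h0, h1, h2]; ring
  exact Complex.normSq_eq_zero.1 this

/-- The inversor identity: the fourth corner of the rhombus on `1` and the two elbows lies on the
real line, and its product with `1`, in true lengths, is `R ^ 2 - q ^ 2`. -/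
theorem two_elbow_re_sub_one {t : ℝ} (ht : 0 < t) (η : ℤˣ) :
    elbow R q t η + conj (elbow R q t η) - 1 = ((R ^ 2 - q ^ 2) / t : ℝ) := by
  rw [Complex.add_conj, elbow_re]
  have : (t : ℂ) ≠ 0 := by exact_mod_cast ht.ne'
  push_cast
  field_simp
  ring

theorem peaucellier_solves_of (hR : 0 < R) (hq : 0 < q) (hh : 0 < h) {t : ℝ} {z : Fin 6 → ℂ}
    (a0 : Complex.normSq (z 0) * t = R ^ 2) (a1 : Complex.normSq (z 1) * t = R ^ 2)
    (a5 : Complex.normSq (z 5) * t = h ^ 2) (b0 : Complex.normSq (z 0 - 1) * t = q ^ 2)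
    (b1 : Complex.normSq (z 1 - 1) * t = q ^ 2)
    (b3 : Complex.normSq (z 3 - 1) * t = (q / 2) ^ 2)
    (w02 : Complex.normSq (z 0 - z 2) * t = q ^ 2) (w12 : Complex.normSq (z 1 - z 2) * t = q ^ 2)
    (w03 : Complex.normSq (z 0 - z 3) * t = (q / 2) ^ 2)
    (w14 : Complex.normSq (z 1 - z 4) * t = (q / 2) ^ 2)
    (w42 : Complex.normSq (z 2 - z 4) * t = (q / 2) ^ 2)
    (w43 : Complex.normSq (z 3 - z 4) * t = q ^ 2)
    (w25 : Complex.normSq (z 2 - z 5) * t = h ^ 2) :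
    (peaucellier R q h hR hq hh).Solves t z := by
  have hneg : ∀ u v : ℂ, Complex.normSq (u - v) = Complex.normSq (v - u) := fun u v => by
    rw [← neg_sub, Complex.normSq_neg]
  refine ⟨fun w hw => ?_, fun w hw => ?_, fun w w' hw => ?_⟩
  · fin_cases w <;> first | assumption | exact absurd rfl hw
  · fin_cases w <;> first | assumption | exact absurd rfl hw
  · fin_cases w <;> fin_cases w' <;>
      first | assumption | exact absurd rfl hw | (refine (congrArg (· * t) (hneg _ _)).trans ?_; assumption)

theorem peaucellier_solves (hR : 0 < R) (hq : 0 < q) (hh : 0 < h) (hRq : R ≠ q) (η : Fin 2 → ℤˣ)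
    {t : ℝ} (ht : t ∈ peaucellierRange R q h) :
    (peaucellier R q h hR hq hh).Solves t fun w => peaucellierPos R q h η w t := by
  obtain ⟨h0, h1, h2, h3, h4, h5⟩ := ht
  have hρ : 0 < (R ^ 2 - q ^ 2) ^ 2 / t := by
    have : R ^ 2 - q ^ 2 ≠ 0 := by
      rw [sq_sub_sq]
      exact mul_ne_zero (by positivity) (sub_ne_zero.2 hRq)
    positivity
  obtain ⟨e1, e2⟩ := elbow_spec h0 h1.le h2.le (η 0)
  obtain ⟨e3, e4⟩ := elbow_spec (R := h) (q := h) (t := (R ^ 2 - q ^ 2) ^ 2 / t) hρ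
    (by simpa using hρ.le) (by rw [← two_mul]; exact h3.le) (η 1)
  have e0 := two_elbow_re_sub_one (R := R) (q := q) h0 (η 0)
  set e := elbow R q t (η 0)
  set ζ := elbow h h ((R ^ 2 - q ^ 2) ^ 2 / t) (η 1)
  set c := (R ^ 2 - q ^ 2) / t with hc
  -- The chain spans the segment from `A` to the image point, whose squared length is `c ^ 2 * t`.
  have hct : (R ^ 2 - q ^ 2) ^ 2 / t = c ^ 2 * t := by rw [hc]; field_simp
  rw [hct] at e3 e4
  have e2' : Complex.normSq (conj e - 1) * t = q ^ 2 := by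
    rw [← e2]; simp [Complex.normSq_apply]
  have hQ1 : Complex.normSq (e - c) * t = q ^ 2 := by
    rw [← e0, show e - (e + conj e - 1) = -(conj e - 1) by ring, Complex.normSq_neg, e2']
  have hQ2 : Complex.normSq (conj e - c) * t = q ^ 2 := by
    rw [← e0, show conj e - (e + conj e - 1) = -(e - 1) by ring, Complex.normSq_neg, e2]
  have hneg : ∀ u v : ℂ, Complex.normSq (u - v) = Complex.normSq (v - u) := fun u v => by
    rw [← neg_sub, Complex.normSq_neg]
  have hhalf : ∀ u : ℂ, Complex.normSq (u / 2) = Complex.normSq u / 4 := fun u => by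
    simp; norm_num
  have m1 : Complex.normSq ((1 + e) / 2 - 1) * t = (q / 2) ^ 2 := by
    rw [show (1 + e) / 2 - 1 = (e - 1) / 2 by ring, hhalf]; linarith
  have m2 : Complex.normSq (e - (1 + e) / 2) * t = (q / 2) ^ 2 := by
    rw [show e - (1 + e) / 2 = (e - 1) / 2 by ring, hhalf]; linarith
  have m3 : Complex.normSq (conj e - (conj e + c) / 2) * t = (q / 2) ^ 2 := by
    rw [show conj e - (conj e + c) / 2 = (conj e - c) / 2 by ring, hhalf]; linarith
  have m4 : Complex.normSq (c - (conj e + c) / 2) * t = (q / 2) ^ 2 := by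
    rw [show c - (conj e + c) / 2 = (c - conj e) / 2 by ring, hhalf, hneg]; linarith
  have m5 : Complex.normSq ((1 + e) / 2 - (conj e + c) / 2) * t = q ^ 2 := by
    rw [show (1 + e) / 2 - (conj e + c) / 2 = 1 - conj e by rw [← e0]; ring, hneg, e2']
  have n1 : Complex.normSq (c * ζ) * t = h ^ 2 := by
    rw [Complex.normSq_mul, Complex.normSq_ofReal, ← e3]; ring
  have n2 : Complex.normSq (c - c * ζ) * t = h ^ 2 := by
    rw [show (c : ℂ) - c * ζ = c * -(ζ - 1) by ring, Complex.normSq_mul, Complex.normSq_ofReal,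
      Complex.normSq_neg, ← e4]; ring
  exact peaucellier_solves_of hR hq hh e1 ((congrArg (· * t) (Complex.normSq_conj e)).trans e1) n1
    e2 e2' m1 hQ1 hQ2 m2 m3 m4 m5 n2

/-- The midpoints force the rhombus to be a parallelogram, and the chain forces its elbows to be
mirror images rather than to coincide. What remains free is one sign for the elbows and one for the
chain. -/
theorem peaucellier_complete (hR : 0 < R) (hq : 0 < q) (hh : 0 < h) (hRq : R ≠ q)
    {t : ℝ} (ht : t ∈ peaucellierRange R q h) {z : Fin 6 → ℂ}
    (hz : (peaucellier R q h hR hq hh).Solves t z) :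
    ∃ η, ∀ w, z w = peaucellierPos R q h η w t := by
  obtain ⟨h0, h1, h2, h3, h4, h5⟩ := ht
  obtain ⟨zA, zB, zW⟩ := hz
  have hR' := hR.ne'
  have hq' := hq.ne'
  have hh' := hh.ne'
  have a0 := zA 0 (by simpa [peaucellier])
  have a1 := zA 1 (by simpa [peaucellier])
  have a5 := zA 5 (by simpa [peaucellier])
  have b0 := zB 0 (by simpa [peaucellier])
  have b1 := zB 1 (by simpa [peaucellier])
  have b3 := zB 3 (by simpa [peaucellier])
  have w02 := zW 0 2 (by simpa [peaucellier])
  have w12 := zW 1 2 (by simpa [peaucellier])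
  have w03 := zW 0 3 (by simpa [peaucellier])
  have w14 := zW 1 4 (by simpa [peaucellier])
  have w42 := zW 4 2 (by simpa [peaucellier])
  have w43 := zW 4 3 (by simpa [peaucellier])
  have w25 := zW 2 5 (by simpa [peaucellier])
  simp [peaucellier] at a0 a1 a5 b0 b1 b3 w02 w12 w03 w14 w42 w43 w25
  rw [← eq_div_iff h0.ne'] at b3 w02 w12 w03 w14 w42 w43
  have z3 : z 3 = (1 + z 0) / 2 := by
    have : z 0 - z 3 = z 3 - 1 := eq_of_normSq_add w03 b3 (by
      rw [sub_add_sub_cancel, eq_div_of_mul_eq h0.ne' b0]; ring)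
    linear_combination (-1 / 2) * this
  have z4 : z 4 = (z 1 + z 2) / 2 := by
    have : z 1 - z 4 = z 4 - z 2 := eq_of_normSq_add w14 w42 (by
      rw [sub_add_sub_cancel, w12]; ring)
    linear_combination (-1 / 2) * this
  -- The number `z 2 - z 0 - z 1 + 1` measures the failure to be a parallelogram. If it is `d`, the
  -- points `w`, `w + d / 2`, `w + d` with `w = z 1 - 1` have equal norm, by the bars of length `q`
  -- from `1` to vertex `1`, between the midpoints, and from vertex `0` to the image point. A line
  -- does not meet a circle three times, so `d = 0`.
  have z2 : z 2 = z 0 + z 1 - 1 := by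
    have : z 2 - z 0 - z 1 + 1 = 0 := by
      refine eq_zero_of_normSq_add (w := z 1 - 1) (eq_div_of_mul_eq h0.ne' b1) ?_ ?_
      · rw [show z 1 - 1 + (z 2 - z 0 - z 1 + 1) = -(z 0 - z 2) by ring, Complex.normSq_neg, w02]
      · rw [show z 1 - 1 + (z 2 - z 0 - z 1 + 1) / 2 = z 4 - z 3 by rw [z3, z4]; ring, w43]
    linear_combination this
  obtain ⟨η₀, e0⟩ := exists_eq_elbow h0 a0 b0
  obtain ⟨η₁, e1⟩ := exists_eq_elbow h0 a1 b1
  -- If the elbows coincided, the parallelogram law would put the image point at squared distance `2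
  -- * R ^ 2 + 2 * q ^ 2 - t` from `A`. This exceeds `(2 * h) ^ 2`, the reach of the chain.
  have hne : η₁ ≠ η₀ := by
    rintro rfl
    have e2 : z 2 = 2 * z 0 - 1 := by rw [z2, e1, ← e0]; ring
    have k1 : Complex.normSq (z 2) * t = 2 * R ^ 2 + 2 * q ^ 2 - t := by
      have : Complex.normSq (2 * z 0 - 1) =
          2 * Complex.normSq (z 0) + 2 * Complex.normSq (z 0 - 1) - 1 := by
        simp [Complex.normSq_apply]; ring
      rw [e2, this]
      linear_combination 2 * a0 + 2 * b0
    have k2 : Complex.normSq (z 2) ≤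
        2 * Complex.normSq (z 5) + 2 * Complex.normSq (z 2 - z 5) := by
      have := Complex.normSq_nonneg (z 2 - 2 * z 5)
      have e : Complex.normSq (z 2 - 2 * z 5) = 2 * Complex.normSq (z 5) +
          2 * Complex.normSq (z 2 - z 5) - Complex.normSq (z 2) := by
        simp [Complex.normSq_apply]; ring
      linarith
    have k3 := mul_le_mul_of_nonneg_right k2 h0.le
    nlinarith
  have e1' : z 1 = conj (z 0) := by
    rw [e1, e0, conj_elbow, Int.units_ne_iff_eq_neg.1 hne]
  have e2 : z 2 = ((R ^ 2 - q ^ 2) / t : ℝ) := by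
    rw [z2, e1', e0, two_elbow_re_sub_one h0]
  have hρ0 : R ^ 2 - q ^ 2 ≠ 0 := by
    rw [sq_sub_sq]
    exact mul_ne_zero (by positivity) (sub_ne_zero.2 hRq)
  have hρ : 0 < (R ^ 2 - q ^ 2) ^ 2 / t := by positivity
  set c := (R ^ 2 - q ^ 2) / t with hc
  have hc0 : (c : ℂ) ≠ 0 := by
    exact_mod_cast div_ne_zero hρ0 h0.ne'
  have hct : (R ^ 2 - q ^ 2) ^ 2 / t = c ^ 2 * t := by rw [hc]; field_simp
  have hz5 : z 5 = c * (z 5 / c) := by field_simp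
  obtain ⟨η₂, e5⟩ := exists_eq_elbow (R := h) (q := h) (z := z 5 / c) hρ
    (by
      rw [hz5, Complex.normSq_mul, Complex.normSq_ofReal] at a5
      rw [hct, ← a5]; ring)
    (by
      rw [e2, show (c : ℂ) - z 5 = c * -(z 5 / c - 1) by field_simp; ring, Complex.normSq_mul,
        Complex.normSq_ofReal, Complex.normSq_neg] at w25
      rw [hct, ← w25]; ring)
  refine ⟨![η₀, η₂], fun w => ?_⟩
  fin_cases w
  · exact e0
  · simp [peaucellierPos, ← e0, e1']
  · exact e2
  · simp [peaucellierPos, ← e0, z3]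
  · simp [peaucellierPos, ← e0, z4, e1', e2, hc]
  · have := hz5
    rw [e5] at this
    exact this

theorem peaucellierPos_analyticAt (hR : 0 < R) (hq : 0 < q) (hRq : R ≠ q)
    (η : Fin 2 → ℤˣ) (w : Fin 6) {t : ℝ} (ht : t ∈ peaucellierRange R q h) :
    AnalyticAt ℝ (peaucellierPos R q h η w) t := by
  obtain ⟨h0, h1, h2, h3, h4, h5⟩ := ht
  have hρ0 : R ^ 2 - q ^ 2 ≠ 0 := by
    rw [sq_sub_sq]
    exact mul_ne_zero (by positivity) (sub_ne_zero.2 hRq)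
  have hρ : 0 < (R ^ 2 - q ^ 2) ^ 2 / t := by positivity
  have k1 := analyticAt_elbow h0 h1 h2 (η 0)
  have k2 : AnalyticAt ℝ (fun t : ℝ => (((R ^ 2 - q ^ 2) / t : ℝ) : ℂ)) t :=
    analyticAt_ofReal (analyticAt_const.div analyticAt_id h0.ne')
  have k3 : AnalyticAt ℝ (fun t : ℝ => elbow h h ((R ^ 2 - q ^ 2) ^ 2 / t) (η 1)) t := by
    refine AnalyticAt.fun_comp (g := fun u => elbow h h u (η 1))
      (f := fun t => (R ^ 2 - q ^ 2) ^ 2 / t) (analyticAt_elbow hρ (by simpa using hρ) ?_ _)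
      (analyticAt_const.div analyticAt_id h0.ne')
    rw [← two_mul]; exact h3
  unfold peaucellierPos
  fin_cases w
  · exact k1
  · exact analyticAt_conj k1
  · exact k2
  · exact (analyticAt_const.add k1).div analyticAt_const two_ne_zero
  · exact ((analyticAt_conj k1).add k2).div analyticAt_const two_ne_zero
  · exact k2.mul k3

theorem im_mul_conj_sub (d z w v : ℂ) :
    ((d * (z - w)) * conj (d * (z - v))).im =
      Complex.normSq d * ((z - w) * conj (z - v)).im := by
  simp [Complex.normSq_apply]; ring

/-- The vertices are determined modulo the ideal in turn: the elbows by circles around `A` and `B`,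
the image point by circles around the elbows, the elbow of the chain by circles around `A` and the
image point, the midpoints by their triangle equations. The bar between the midpoints only serves to
exclude points. -/
theorem peaucellier_congr (hR : 0 < R) (hq : 0 < q) (hh : 0 < h) (hRq : R ≠ q)
    {E : Type} [NormedAddCommGroup E] [NormedSpace ℝ E] {S : Set (E → ℝ)} {x : E}
    {a b : E → ℂ} {ω : Fin 6 → E → ℂ} {η : Fin 2 → ℤˣ} (ha : AnalyticAt ℝ a x)
    (hb : AnalyticAt ℝ b x) (hω : ∀ w, AnalyticAt ℝ (ω w) x)
    (hI : Complex.normSq (b x - a x) ∈ peaucellierRange R q h)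
    (hx : ∀ w, ω w x = relPos (peaucellierPos R q h η w) (a x) (b x))
    (hE : (peaucellier R q h hR hq hh).EqsMem S x a b ω) (w : Fin 6) :
    CMem S x fun y => ω w y - relPos (peaucellierPos R q h η w) (a y) (b y) := by
  set P : Fin 6 → E → ℂ := fun w y => relPos (peaucellierPos R q h η w) (a y) (b y) with hP
  have hPa : ∀ w, AnalyticAt ℝ (P w) x := fun w =>
    analyticAt_relPos ha hb (peaucellierPos_analyticAt hR hq hRq η w hI)
  have hev : ∀ᶠ y in 𝓝 x, Complex.normSq (b y - a y) ∈ peaucellierRange R q h :=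
    (analyticAt_normSq (hb.sub ha)).continuousAt (isOpen_peaucellierRange.mem_nhds hI)
  have hneg : ∀ u v : ℂ, Complex.normSq (u - v) = Complex.normSq (v - u) := fun u v => by
    rw [← neg_sub, Complex.normSq_neg]
  have hA : ∀ w, (peaucellier R q h hR hq hh).toA w ≠ 0 → MemIdealAt S x fun y =>
      Complex.normSq (ω w y - a y) - Complex.normSq (P w y - a y) := by
    intro w hw
    refine (hE.toA w hw).congr (hev.mono fun y hy => ?_)
    simp only [hP]
    rw [hneg (relPos _ _ _), relPos_sub_left, (peaucellier_solves hR hq hh hRq η hy).toA w hw, hneg]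
  have hB : ∀ w, (peaucellier R q h hR hq hh).toB w ≠ 0 → MemIdealAt S x fun y =>
      Complex.normSq (ω w y - b y) - Complex.normSq (P w y - b y) := by
    intro w hw
    refine (hE.toB w hw).congr (hev.mono fun y hy => ?_)
    simp only [hP]
    rw [hneg (relPos _ _ _), relPos_sub_right, (peaucellier_solves hR hq hh hRq η hy).toB w hw,
      hneg]
  have hW : ∀ w w', (peaucellier R q h hR hq hh).btw w w' ≠ 0 →
      CMem S x (fun y => ω w' y - P w' y) → MemIdealAt S x fun y =>
      Complex.normSq (ω w y - ω w' y) - Complex.normSq (P w y - ω w' y) := by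
    intro w w' hw hw'
    -- Replacing `P w'` by the congruent `ω w'` gives the two circles a common centre.
    have h1 : CMem S x fun y => (P w y - P w' y) - (P w y - ω w' y) :=
      hw'.congr (.of_forall fun y => by ring)
    have h2 : MemIdealAt S x fun y =>
        Complex.normSq (P w y - P w' y) - Complex.normSq (P w y - ω w' y) :=
      CMem.normSq_sub ((hPa w).sub (hPa w')) ((hPa w).sub (hω w')) h1
    refine ((hE.btw w w' hw).add h2).congr (hev.mono fun y hy => ?_)
    have := (peaucellier_solves hR hq hh hRq η hy).btw w w' hw
    rw [← relPos_sub_relPos] at this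
    simp only [hP]
    linarith
  obtain ⟨h0, h1, h2, h3, h4, h5⟩ := hI
  have hR' := hR.ne'
  have hq' := hq.ne'
  have hh' := hh.ne'
  set d := b x - a x with hd
  set t := Complex.normSq d with ht
  have him := elbow_im_ne_zero h0 h1 h2 (η 0)
  have hsub : ∀ w w', ω w x - ω w' x =
      d * (peaucellierPos R q h η w t - peaucellierPos R q h η w' t) := by
    intro w w'
    rw [hx, hx]
    simp only [relPos]
    ring
  have hsubA : ∀ w, ω w x - a x = d * (peaucellierPos R q h η w t - 0) := by
    intro w; rw [hx]; simp only [relPos]; ring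
  have hsubB : ∀ w, ω w x - b x = d * (peaucellierPos R q h η w t - 1) := by
    intro w; rw [hx]; simp only [relPos]; ring
  have c0 : CMem S x fun y => ω 0 y - P 0 y := by
    refine two_circles (hω 0) (hPa 0) ha hb (hx 0) (hA 0 (by simpa [peaucellier]))
      (hB 0 (by simpa [peaucellier])) ?_
    rw [hsubA, hsubB, im_mul_conj_sub]
    refine mul_ne_zero h0.ne' ?_
    have : ((peaucellierPos R q h η 0 t - 0) * conj (peaucellierPos R q h η 0 t - 1)).im =
      -(elbow R q t (η 0)).im := by simp [peaucellierPos]; ring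
    rw [this]; exact neg_ne_zero.2 him
  have c1 : CMem S x fun y => ω 1 y - P 1 y := by
    refine two_circles (hω 1) (hPa 1) ha hb (hx 1) (hA 1 (by simpa [peaucellier]))
      (hB 1 (by simpa [peaucellier])) ?_
    rw [hsubA, hsubB, im_mul_conj_sub]
    refine mul_ne_zero h0.ne' ?_
    have : ((peaucellierPos R q h η 1 t - 0) * conj (peaucellierPos R q h η 1 t - 1)).im =
      (elbow R q t (η 0)).im := by simp [peaucellierPos]; ring
    rw [this]; exact him
  have c3 : CMem S x fun y => ω 3 y - P 3 y := by
    -- The two circles through a midpoint are tangent there, so `two_circles` does not apply; the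
    -- triangle equation gives the position directly.
    have k := hE.midB 3 0 (by simpa [peaucellier]) (by simp [peaucellier])
      (by simp [peaucellier]; ring)
    refine (k.add (c0.mul_left (a := fun _ => 1 / 2) analyticAt_const)).congr
      (.of_forall fun y => ?_)
    simp [hP, relPos, peaucellierPos]
    ring
  have c2 : CMem S x fun y => ω 2 y - P 2 y := by
    refine two_circles (hω 2) (hPa 2) (hω 0) (hω 1) (hx 2) (hW 2 0 (by simpa [peaucellier]) c0)
      (hW 2 1 (by simpa [peaucellier]) c1) ?_
    rw [hsub, hsub, im_mul_conj_sub]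
    refine mul_ne_zero h0.ne' ?_
    have e0 := two_elbow_re_sub_one (R := R) (q := q) h0 (η 0)
    have : ((peaucellierPos R q h η 2 t - peaucellierPos R q h η 0 t) *
        conj (peaucellierPos R q h η 2 t - peaucellierPos R q h η 1 t)).im =
        -2 * ((elbow R q t (η 0)).re - 1) * (elbow R q t (η 0)).im := by
      have e2 : peaucellierPos R q h η 2 t =
          elbow R q t (η 0) + conj (elbow R q t (η 0)) - 1 := by
        rw [e0]; rfl
      rw [e2]
      simp [peaucellierPos]
      ring
    rw [this]
    -- The circles around the elbows are tangent only when the rhombus is flat with the image point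
    -- at `B`. This is the case `t = R ^ 2 - q ^ 2`, excluded from the range.
    refine mul_ne_zero (mul_ne_zero (by norm_num) ?_) him
    rw [elbow_re]
    intro h6
    rw [sub_eq_zero, div_eq_one_iff_eq (by positivity)] at h6
    exact h5 (by linarith)
  have c4 : CMem S x fun y => ω 4 y - P 4 y := by
    have k := hE.mid 1 4 2 (by simpa [peaucellier]) (by simp [peaucellier])
      (by simp [peaucellier]; ring)
    refine (k.add ((c1.add c2).mul_left (a := fun _ => 1 / 2) analyticAt_const)).congr
      (.of_forall fun y => ?_)
    simp [hP, relPos, peaucellierPos]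
    ring
  have c5 : CMem S x fun y => ω 5 y - P 5 y := by
    refine two_circles (hω 5) (hPa 5) ha (hω 2) (hx 5) (hA 5 (by simpa [peaucellier]))
      (hW 5 2 (by simpa [peaucellier]) c2) ?_
    rw [hsub, hsubA, im_mul_conj_sub]
    refine mul_ne_zero h0.ne' ?_
    have hρ0 : R ^ 2 - q ^ 2 ≠ 0 := by
      rw [sq_sub_sq]
      exact mul_ne_zero (by positivity) (sub_ne_zero.2 hRq)
    have hρ : 0 < (R ^ 2 - q ^ 2) ^ 2 / t := by positivity
    have him' := elbow_im_ne_zero (R := h) (q := h) hρ (by simpa using hρ)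
      (by rw [← two_mul]; exact h3) (η 1)
    have : ((peaucellierPos R q h η 5 t - 0) *
        conj (peaucellierPos R q h η 5 t - peaucellierPos R q h η 2 t)).im =
        -((R ^ 2 - q ^ 2) / t) ^ 2 * (elbow h h ((R ^ 2 - q ^ 2) ^ 2 / t) (η 1)).im := by
      have e2 : peaucellierPos R q h η 2 t = (((R ^ 2 - q ^ 2) / t : ℝ) : ℂ) := rfl
      have e5 : peaucellierPos R q h η 5 t = (((R ^ 2 - q ^ 2) / t : ℝ) : ℂ) *
        elbow h h ((R ^ 2 - q ^ 2) ^ 2 / t) (η 1) := rfl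
      rw [e2, e5]
      generalize (R ^ 2 - q ^ 2) / t = c
      simp only [Complex.mul_im, Complex.mul_re, Complex.conj_re, Complex.conj_im, Complex.sub_re,
        Complex.sub_im, Complex.ofReal_re, Complex.ofReal_im, Complex.zero_re, Complex.zero_im]
      ring
    rw [this]
    exact mul_ne_zero (neg_ne_zero.2 (pow_ne_zero _ (div_ne_zero hρ0 h0.ne'))) him'
  fin_cases w
  exacts [c0, c1, c2, c3, c4, c5]

theorem peaucellier_eq_two (hR : 0 < R) (hq : 0 < q) (hh : 0 < h) {w : Fin 6}
    (hw : (peaucellier R q h hR hq hh).label w = none) : w = 2 := by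
  fin_cases w <;> simp [peaucellier] at hw ⊢

theorem peaucellierPos_zero (η : Fin 2 → ℤˣ) (t : ℝ) :
    peaucellierPos R q h η 0 t = elbow R q t (η 0) := rfl

theorem peaucellierPos_one (η : Fin 2 → ℤˣ) (t : ℝ) :
    peaucellierPos R q h η 1 t = conj (elbow R q t (η 0)) := rfl

theorem peaucellierPos_three (η : Fin 2 → ℤˣ) (t : ℝ) :
    peaucellierPos R q h η 3 t = (1 + elbow R q t (η 0)) / 2 := rfl

theorem peaucellierPos_four (η : Fin 2 → ℤˣ) (t : ℝ) : peaucellierPos R q h η 4 t =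
    (conj (elbow R q t (η 0)) + ((R ^ 2 - q ^ 2) / t : ℝ)) / 2 := rfl

theorem peaucellierPos_five (η : Fin 2 → ℤˣ) (t : ℝ) : peaucellierPos R q h η 5 t =
    ((R ^ 2 - q ^ 2) / t : ℝ) * elbow h h ((R ^ 2 - q ^ 2) ^ 2 / t) (η 1) := rfl

theorem peaucellierPos_two (η : Fin 2 → ℤˣ) (t : ℝ) :
    peaucellierPos R q h η 2 t = ((R ^ 2 - q ^ 2) / t : ℝ) := rfl

theorem peaucellierPos_mul_none (hR : 0 < R) (hq : 0 < q) (hh : 0 < h) (δ η : Fin 2 → ℤˣ)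
    (t : ℝ) {w : Fin 6} (hw : (peaucellier R q h hR hq hh).label w = none) :
    peaucellierPos R q h (δ * η) w t = peaucellierPos R q h η w t := by
  obtain rfl := peaucellier_eq_two hR hq hh hw
  rw [peaucellierPos_two, peaucellierPos_two]

theorem peaucellierPos_mul_some (hR : 0 < R) (hq : 0 < q) (hh : 0 < h) (δ η : Fin 2 → ℤˣ)
    (t : ℝ) {w : Fin 6} {k : Fin 2} (hw : (peaucellier R q h hR hq hh).label w = some k) :
    peaucellierPos R q h (δ * η) w t =
      if δ k = 1 then peaucellierPos R q h η w t else conj (peaucellierPos R q h η w t) := by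
  have hlabel : (w = 0 ∨ w = 1 ∨ w = 3 ∨ w = 4) ∧ k = 0 ∨ w = 5 ∧ k = 1 := by
    fin_cases w <;> simp [peaucellier] at hw ⊢ <;> exact hw.symm
  have e0 := elbow_mul (R := R) (q := q) (t := t) (δ 0) (η 0)
  have e1 := elbow_mul (R := h) (q := h) (t := (R ^ 2 - q ^ 2) ^ 2 / t) (δ 1) (η 1)
  obtain ⟨rfl | rfl | rfl | rfl, rfl⟩ | ⟨rfl, rfl⟩ := hlabel
  · rw [peaucellierPos_zero, peaucellierPos_zero, Pi.mul_apply, e0]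
  · rw [peaucellierPos_one, peaucellierPos_one, Pi.mul_apply, e0]
    split_ifs <;> rfl
  · rw [peaucellierPos_three, peaucellierPos_three, Pi.mul_apply, e0]
    split_ifs
    · rfl
    · rw [map_div₀, map_add, map_one, map_ofNat]
  · rw [peaucellierPos_four, peaucellierPos_four, Pi.mul_apply, e0]
    split_ifs
    · rfl
    · rw [map_div₀, map_add, Complex.conj_ofReal, map_ofNat]
  · rw [peaucellierPos_five, peaucellierPos_five, Pi.mul_apply, e1]
    split_ifs
    · rfl
    · rw [map_mul, Complex.conj_ofReal]

theorem peaucellierPos_real (hR : 0 < R) (hq : 0 < q) (hh : 0 < h) (η : Fin 2 → ℤˣ)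
    (t : ℝ) {w : Fin 6} (hw : (peaucellier R q h hR hq hh).label w = none) :
    conj (peaucellierPos R q h η w t) = peaucellierPos R q h η w t := by
  obtain rfl := peaucellier_eq_two hR hq hh hw
  exact Complex.conj_ofReal _

theorem peaucellierPos_injective (hR : 0 < R) (hq : 0 < q) (hRq : R ≠ q) {t : ℝ}
    (ht : t ∈ peaucellierRange R q h) {η η' : Fin 2 → ℤˣ}
    (he : ∀ w, peaucellierPos R q h η w t = peaucellierPos R q h η' w t) : η = η' := by
  obtain ⟨h0, h1, h2, h3, h4, h5⟩ := ht
  have hρ0 : R ^ 2 - q ^ 2 ≠ 0 := by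
    rw [sq_sub_sq]
    exact mul_ne_zero (by positivity) (sub_ne_zero.2 hRq)
  have hρ : 0 < (R ^ 2 - q ^ 2) ^ 2 / t := by positivity
  have e0 : η 0 = η' 0 := elbow_injective h0 h1 h2 (he 0)
  have e1 : η 1 = η' 1 := by
    refine elbow_injective (R := h) (q := h) hρ (by simpa using hρ)
      (by rw [← two_mul]; exact h3) ?_
    refine mul_left_cancel₀ ?_ (he 5)
    exact_mod_cast div_ne_zero hρ0 h0.ne'
  funext k
  fin_cases k
  exacts [e0, e1]

theorem peaucellier_label_adj (hR : 0 < R) (hq : 0 < q) (hh : 0 < h) {w w' : Fin 6} {k l : Fin 2}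
    (hww : (peaucellier R q h hR hq hh).btw w w' ≠ 0)
    (hw : (peaucellier R q h hR hq hh).label w = some k)
    (hw' : (peaucellier R q h hR hq hh).label w' = some l) : k = l := by
  have key : ∀ w w' : Fin 6, (peaucellier R q h hR hq hh).btw w w' ≠ 0 →
      w ≠ 2 → w' ≠ 2 → (w = 5 ↔ w' = 5) := by
    intro w w' h1 h2 h3
    fin_cases w <;> fin_cases w' <;> first | exact absurd rfl h1 | exact absurd rfl h2 | exact absurd rfl h3 | decide
  have hl : ∀ w k, (peaucellier R q h hR hq hh).label w = some k →
      w ≠ 2 ∧ (w = 5 ∧ k = 1 ∨ w ≠ 5 ∧ k = 0) := by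
    intro w k hk
    fin_cases w <;> simp [peaucellier] at hk ⊢ <;> exact hk.symm
  have h1 := hl w k hw
  have h2 := hl w' l hw'
  have h3 := key w w' hww h1.1 h2.1
  rcases h1.2 with ⟨a, rfl⟩ | ⟨a, rfl⟩ <;> rcases h2.2 with ⟨b, rfl⟩ | ⟨b, rfl⟩
  · rfl
  · exact absurd (h3.1 a) b
  · exact absurd (h3.2 b) a
  · rfl

theorem peaucellier_isGood (hR : 0 < R) (hq : 0 < q) (hh : 0 < h) (hRq : R ≠ q) :
    (peaucellier R q h hR hq hh).IsGood (peaucellierRange R q h) (peaucellierPos R q h) where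
  isOpen := isOpen_peaucellierRange
  pos t ht := ht.1
  analyticAt η w t ht := peaucellierPos_analyticAt hR hq hRq η w ht
  solves η t ht := peaucellier_solves hR hq hh hRq η ht
  complete t ht z hz := peaucellier_complete hR hq hh hRq ht hz
  inj t ht η η' he := peaucellierPos_injective hR hq hRq ht he
  mul_none t _ δ η w hw := peaucellierPos_mul_none hR hq hh δ η t hw
  mul_some t _ δ η w k hw := peaucellierPos_mul_some hR hq hh δ η t hw
  real t _ η w hw := peaucellierPos_real hR hq hh η t hw
  core_toA w hw := by rw [peaucellier_eq_two hR hq hh hw]; rfl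
  core_toB w hw := by rw [peaucellier_eq_two hR hq hh hw]; rfl
  core_btw w w' hw hw' := by
    rw [peaucellier_eq_two hR hq hh hw, peaucellier_eq_two hR hq hh hw']; rfl
  label_adj w w' k l hww hw hw' := peaucellier_label_adj hR hq hh hww hw hw'
  congr E _ _ S x a b ω η ha hb hω hI hx hE w :=
    peaucellier_congr hR hq hh hRq ha hb hω hI hx hE w

end Peaucellier

/-! ### Topology of products of annuli and of their walls. -/

section Annuli

variable {ι : Type} {E : Type*} [NormedAddCommGroup E]

/-- Product of the annuli with centre `c` between the radii `a i - b i` and `a i + b i`. -/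
def annuli (c : E) (a b : ι → ℝ) : Set (ι → E) :=
  {y | ∀ i, a i - b i ≤ ‖y i - c‖ ∧ ‖y i - c‖ ≤ a i + b i}

/-- The points of the annuli with some coordinate on a boundary circle. -/
def annuliWall (c : E) (a b : ι → ℝ) : Set (ι → E) :=
  {y | ∃ i, ‖y i - c‖ = a i - b i ∨ ‖y i - c‖ = a i + b i}

variable {c : E} {a b : ι → ℝ}

theorem isClosed_annuli : IsClosed (annuli c a b) := by
  have : annuli c a b = ⋂ i, {y : ι → E | a i - b i ≤ ‖y i - c‖} ∩ {y | ‖y i - c‖ ≤ a i + b i} := by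
    ext y; simp [annuli]
  rw [this]
  exact isClosed_iInter fun i => (isClosed_le continuous_const (by fun_prop)).inter
    (isClosed_le (by fun_prop) continuous_const)

theorem isCompact_annuli [ProperSpace E] : IsCompact (annuli c a b) := by
  refine (isCompact_univ_pi fun i => isCompact_closedBall c (a i + b i)).of_isClosed_subset
    isClosed_annuli fun y hy i _ => ?_
  rw [mem_closedBall_iff_norm]
  exact (hy i).2

theorem isClosed_annuliWall [Finite ι] : IsClosed (annuliWall c a b) := by
  have : annuliWall c a b =
      ⋃ i, {y : ι → E | ‖y i - c‖ = a i - b i} ∪ {y | ‖y i - c‖ = a i + b i} := by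
    ext y; simp [annuliWall]
  rw [this]
  exact isClosed_iUnion_of_finite fun i => (isClosed_eq (by fun_prop) continuous_const).union
    (isClosed_eq (by fun_prop) continuous_const)

theorem isOpen_lt_annuli [Finite ι] :
    IsOpen {y : ι → E | ∀ i, a i - b i < ‖y i - c‖ ∧ ‖y i - c‖ < a i + b i} := by
  have : {y : ι → E | ∀ i, a i - b i < ‖y i - c‖ ∧ ‖y i - c‖ < a i + b i} =
      ⋂ i, {y : ι → E | a i - b i < ‖y i - c‖} ∩ {y | ‖y i - c‖ < a i + b i} := by
    ext y; simp
  rw [this]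
  exact isOpen_iInter_of_finite fun i => (isOpen_lt continuous_const (by fun_prop)).inter
    (isOpen_lt (by fun_prop) continuous_const)

/-- Pushing every coordinate radially towards the middle circle of radius `a i` leaves the wall at
once: the new norm is a proper convex combination of the old norm and `a i`. -/
theorem annuli_subset_closure [NormedSpace ℝ E] (hb : ∀ i, 0 < b i) (hab : ∀ i, b i < a i) :
    annuli c a b ⊆ closure (annuli c a b \ annuliWall c a b) := by
  intro y hy
  set γ : ℝ → ι → E := fun τ i =>
    c + ((1 - τ) + τ * (a i / ‖y i - c‖)) • (y i - c) with hγ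
  have hpos : ∀ i, 0 < ‖y i - c‖ := fun i => by linarith [(hy i).1, hab i]
  have hcont : Tendsto γ (𝓝[>] 0) (𝓝 y) := by
    have : Tendsto γ (𝓝 0) (𝓝 (γ 0)) := by
      refine Continuous.tendsto (continuous_pi fun i => ?_) 0
      fun_prop
    have h0 : γ 0 = y := by funext i; simp [hγ]
    rw [h0] at this
    exact this.mono_left nhdsWithin_le_nhds
  refine mem_closure_of_tendsto hcont ?_
  filter_upwards [Ioo_mem_nhdsGT (zero_lt_one' ℝ)] with τ hτ
  have hn : ∀ i, ‖γ τ i - c‖ = (1 - τ) * ‖y i - c‖ + τ * a i := by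
    intro i
    have h1 : 0 < a i := (hb i).trans (hab i)
    have h2 : 0 ≤ (1 - τ) + τ * (a i / ‖y i - c‖) := by
      have := hpos i
      have := hτ.1
      have := hτ.2
      have : 0 < 1 - τ := by linarith
      positivity
    simp only [hγ, add_sub_cancel_left, norm_smul, Real.norm_of_nonneg h2]
    have := (hpos i).ne'
    field_simp
  have hlt : ∀ i, a i - b i < ‖γ τ i - c‖ ∧ ‖γ τ i - c‖ < a i + b i := by
    intro i
    rw [hn]
    have h1 := mul_pos hτ.1 (hb i)
    have h2 : 0 < 1 - τ := by linarith [hτ.2]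
    have h3 := mul_le_mul_of_nonneg_left (hy i).1 h2.le
    have h4 := mul_le_mul_of_nonneg_left (hy i).2 h2.le
    constructor <;> nlinarith
  refine ⟨fun i => ⟨(hlt i).1.le, (hlt i).2.le⟩, ?_⟩
  rintro ⟨i, hi | hi⟩
  · exact (hlt i).1.ne' hi
  · exact (hlt i).2.ne hi

theorem lt_of_mem_annuli_diff {y : ι → E} (hy : y ∈ annuli c a b \ annuliWall c a b) (i : ι) :
    a i - b i < ‖y i - c‖ ∧ ‖y i - c‖ < a i + b i :=
  ⟨lt_of_le_of_ne (hy.1 i).1 fun h => hy.2 ⟨i, Or.inl h.symm⟩,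
    lt_of_le_of_ne (hy.1 i).2 fun h => hy.2 ⟨i, Or.inr h⟩⟩

end Annuli

/-! ### Two-bar arms that carry the inputs. -/

section Arms

variable {ι : Type} {s : ℕ}

/-- Fixed vertices, elbows and hands. -/
abbrev ArmVertex (ι : Type) (s : ℕ) : Type := Fin s ⊕ (ι ⊕ ι)

/-- The edges of the arms, and the edge between the first two fixed vertices. -/
inductive ArmEdge (i₀ i₁ : Fin s) : ArmVertex ι s → ArmVertex ι s → Prop
  | base : ArmEdge i₀ i₁ (.inl i₀) (.inl i₁)
  | upper (i : ι) : ArmEdge i₀ i₁ (.inl i₁) (.inr (.inl i))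
  | lower (i : ι) : ArmEdge i₀ i₁ (.inr (.inl i)) (.inr (.inr i))

/-- The lengths of the arms. -/
def armLen (l : ℝ) (a b : ι → ℝ) : ArmVertex ι s → ArmVertex ι s → ℝ
  | .inl _, .inl _ => l
  | .inl _, .inr x => Sum.elim a b x
  | .inr x, .inl _ => Sum.elim a b x
  -- Values at pairs that are not joined by a bar are defaults.
  | .inr (.inl _), .inr (.inl _) => 1
  | .inr (.inl i), .inr (.inr _) => b i
  | .inr (.inr _), .inr (.inl i) => b i
  | .inr (.inr _), .inr (.inr _) => 1

/-- Arms with lengths `a i` and `b i`, attached to the second fixed vertex. -/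
def armLinkage (Z : Fin s → ℂ) {i₀ i₁ : Fin s} (hZ : Z i₀ ≠ Z i₁) {a b : ι → ℝ}
    (hb : ∀ i, 0 < b i) (hab : ∀ i, b i < a i) : MarkedLinkage (ArmVertex ι s) s where
  graph := SimpleGraph.fromRel (ArmEdge i₀ i₁)
  len := Sym2.lift ⟨armLen ‖Z i₀ - Z i₁‖ a b, by
    rintro (v | v | v) (w | w | w) <;> rfl⟩
  len_pos := by
    have h0 : ∀ x y : ArmVertex ι s, ArmEdge i₀ i₁ x y → 0 < armLen ‖Z i₀ - Z i₁‖ a b x y := by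
      rintro _ _ (_ | i | i)
      · exact norm_pos_iff.2 (sub_ne_zero.2 hZ)
      · exact (hb i).trans (hab i)
      · exact hb i
    have hsymm : ∀ x y : ArmVertex ι s, armLen ‖Z i₀ - Z i₁‖ a b x y =
        armLen ‖Z i₀ - Z i₁‖ a b y x := by
      rintro (v | v | v) (w | w | w) <;> rfl
    intro e
    induction e using Sym2.ind with
    | _ x y =>
      rintro ⟨-, h | h⟩
      · exact h0 x y h
      · exact (h0 y x h).trans_eq (hsymm y x)
  fixed := Function.Embedding.inl

variable {Z : Fin s → ℂ} {i₀ i₁ : Fin s} {hZ : Z i₀ ≠ Z i₁} {a b : ι → ℝ} {hb : ∀ i, 0 < b i}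
  {hab : ∀ i, b i < a i}

theorem armLinkage_adj {x y : ArmVertex ι s} (h : ArmEdge i₀ i₁ x y) :
    (armLinkage Z hZ hb hab).graph.Adj x y := by
  refine ⟨?_, Or.inl h⟩
  rintro rfl
  rcases x with j | i | i <;> cases h
  exact hZ rfl

theorem normSq_sub_comm (u v : ℂ) : Complex.normSq (u - v) = Complex.normSq (v - u) := by
  rw [← neg_sub, Complex.normSq_neg]

theorem mem_armLinkage_iff {φ : ArmVertex ι s → ℂ} : φ ∈ configSpace (armLinkage Z hZ hb hab) Z ↔
    (∀ j, φ (.inl j) = Z j) ∧ ∀ i,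
      Complex.normSq (Z i₁ - φ (.inr (.inl i))) = a i ^ 2 ∧
      Complex.normSq (φ (.inr (.inl i)) - φ (.inr (.inr i))) = b i ^ 2 := by
  rw [mem_configSpace_iff]
  constructor
  · rintro ⟨h1, h2⟩
    refine ⟨h2, fun i => ⟨?_, h1 _ _ (armLinkage_adj (.lower i))⟩⟩
    rw [← h2]
    exact h1 _ _ (armLinkage_adj (.upper i))
  · rintro ⟨h1, h2⟩
    refine ⟨?_, h1⟩
    have h0 : ∀ x y, ArmEdge i₀ i₁ x y → Complex.normSq (φ x - φ y) =
        (armLinkage Z hZ hb hab).len s(x, y) ^ 2 := by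
      rintro _ _ (_ | i | i)
      · rw [h1, h1, Complex.normSq_eq_norm_sq]
        rfl
      · rw [h1]
        exact (h2 i).1
      · exact (h2 i).2
    rintro x y ⟨-, h | h⟩
    · exact h0 x y h
    · rw [normSq_sub_comm, Sym2.eq_swap]
      exact h0 y x h

/-- The labels of the arms: each elbow can be reflected. -/
def armLabel : ArmVertex ι s → Option ι
  | .inr (.inl i) => some i
  | _ => none

/-- The sections of the arms. -/
def armSec (Z : Fin s → ℂ) (i₁ : Fin s) (a b : ι → ℝ) (ε : ι → ℤˣ) (y : ι → ℂ) :
    ArmVertex ι s → ℂ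
  | .inl j => Z j
  | .inr (.inl i) => relPos (fun t => elbow (a i) (b i) t (ε i)) (Z i₁) (y i)
  | .inr (.inr i) => y i

/-- The positions of the fixed vertices and the hands. -/
def armCore (Z : Fin s → ℂ) : ArmVertex ι s → (ι → ℂ) → ℂ
  | .inl j, _ => Z j
  -- The elbows are labelled, so this value plays no role.
  | .inr (.inl _), _ => 0
  | .inr (.inr i), y => y i

theorem sq_le_normSq_of_mem_annuli (hab : ∀ i, b i < a i) {c : ℂ} {y : ι → ℂ}
    (hy : y ∈ annuli c a b) (i : ι) :
    0 < Complex.normSq (y i - c) ∧ (a i - b i) ^ 2 ≤ Complex.normSq (y i - c) ∧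
      Complex.normSq (y i - c) ≤ (a i + b i) ^ 2 := by
  have h1 : 0 < a i - b i := sub_pos.2 (hab i)
  have h2 : 0 < ‖y i - c‖ := h1.trans_le (hy i).1
  rw [Complex.normSq_eq_norm_sq]
  exact ⟨by positivity, pow_le_pow_left₀ h1.le (hy i).1 2, pow_le_pow_left₀ h2.le (hy i).2 2⟩

theorem sq_lt_normSq_of_mem_annuli_diff (hab : ∀ i, b i < a i) {c : ℂ} {y : ι → ℂ}
    (hy : y ∈ annuli c a b \ annuliWall c a b) (i : ι) :
    0 < Complex.normSq (y i - c) ∧ (a i - b i) ^ 2 < Complex.normSq (y i - c) ∧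
      Complex.normSq (y i - c) < (a i + b i) ^ 2 := by
  have h1 : 0 < a i - b i := sub_pos.2 (hab i)
  obtain ⟨h3, h4⟩ := lt_of_mem_annuli_diff hy i
  have h2 : 0 < ‖y i - c‖ := h1.trans h3
  rw [Complex.normSq_eq_norm_sq]
  exact ⟨by positivity, pow_lt_pow_left₀ h3 h1.le two_ne_zero, pow_lt_pow_left₀ h4 h2.le two_ne_zero⟩

theorem armSec_mem (hab' : ∀ i, b i < a i) (ε : ι → ℤˣ) {y : ι → ℂ}
    (hy : y ∈ annuli (Z i₁) a b) :
    armSec Z i₁ a b ε y ∈ configSpace (armLinkage Z hZ hb hab) Z := by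
  rw [mem_armLinkage_iff]
  refine ⟨fun j => rfl, fun i => ?_⟩
  obtain ⟨h0, h1, h2⟩ := sq_le_normSq_of_mem_annuli hab' hy i
  obtain ⟨e1, e2⟩ := elbow_spec h0 h1 h2 (ε i)
  constructor
  · exact (relPos_sub_left _ _ _).trans e1
  · rw [normSq_sub_comm]
    exact (relPos_sub_right _ _ _).trans e2

/-- The two bars of an arm have different lengths, so the hand never returns to the pivot and the
axis of reflection is always defined. -/
theorem arm_pin_ne {φ : ArmVertex ι s → ℂ}
    (hφ : φ ∈ configSpace (armLinkage Z hZ hb hab) Z) (i : ι) : Z i₁ ≠ φ (.inr (.inr i)) := by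
  intro h
  obtain ⟨h1, h2⟩ := (mem_armLinkage_iff.1 hφ).2 i
  rw [normSq_sub_comm, h, h2] at h1
  have := pow_lt_pow_left₀ (hab i) (hb i).le two_ne_zero
  linarith

theorem arm_exists {φ : ArmVertex ι s → ℂ}
    (hφ : φ ∈ configSpace (armLinkage Z hZ hb hab) Z) :
    (fun i => φ (.inr (.inr i))) ∈ annuli (Z i₁) a b ∧
      ∃ ε, φ = armSec Z i₁ a b ε fun i => φ (.inr (.inr i)) := by
  obtain ⟨hf, hE⟩ := mem_armLinkage_iff.1 hφ
  have hne := arm_pin_ne hφ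
  have key : ∀ i, ((a i - b i) ^ 2 ≤ Complex.normSq (φ (.inr (.inr i)) - Z i₁) ∧
      Complex.normSq (φ (.inr (.inr i)) - Z i₁) ≤ (a i + b i) ^ 2) ∧
      ∃ η, φ (.inr (.inl i)) =
        relPos (fun t => elbow (a i) (b i) t η) (Z i₁) (φ (.inr (.inr i))) := by
    intro i
    obtain ⟨h1, h2⟩ := hE i
    have h0 : φ (.inr (.inr i)) - Z i₁ ≠ 0 := sub_ne_zero.2 (hne i).symm
    have ht := Complex.normSq_pos.2 h0
    set z := (φ (.inr (.inl i)) - Z i₁) / (φ (.inr (.inr i)) - Z i₁) with hz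
    have hzr : φ (.inr (.inl i)) = relPos (fun _ => z) (Z i₁) (φ (.inr (.inr i))) := by
      simp only [relPos, hz]; field_simp; ring
    have h1' : Complex.normSq z * Complex.normSq (φ (.inr (.inr i)) - Z i₁) = a i ^ 2 := by
      rw [hzr, relPos_sub_left] at h1; exact h1
    have h2' : Complex.normSq (z - 1) * Complex.normSq (φ (.inr (.inr i)) - Z i₁) = b i ^ 2 := by
      rw [normSq_sub_comm, hzr, relPos_sub_right] at h2; exact h2
    refine ⟨elbow_range ((hb i).trans (hab i)) (hb i) ht h1' h2', ?_⟩
    obtain ⟨η, hη⟩ := exists_eq_elbow ht h1' h2'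
    refine ⟨η, hzr.trans ?_⟩
    simp only [relPos, hη]
  choose hr η hη using key
  refine ⟨fun i => ?_, η, ?_⟩
  · have h1 : 0 < a i - b i := sub_pos.2 (hab i)
    have h3 : 0 < a i + b i := by linarith [hb i]
    have h2 := hr i
    rw [Complex.normSq_eq_norm_sq] at h2
    exact ⟨(sq_le_sq₀ h1.le (norm_nonneg _)).1 h2.1, (sq_le_sq₀ (norm_nonneg _) h3.le).1 h2.2⟩
  · funext x
    rcases x with j | i | i
    exacts [hf j, hη i, rfl]

variable [Fintype ι]

theorem arm_fixed_congr (φ : ArmVertex ι s → ℂ) (j : Fin s) :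
    CMem (schemeEqs (armLinkage Z hZ hb hab) Z) φ fun ψ => ψ (.inl j) - Z j :=
  ⟨MemIdealAt.of_mem (fixedEqs_subset ⟨j, Or.inl rfl⟩),
    MemIdealAt.of_mem (fixedEqs_subset ⟨j, Or.inr rfl⟩)⟩

/-- Off the wall the elbow is not on the line through pivot and hand, so the two circles around them
cross transversally. -/
theorem arm_elbow_congr (ε : ι → ℤˣ) {y : ι → ℂ}
    (hy : y ∈ annuli (Z i₁) a b \ annuliWall (Z i₁) a b) (i : ι) :
    CMem (schemeEqs (armLinkage Z hZ hb hab) Z) (armSec Z i₁ a b ε y) fun ψ =>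
      ψ (.inr (.inl i)) -
        relPos (fun t => elbow (a i) (b i) t (ε i)) (Z i₁) (ψ (.inr (.inr i))) := by
  obtain ⟨h0, h1, h2⟩ := sq_lt_normSq_of_mem_annuli_diff hab hy i
  have hev : ∀ᶠ ψ : ArmVertex ι s → ℂ in 𝓝 (armSec Z i₁ a b ε y),
      0 < Complex.normSq (ψ (.inr (.inr i)) - Z i₁) ∧
      (a i - b i) ^ 2 < Complex.normSq (ψ (.inr (.inr i)) - Z i₁) ∧
      Complex.normSq (ψ (.inr (.inr i)) - Z i₁) < (a i + b i) ^ 2 := by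
    have hc : Continuous fun ψ : ArmVertex ι s → ℂ => Complex.normSq (ψ (.inr (.inr i)) - Z i₁) :=
      Complex.continuous_normSq.comp ((continuous_apply _).sub continuous_const)
    exact (hc.continuousAt.eventually (lt_mem_nhds h0)).and
      ((hc.continuousAt.eventually (lt_mem_nhds h1)).and
        (hc.continuousAt.eventually (gt_mem_nhds h2)))
  have hrel : AnalyticAt ℝ (fun ψ : ArmVertex ι s → ℂ =>
      relPos (fun t => elbow (a i) (b i) t (ε i)) (Z i₁) (ψ (.inr (.inr i))))
      (armSec Z i₁ a b ε y) :=
    analyticAt_relPos analyticAt_const (analyticAt_eval _ _) (analyticAt_elbow h0 h1 h2 _)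
  have hedge : ∀ v w, ArmEdge i₀ i₁ v w → MemIdealAt (schemeEqs (armLinkage Z hZ hb hab) Z)
      (armSec Z i₁ a b ε y) fun ψ =>
        Complex.normSq (ψ v - ψ w) - (armLinkage Z hZ hb hab).len s(v, w) ^ 2 :=
    fun v w h => MemIdealAt.of_mem (edgeEqs_subset ⟨v, w, armLinkage_adj h, rfl⟩)
  refine two_circles (A := fun _ => Z i₁) (B := fun ψ => ψ (.inr (.inr i))) (analyticAt_eval _ _)
    hrel analyticAt_const (analyticAt_eval _ _) rfl ?_ ?_ ?_
  · have k1 := hedge _ _ (.upper i)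
    have k2 : MemIdealAt (schemeEqs (armLinkage Z hZ hb hab) Z) (armSec Z i₁ a b ε y) fun ψ =>
        Complex.normSq (ψ (.inl i₁) - ψ (.inr (.inl i))) -
          Complex.normSq (Z i₁ - ψ (.inr (.inl i))) :=
      CMem.normSq_sub ((analyticAt_eval _ _).sub (analyticAt_eval _ _))
        (analyticAt_const.sub (analyticAt_eval _ _))
        ((arm_fixed_congr _ i₁).congr (.of_forall fun ψ => by simp))
    refine (k1.sub k2).congr (hev.mono fun ψ hψ => ?_)
    have := relPos_sub_left (fun t => elbow (a i) (b i) t (ε i)) (Z i₁) (ψ (.inr (.inr i)))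
    rw [(elbow_spec hψ.1 hψ.2.1.le hψ.2.2.le _).1] at this
    have hl : (armLinkage Z hZ hb hab).len s(.inl i₁, .inr (.inl i)) = a i := rfl
    simp only [hl]
    rw [normSq_sub_comm _ (Z i₁), normSq_sub_comm _ (Z i₁), this]
    ring
  · have k1 := hedge _ _ (.lower i)
    refine k1.congr (hev.mono fun ψ hψ => ?_)
    have := relPos_sub_right (fun t => elbow (a i) (b i) t (ε i)) (Z i₁) (ψ (.inr (.inr i)))
    rw [(elbow_spec hψ.1 hψ.2.1.le hψ.2.2.le _).2] at this
    have hl : (armLinkage Z hZ hb hab).len s(.inr (.inl i), .inr (.inr i)) = b i := rfl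
    simp only [hl]
    rw [normSq_sub_comm (relPos _ _ _), this]
  · have e1 : armSec Z i₁ a b ε y (.inr (.inl i)) - Z i₁ = (y i - Z i₁) *
        (elbow (a i) (b i) (Complex.normSq (y i - Z i₁)) (ε i) - 0) := by
      simp only [armSec, relPos]; ring
    have e2 : armSec Z i₁ a b ε y (.inr (.inl i)) - armSec Z i₁ a b ε y (.inr (.inr i)) =
        (y i - Z i₁) * (elbow (a i) (b i) (Complex.normSq (y i - Z i₁)) (ε i) - 1) := by
      simp only [armSec, relPos]; ring
    rw [e1, e2, im_mul_conj_sub]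
    refine mul_ne_zero h0.ne' ?_
    have him := elbow_im_ne_zero h0 h1 h2 (ε i)
    set e := elbow (a i) (b i) (Complex.normSq (y i - Z i₁)) (ε i)
    have : ((e - 0) * conj (e - 1)).im = -e.im := by simp; ring
    rw [this]
    exact neg_ne_zero.2 him

/-- The only neighbours of an elbow are its pivot and its hand, which span its axis. -/
theorem arm_reflective : IsReflective (armLinkage Z hZ hb hab) Z armLabel
    (fun _ => .inl i₁) (fun i => .inr (.inr i)) where
  label_ax _ := rfl
  label_bx _ := rfl
  label_fixed _ := rfl
  axis_ne φ hφ i := by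
    rw [(mem_armLinkage_iff.1 hφ).1]
    exact arm_pin_ne hφ i
  label_adj v w h k l hk hl := by
    have h0 : ∀ x y : ArmVertex ι s, ArmEdge i₀ i₁ x y → armLabel x = none ∨ armLabel y = none := by
      rintro _ _ (_ | i | i)
      exacts [Or.inl rfl, Or.inl rfl, Or.inr rfl]
    have : armLabel v = none ∨ armLabel w = none := h.2.elim (h0 v w) fun h => (h0 w v h).symm
    rw [hk, hl] at this
    simp at this
  onAxis φ hφ v w k h hv hw := by
    rcases w with j | i | i
    · cases hw
    · obtain rfl : i = k := Option.some_injective _ hw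
      rcases h.2 with h | h
      · cases h
        exact CMem.of_eventually_eq_zero (.of_forall fun ψ => by simp [refl_left])
      · cases h
        exact CMem.of_eventually_eq_zero (.of_forall fun ψ => by simp [refl_right])
    · cases hw

/-- The mechanism formed by the arms. -/
def armMechanism (Z : Fin s → ℂ) {i₀ i₁ : Fin s} (hZ : Z i₀ ≠ Z i₁) {a b : ι → ℝ}
    (hb : ∀ i, 0 < b i) (hab : ∀ i, b i < a i) :
    Mechanism ι Z (annuli (Z i₁) a b) (annuliWall (Z i₁) a b) where
  V := ArmVertex ι s
  κ := ι
  L := armLinkage Z hZ hb hab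
  label := armLabel
  ax _ := .inl i₁
  bx i := .inr (.inr i)
  inp i := .inr (.inr i)
  F := armCore Z
  sec := armSec Z i₁ a b
  reflective := arm_reflective
  inp_injective _ _ h := Sum.inr_injective (Sum.inr_injective h)
  label_inp _ := rfl
  F_inp _ _ := rfl
  F_analyticAt v hv y _ := by
    rcases v with j | i | i
    · exact analyticAt_const
    · cases hv
    · exact analyticAt_eval i y
  core_congr φ _ v hv := by
    rcases v with j | i | i
    · exact arm_fixed_congr φ j
    · cases hv
    · exact CMem.of_eventually_eq_zero (.of_forall fun ψ => sub_self _)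
  core_adj v w h hv hw := by
    have h0 : ∀ x y : ArmVertex ι s, ArmEdge i₀ i₁ x y → armLabel x = none → armLabel y = none →
        x ∈ range (armLinkage Z hZ hb hab).fixed ∧ y ∈ range (armLinkage Z hZ hb hab).fixed := by
      rintro _ _ (_ | i | i) h1 h2
      · exact ⟨⟨_, rfl⟩, _, rfl⟩
      · cases h2
      · cases h1
    exact h.2.elim (fun h => h0 v w h hv hw) fun h => (h0 w v h hw hv).symm
  sections :=
    { mem := fun ε y hy => armSec_mem hab ε hy
      proj := fun _ _ _ => rfl
      cont := fun ε => by
        refine continuousOn_pi.2 fun x => ?_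
        rcases x with j | i | i
        · exact continuousOn_const
        · intro y hy
          have h0 := (sq_le_normSq_of_mem_annuli hab hy i).1
          have hc : Continuous fun y : ι → ℂ => Complex.normSq (y i - Z i₁) :=
            Complex.continuous_normSq.comp ((continuous_apply _).sub continuous_const)
          have he : ContinuousAt (fun y : ι → ℂ =>
              elbow (a i) (b i) (Complex.normSq (y i - Z i₁)) (ε i)) y :=
            ContinuousAt.comp (g := fun t => elbow (a i) (b i) t (ε i))
              (continuousAt_elbow h0 (ε i)) hc.continuousAt
          exact (continuousAt_const.add (((continuous_apply i).continuousAt.sub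
            continuousAt_const).mul he)).continuousWithinAt
        · exact (continuous_apply i).continuousOn
      analyticAt := fun ε y hy => by
        refine AnalyticAt.pi fun x => ?_
        rcases x with j | i | i
        · exact analyticAt_const
        · obtain ⟨h0, h1, h2⟩ := sq_lt_normSq_of_mem_annuli_diff hab hy i
          exact analyticAt_relPos analyticAt_const (analyticAt_eval _ _)
            (analyticAt_elbow h0 h1 h2 _)
        · exact analyticAt_eval i y
      exists_eq := fun φ hφ => arm_exists hφ
      inj := fun y hy ε ε' h => by
        funext i
        obtain ⟨h0, h1, h2⟩ := sq_lt_normSq_of_mem_annuli_diff hab hy i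
        refine elbow_injective h0 h1 h2 ?_
        have := congrFun h (.inr (.inl i))
        simp only [armSec, relPos, add_right_inj] at this
        exact mul_left_cancel₀ (Complex.normSq_pos.1 h0) this
      congrAt := fun ε y hy => by
        refine congrAt_pi_iff.2 fun x => ?_
        rcases x with j | i | i
        · exact arm_fixed_congr _ j
        · exact arm_elbow_congr ε hy i
        · exact CMem.of_eventually_eq_zero (.of_forall fun ψ => sub_self _) }
  sec_mul δ ε y hy := by
    funext x
    rcases x with j | i | i
    · exact labelAct_none _ _ rfl
    · rw [labelAct_some (label := armLabel) (v := .inr (.inl i)) (k := i) _ _ rfl]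
      have hne : Z i₁ ≠ y i := fun h => by
        have := (sq_le_normSq_of_mem_annuli hab hy i).1
        simp [h] at this
      have e := elbow_mul (R := a i) (q := b i) (t := Complex.normSq (y i - Z i₁)) (δ i) (ε i)
      simp only [armSec, relPos, twist, Pi.mul_apply, e]
      split_ifs
      · rfl
      · exact refl_add_mul _ _ _ hne
    · exact labelAct_none _ _ rfl

end Arms

/-! ### Choice of the bars of an inversor for a compact set of distances. -/

section Parameters

/-- Set `R + q = N` and `R - q = ρ / N`, so that `R ^ 2 - q ^ 2 = ρ` for either sign of `ρ`, and let
`N ^ 2 = S` be large: then `(R - q) ^ 2 = ρ ^ 2 / S` is small and `(R + q) ^ 2 = S` is large. The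
chain has `(2 * h) ^ 2 = 4 * ρ ^ 2 / t₀`, which exceeds `ρ ^ 2 / t` for all `t ∈ T`. The sum `2 * R
^ 2 + 2 * q ^ 2` is larger than `S`, and `S` contains this term and a bound for `t`, so coinciding
elbows are out of reach. -/
theorem exists_peaucellier_parameters {T : Set ℝ} (hT : IsCompact T) (hpos : ∀ t ∈ T, 0 < t)
    {ρ : ℝ} (hρ : ρ ≠ 0) (hρT : ρ ∉ T) :
    ∃ R q h : ℝ, 0 < R ∧ 0 < q ∧ 0 < h ∧ R ≠ q ∧ R ^ 2 - q ^ 2 = ρ ∧ T ⊆ peaucellierRange R q h := by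
  obtain ⟨t₀, h₀, ht₀⟩ : ∃ t₀ : ℝ, 0 < t₀ ∧ ∀ t ∈ T, t₀ ≤ t := by
    rcases T.eq_empty_or_nonempty with rfl | hne
    · exact ⟨1, one_pos, by simp⟩
    · obtain ⟨t₀, h1, h2⟩ := hT.exists_isLeast hne
      exact ⟨t₀, hpos _ h1, h2⟩
  obtain ⟨t₁, ht₁⟩ := hT.bddAbove
  set S : ℝ := 1 + |ρ| + |t₁| + 4 * ρ ^ 2 / t₀ with hS
  have h4 : 0 ≤ 4 * ρ ^ 2 / t₀ := by positivity
  have hρ2 : 0 < ρ ^ 2 := by positivity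
  have hS1 : 1 ≤ S := by have := abs_nonneg ρ; have := abs_nonneg t₁; linarith
  have hSρ : |ρ| < S := by have := abs_nonneg t₁; linarith
  set N := Real.sqrt S
  have hN : 0 < N := Real.sqrt_pos.2 (by linarith)
  have hN2 : N ^ 2 = S := Real.sq_sqrt (by linarith)
  have hq : |ρ / N| < N := by
    rw [abs_div, abs_of_pos hN, div_lt_iff₀ hN, ← sq, hN2]
    exact hSρ
  have hq' := abs_lt.1 hq
  have hsq : ρ ^ 2 / S < t₀ := by
    have h5 : 4 * ρ ^ 2 / t₀ < S := by
      have := abs_nonneg t₁; have := abs_nonneg ρ; linarith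
    rw [div_lt_iff₀ h₀] at h5
    rw [div_lt_iff₀ (by linarith)]
    linarith
  have hd : ((N + ρ / N) / 2) ^ 2 - ((N - ρ / N) / 2) ^ 2 = ρ := by field_simp; ring
  have hh : (2 * (|ρ| / Real.sqrt t₀)) ^ 2 = 4 * ρ ^ 2 / t₀ := by
    rw [mul_pow, div_pow, sq_abs, Real.sq_sqrt h₀.le]
    ring
  have hρN : 0 < (ρ / N) ^ 2 := by positivity
  refine ⟨(N + ρ / N) / 2, (N - ρ / N) / 2, |ρ| / Real.sqrt t₀, by linarith, by linarith,
    div_pos (abs_pos.2 hρ) (Real.sqrt_pos.2 h₀), fun h => hρ ?_, hd, fun t ht => ?_⟩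
  · rw [← hd, h, sub_self]
  · have h5 := ht₀ t ht
    have h6 := (ht₁ ht).trans (le_abs_self t₁)
    have h7 := abs_nonneg ρ
    refine ⟨hpos t ht, ?_, ?_, ?_, ?_, ?_⟩
    · have : (N + ρ / N) / 2 - (N - ρ / N) / 2 = ρ / N := by ring
      rw [this, div_pow, hN2]
      linarith
    · have : (N + ρ / N) / 2 + (N - ρ / N) / 2 = N := by ring
      rw [this, hN2]
      linarith
    · rw [hd, hh]
      have : 0 < ρ ^ 2 / t₀ := by positivity
      calc ρ ^ 2 / t ≤ ρ ^ 2 / t₀ := by gcongr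
        _ < 4 * ρ ^ 2 / t₀ := by rw [mul_div_assoc]; linarith
    · rw [hh]
      have : 2 * ((N + ρ / N) / 2) ^ 2 + 2 * ((N - ρ / N) / 2) ^ 2 = N ^ 2 + (ρ / N) ^ 2 := by ring
      rw [this, hN2]
      linarith
    · rw [hd]
      rintro rfl
      exact hρT ht

end Parameters

/-! ### Functions constructible by inversions are closed under ring operations. -/

section Constructible

variable {ι : Type} {s : ℕ} {Z : Fin s → ℂ} {D Wall : Set (ι → ℂ)}

/-- The functions on `D` that are obtained from the coordinates and the constants `Z j` by
inversions in circles centred at one function. -/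
inductive IsConstructible (Z : Fin s → ℂ) (D : Set (ι → ℂ)) : ((ι → ℂ) → ℂ) → Prop
  | fixed (j : Fin s) : IsConstructible Z D fun _ => Z j
  | coord (i : ι) : IsConstructible Z D fun y => y i
  | inv {f g : (ι → ℂ) → ℂ} (ρ : ℝ) (hf : IsConstructible Z D f) (hg : IsConstructible Z D g)
      (hρ : ρ ≠ 0) (hfg : ∀ y ∈ D, f y ≠ g y)
      (hD : ∀ y ∈ D, Complex.normSq (g y - f y) ≠ ρ) :
      IsConstructible Z D fun y => f y + ρ / conj (g y - f y)
  | congr {f g : (ι → ℂ) → ℂ} (hf : IsConstructible Z D f) (h : EqOn f g D) :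
      IsConstructible Z D g

theorem peaucellier_relPos {R q h ρ : ℝ} (hρ : R ^ 2 - q ^ 2 = ρ) (η : Fin 2 → ℤˣ) {a b : ℂ}
    (hab : a ≠ b) : relPos (peaucellierPos R q h η 2) a b = a + ρ / conj (b - a) := by
  have h0 : b - a ≠ 0 := sub_ne_zero.2 hab.symm
  have h1 : conj (b - a) ≠ 0 := (map_ne_zero _).2 h0
  rw [relPos, peaucellierPos_two, hρ]
  push_cast
  rw [← Complex.mul_conj]
  field_simp

namespace Mechanism

variable [Fintype ι]

theorem F_fixed (M : Mechanism ι Z D Wall) (j : Fin s) : EqOn (M.F (M.L.fixed j)) (fun _ => Z j) D := by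
  intro y hy
  rw [← M.sec_core 1 hy (M.reflective.label_fixed j)]
  exact (mem_configSpace_iff.1 (M.sections.mem 1 y hy)).2 j

/-- Compactness of `D` makes the conditions on the distance uniform, so that one inversor serves all
inputs. The result is a new vertex, which is used to keep outputs apart from inputs. -/
theorem exists_inv (M : Mechanism ι Z D Wall) (hDc : IsCompact D) (hDn : D.Nonempty) {A B : M.V}
    (hA : M.label A = none) (hB : M.label B = none) {ρ : ℝ} (hρ : ρ ≠ 0)
    (hne : ∀ y ∈ D, M.F A y ≠ M.F B y)
    (hρD : ∀ y ∈ D, Complex.normSq (M.F B y - M.F A y) ≠ ρ) :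
    ∃ (M' : Mechanism ι Z D Wall) (e : Hom M M') (v : M'.V), M'.label v = none ∧ v ∉ range e.e ∧
      EqOn (M'.F v) (fun y => M.F A y + ρ / conj (M.F B y - M.F A y)) D := by
  have hc : ContinuousOn (fun y => Complex.normSq (M.F B y - M.F A y)) D := fun y hy =>
    (analyticAt_normSq ((M.F_analyticAt B hB y hy).sub
      (M.F_analyticAt A hA y hy))).continuousAt.continuousWithinAt
  obtain ⟨R, q, h, hR, hq, hh, hRq, hd, hT⟩ := exists_peaucellier_parameters
    (hDc.image_of_continuousOn hc)
    (by
      rintro _ ⟨y, hy, rfl⟩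
      exact Complex.normSq_pos.2 (sub_ne_zero.2 (hne y hy).symm)) hρ
    (by
      rintro ⟨y, hy, e⟩
      exact hρD y hy e)
  -- Distinctness of the vertices themselves needs an actual input, hence a nonempty `D`.
  have hAB : A ≠ B := by
    rintro rfl
    obtain ⟨y, hy⟩ := hDn
    exact hne y hy rfl
  have hg := peaucellier_isGood hR hq hh hRq
  refine ⟨M.attach hg hA hB hAB fun y hy => hT ⟨y, hy, rfl⟩,
    M.attachHom hg hA hB hAB fun y hy => hT ⟨y, hy, rfl⟩, Sum.inr 2, ?_, ?_, fun y hy => ?_⟩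
  · rfl
  · rintro ⟨v, hv⟩
    cases hv
  · exact peaucellier_relPos hd 1 (hne y hy)

end Mechanism

namespace IsConstructible

/-- The inversor needs `f` and `g` in a common mechanism: `g` is built on top of the one for `f`,
and extensions preserve the positions of old vertices. -/
theorem exists_mechanism [Fintype ι] (hDc : IsCompact D) (hDn : D.Nonempty) {f : (ι → ℂ) → ℂ}
    (hf : IsConstructible Z D f) (M : Mechanism ι Z D Wall) :
    ∃ (M' : Mechanism ι Z D Wall) (_ : M.Hom M') (v : M'.V), M'.label v = none ∧
      EqOn (M'.F v) f D := by
  induction hf generalizing M with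
  | fixed j => exact ⟨M, .refl M, M.L.fixed j, M.reflective.label_fixed j, M.F_fixed j⟩
  | coord i => exact ⟨M, .refl M, M.inp i, M.label_inp i, fun y _ => M.F_inp i y⟩
  | inv ρ hf hg hρ hfg hD ihf ihg =>
    obtain ⟨M₁, e₁, A, hA, hAf⟩ := ihf M
    obtain ⟨M₂, e₂, B, hB, hBg⟩ := ihg M₁
    have hA' := hAf
    rw [← e₂.F_eq] at hA'
    obtain ⟨M₃, e₃, v, hv, -, h⟩ := M₂.exists_inv hDc hDn (e₂.label_eq A hA) hB hρ
      (fun y hy => by rw [hA' hy, hBg hy]; exact hfg y hy)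
      (fun y hy => by rw [hA' hy, hBg hy]; exact hD y hy)
    exact ⟨M₃, e₁.trans (e₂.trans e₃), v, hv, fun y hy => by
      rw [h hy]; simp only [hA' hy, hBg hy]⟩
  | congr _ h ih =>
    obtain ⟨M', e, v, hv, hvf⟩ := ih M
    exact ⟨M', e, v, hv, hvf.trans h⟩

theorem continuousOn {f : (ι → ℂ) → ℂ} (hf : IsConstructible Z D f) : ContinuousOn f D := by
  induction hf with
  | fixed j => exact continuousOn_const
  | coord i => exact (continuous_apply i).continuousOn
  | inv ρ _ _ _ hfg _ ihf ihg =>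
    refine ihf.add (continuousOn_const.div
      (Complex.continuous_conj.comp_continuousOn (ihg.sub ihf)) fun y hy => ?_)
    exact (map_ne_zero _).2 (sub_ne_zero.2 (hfg y hy).symm)
  | congr _ h ih => exact ih.congr h.symm

variable {f g : (ι → ℂ) → ℂ}

theorem exists_bound (hDc : IsCompact D) (hf : IsConstructible Z D f) :
    ∃ K : ℝ, 0 < K ∧ ∀ y ∈ D, ‖f y‖ < K := by
  obtain ⟨K, hK⟩ := hDc.exists_bound_of_continuousOn hf.continuousOn
  exact ⟨|K| + 1, by positivity, fun y hy => (hK y hy).trans_lt (by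
    have := le_abs_self K; linarith)⟩

theorem exists_normSq_bound (hDc : IsCompact D) (hf : IsConstructible Z D f)
    (hg : IsConstructible Z D g) :
    ∃ K : ℝ, 0 < K ∧ ∀ y ∈ D, Complex.normSq (g y - f y) < K := by
  obtain ⟨K, hK⟩ := hDc.exists_bound_of_continuousOn
    (Complex.continuous_normSq.comp_continuousOn (hg.continuousOn.sub hf.continuousOn))
  exact ⟨|K| + 1, by positivity, fun y hy =>
    ((le_abs_self _).trans (hK y hy)).trans_lt (by have := le_abs_self K; linarith)⟩

/-- Inversions with the same centre and powers `ρ` and `r * ρ` compose to the homothety of ratio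
`r`. The second inversion is left to be done, so that its result can be placed at a fresh vertex. -/
theorem line (hDc : IsCompact D) (hf : IsConstructible Z D f) (hg : IsConstructible Z D g)
    (hfg : ∀ y ∈ D, f y ≠ g y) {r : ℝ} (hr : r ≠ 0) :
    ∃ w, IsConstructible Z D w ∧ ∃ ρ : ℝ, ρ ≠ 0 ∧ (∀ y ∈ D, f y ≠ w y) ∧
      (∀ y ∈ D, Complex.normSq (w y - f y) ≠ ρ) ∧
      EqOn (fun y => f y + ρ / conj (w y - f y)) (fun y => f y + r * (g y - f y)) D := by
  obtain ⟨K, hK, hKD⟩ := exists_normSq_bound hDc hf hg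
  -- The excluded squared distances `ρ` and, after the first inversion, `ρ / r` exceed in absolute
  -- value `K`, a strict bound for the squared distance from `f` to `g`.
  set ρ := K + |r| * K with hρ
  have hKρ : K ≤ ρ := by have := abs_nonneg r; nlinarith
  have hρ0 : 0 < ρ := by linarith
  have hsub : ∀ y ∈ D, g y - f y ≠ 0 := fun y hy => sub_ne_zero.2 (hfg y hy).symm
  have hcsub : ∀ y ∈ D, conj (g y - f y) ≠ 0 := fun y hy => (map_ne_zero _).2 (hsub y hy)
  have hρC : (ρ : ℂ) ≠ 0 := by exact_mod_cast hρ0.ne'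
  have hw := inv ρ hf hg hρ0.ne' hfg fun y hy => ((hKD y hy).trans_le hKρ).ne
  refine ⟨_, hw, r * ρ, mul_ne_zero hr hρ0.ne', fun y hy h => ?_, fun y hy h => ?_, fun y hy => ?_⟩
  · exact div_ne_zero hρC (hcsub y hy) (by simpa using h.symm)
  · simp only [add_sub_cancel_left] at h
    rw [Complex.normSq_div, Complex.normSq_conj, Complex.normSq_ofReal] at h
    have hp := Complex.normSq_pos.2 (hsub y hy)
    rw [div_eq_iff hp.ne'] at h
    have h2 : ρ = r * Complex.normSq (g y - f y) := by
      refine mul_left_cancel₀ hρ0.ne' ?_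
      linarith
    have h3 : r * Complex.normSq (g y - f y) ≤ |r| * K :=
      mul_le_mul (le_abs_self r) (hKD y hy).le hp.le (abs_nonneg r)
    linarith
  · have h1 := hcsub y hy
    have h2 := hsub y hy
    simp only [add_sub_cancel_left, map_div₀, Complex.conj_conj, Complex.conj_ofReal]
    push_cast
    field_simp

theorem lineMap (hDc : IsCompact D) (hf : IsConstructible Z D f) (hg : IsConstructible Z D g)
    (hfg : ∀ y ∈ D, f y ≠ g y) {r : ℝ} (hr : r ≠ 0) :
    IsConstructible Z D fun y => f y + r * (g y - f y) := by
  obtain ⟨w, hw, ρ, hρ, h1, h2, h3⟩ := line hDc hf hg hfg hr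
  exact (inv ρ hf hw hρ h1 h2).congr h3

variable {i₀ i₁ : Fin s}

theorem ofReal (hDc : IsCompact D) (h₀ : Z i₀ = 0) {l : ℝ} (hl : l ≠ 0) (h₁ : Z i₁ = l) (r : ℝ) :
    IsConstructible Z D fun _ => (r : ℂ) := by
  have hl' : (l : ℂ) ≠ 0 := by exact_mod_cast hl
  rcases eq_or_ne r 0 with rfl | hr
  · exact (fixed i₀).congr fun y _ => by simp [h₀]
  · refine (lineMap hDc (fixed i₀) (fixed i₁) (fun y _ => ?_)
      (div_ne_zero hr hl)).congr fun y _ => ?_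
    · rw [h₀, h₁]; exact hl'.symm
    · simp only [h₀, h₁]
      push_cast
      field_simp
      ring

/-- The domain `D` is compact and the real constants are constructible on it. -/
structure Base (Z : Fin s → ℂ) (D : Set (ι → ℂ)) : Prop where
  isCompact : IsCompact D
  ofReal : ∀ r : ℝ, IsConstructible Z D fun _ => (r : ℂ)

theorem ofReal_ne_of_norm_lt {K r : ℝ} (hr : K ≤ |r|) {z : ℂ} (hz : ‖z‖ < K) : (r : ℂ) ≠ z := by
  rintro rfl
  rw [Complex.norm_real, Real.norm_eq_abs] at hz
  linarith

/-- Homotheties of ratios `2` and `1 / 2` with different real centres compose to a translation. The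
centres are so far out that the moving point never meets them. -/
theorem add_ofReal (hb : Base Z D) (hf : IsConstructible Z D f) (c : ℝ) :
    IsConstructible Z D fun y => f y + c := by
  obtain ⟨K, hK, hKD⟩ := hf.exists_bound hb.isCompact
  have h1 := lineMap hb.isCompact (hb.ofReal (K + |c|)) hf
    (fun y hy => ofReal_ne_of_norm_lt
      ((le_add_of_nonneg_right (abs_nonneg c)).trans (le_abs_self _)) (hKD y hy)) (r := 2) two_ne_zero
  refine (lineMap hb.isCompact (hb.ofReal (K + |c| + 2 * c)) h1 (fun y hy h => ?_)
    (r := 1 / 2) (by norm_num)).congr fun y hy => ?_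
  · refine ofReal_ne_of_norm_lt (r := K + |c| + c) ?_ (hKD y hy) ?_
    · refine le_trans ?_ (le_abs_self _)
      have := neg_abs_le c
      linarith
    · push_cast at h ⊢
      linear_combination (1 / 2) * h
  · push_cast
    ring

/-- A homothety of ratio `c` with centre `K` out of reach of `f`, followed by a translation by `(c -
1) * K`. -/
theorem ofReal_mul (hb : Base Z D) (hf : IsConstructible Z D f) (c : ℝ) :
    IsConstructible Z D fun y => c * f y := by
  rcases eq_or_ne c 0 with rfl | hc
  · exact (hb.ofReal 0).congr fun y _ => by simp
  · obtain ⟨K, hK, hKD⟩ := hf.exists_bound hb.isCompact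
    have h1 := lineMap hb.isCompact (hb.ofReal K) hf
      (fun y hy => ofReal_ne_of_norm_lt (le_abs_self _) (hKD y hy)) hc
    refine (add_ofReal hb h1 ((c - 1) * K)).congr fun y _ => ?_
    push_cast
    ring

/-- The midpoint of `f + (K + K')` and `g`, doubled and translated back. The first translation keeps
the two points apart. -/
theorem add (hb : Base Z D) (hf : IsConstructible Z D f) (hg : IsConstructible Z D g) :
    IsConstructible Z D fun y => f y + g y := by
  obtain ⟨K, hK, hKD⟩ := hf.exists_bound hb.isCompact
  obtain ⟨K', hK', hKD'⟩ := hg.exists_bound hb.isCompact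
  have h1 := lineMap hb.isCompact (add_ofReal hb hf (K + K')) hg (fun y hy h => by
    refine ofReal_ne_of_norm_lt (r := K + K') (z := g y - f y) (le_abs_self _) ?_
      (by linear_combination h)
    calc ‖g y - f y‖ ≤ ‖g y‖ + ‖f y‖ := norm_sub_le _ _
      _ < K + K' := by linarith [hKD y hy, hKD' y hy]) (r := 1 / 2) (by norm_num)
  refine (add_ofReal hb (ofReal_mul hb h1 2) (-(K + K'))).congr fun y _ => ?_
  push_cast
  ring

theorem sub (hb : Base Z D) (hf : IsConstructible Z D f) (hg : IsConstructible Z D g) :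
    IsConstructible Z D fun y => f y - g y :=
  (add hb hf (ofReal_mul hb hg (-1))).congr fun y _ => by push_cast; ring

theorem inv_conj (hb : Base Z D) (hf : IsConstructible Z D f) (h0 : ∀ y ∈ D, f y ≠ 0) :
    IsConstructible Z D fun y => 1 / conj (f y) := by
  obtain ⟨K, hK, hKD⟩ := exists_normSq_bound hb.isCompact (hb.ofReal 0) hf
  have h1 := inv K (hb.ofReal 0) hf hK.ne' (fun y hy h => h0 y hy (by simpa using h.symm))
    fun y hy => (hKD y hy).ne
  refine (ofReal_mul hb h1 (1 / K)).congr fun y hy => ?_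
  have hKC : (K : ℂ) ≠ 0 := by exact_mod_cast hK.ne'
  have := (map_ne_zero (starRingEnd ℂ)).2 (h0 y hy)
  simp only [Complex.ofReal_zero, zero_add, sub_zero]
  push_cast
  field_simp

/-- From `1 / conj (f - K) - 1 / conj (f + K) = 2 * K / conj (f ^ 2 - K ^ 2)`; a second use of
`inv_conj` removes the conjugation and gives `(f ^ 2 - K ^ 2) / (2 * K)`. As `‖f‖ < K`, no
denominator vanishes. -/
theorem sq (hb : Base Z D) (hf : IsConstructible Z D f) : IsConstructible Z D fun y => f y ^ 2 := by
  obtain ⟨K, hK, hKD⟩ := hf.exists_bound hb.isCompact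
  have hKC : (K : ℂ) ≠ 0 := by exact_mod_cast hK.ne'
  have n1 : ∀ y ∈ D, f y + (-K : ℝ) ≠ 0 := fun y hy h =>
    ofReal_ne_of_norm_lt (le_abs_self _) (hKD y hy) (by push_cast at h; linear_combination -h)
  have n2 : ∀ y ∈ D, f y + (K : ℝ) ≠ 0 := fun y hy h =>
    ofReal_ne_of_norm_lt (r := -K) (by rw [abs_neg]; exact le_abs_self _) (hKD y hy)
      (by push_cast; linear_combination -h)
  have h1 := inv_conj hb (add_ofReal hb hf (-K)) n1
  have h2 := inv_conj hb (add_ofReal hb hf K) n2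
  have e : ∀ y ∈ D, 1 / conj (f y + (-K : ℝ)) - 1 / conj (f y + K) =
      2 * K / conj ((f y + (-K : ℝ)) * (f y + K)) := by
    intro y hy
    have k1 := (map_ne_zero (starRingEnd ℂ)).2 (n1 y hy)
    have k2 := (map_ne_zero (starRingEnd ℂ)).2 (n2 y hy)
    rw [map_mul]
    field_simp
    simp
    ring
  have h3 : IsConstructible Z D fun y => 2 * K / conj ((f y + (-K : ℝ)) * (f y + K)) :=
    (sub hb h1 h2).congr e
  have h4 := inv_conj hb h3 fun y hy => div_ne_zero (mul_ne_zero two_ne_zero hKC)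
    ((map_ne_zero _).2 (mul_ne_zero (n1 y hy) (n2 y hy)))
  refine (add_ofReal hb (ofReal_mul hb h4 (2 * K)) (K ^ 2)).congr fun y hy => ?_
  have k1 := n1 y hy
  have k2 := n2 y hy
  simp only [map_div₀, Complex.conj_conj, map_mul, Complex.conj_ofReal, map_ofNat]
  push_cast at k1 k2 ⊢
  field_simp
  ring

/-- Polarization of squares. -/
theorem mul (hb : Base Z D) (hf : IsConstructible Z D f) (hg : IsConstructible Z D g) :
    IsConstructible Z D fun y => f y * g y := by
  refine (ofReal_mul hb (sub hb (sq hb (add hb hf hg)) (sq hb (sub hb hf hg))) (1 / 4)).congr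
    fun y _ => ?_
  push_cast
  ring

theorem aeval (hb : Base Z D) {σ R : Type*} [CommSemiring R] [Algebra R ℂ]
    (hR : ∀ r : R, IsConstructible Z D fun _ => algebraMap R ℂ r) {u : σ → (ι → ℂ) → ℂ}
    (hu : ∀ i, IsConstructible Z D (u i)) (p : MvPolynomial σ R) :
    IsConstructible Z D fun y => MvPolynomial.aeval (fun i => u i y) p := by
  induction p using MvPolynomial.induction_on with
  | C r => simpa only [MvPolynomial.aeval_C] using hR r
  | add p q hp hq => simpa only [map_add] using add hb hp hq
  | mul_X p i hp => simpa only [map_mul, MvPolynomial.aeval_X] using mul hb hp (hu i)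

/-- `exists_mechanism` may return an old vertex, for instance an input, whereas outputs must be
distinct from inputs and from each other. A homothety of ratio `1` ends with an inversion and so
copies the value to a new vertex. -/
theorem exists_fresh [Fintype ι] (hb : Base Z D) (hDn : D.Nonempty) (hf : IsConstructible Z D f)
    (M : Mechanism ι Z D Wall) :
    ∃ (M' : Mechanism ι Z D Wall) (e : M.Hom M') (v : M'.V), M'.label v = none ∧ v ∉ range e.e ∧
      EqOn (M'.F v) f D := by
  obtain ⟨K, hK, hKD⟩ := hf.exists_bound hb.isCompact
  obtain ⟨w, hw, ρ, hρ, h1, h2, h3⟩ := line hb.isCompact (hb.ofReal K) hf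
    (fun y hy => ofReal_ne_of_norm_lt (le_abs_self _) (hKD y hy)) one_ne_zero
  obtain ⟨M₁, e₁, A, hA, hAf⟩ := (hb.ofReal K).exists_mechanism hb.isCompact hDn M
  obtain ⟨M₂, e₂, B, hB, hBg⟩ := hw.exists_mechanism hb.isCompact hDn M₁
  have hA' := hAf
  rw [← e₂.F_eq] at hA'
  obtain ⟨M₃, e₃, v, hv, hve, h⟩ := M₂.exists_inv hb.isCompact hDn (e₂.label_eq A hA) hB hρ
      (fun y hy => by rw [hA' hy, hBg hy]; exact h1 y hy)
      (fun y hy => by rw [hA' hy, hBg hy]; exact h2 y hy)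
  refine ⟨M₃, e₁.trans (e₂.trans e₃), v, hv, ?_, fun y hy => ?_⟩
  · rintro ⟨x, rfl⟩
    exact hve ⟨_, rfl⟩
  · have := h3 hy
    simp only at this
    rw [h hy]
    simp only [hA' hy, hBg hy, this]
    push_cast
    ring

theorem exists_family [Fintype ι] (hb : Base Z D) (hDn : D.Nonempty) (M : Mechanism ι Z D Wall)
    {n : ℕ} {F : Fin n → (ι → ℂ) → ℂ} (hF : ∀ j, IsConstructible Z D (F j)) :
    ∃ (M' : Mechanism ι Z D Wall) (e : M.Hom M') (Q : Fin n → M'.V), Function.Injective Q ∧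
      ∀ j, M'.label (Q j) = none ∧ Q j ∉ range e.e ∧ EqOn (M'.F (Q j)) (F j) D := by
  induction n with
  | zero => exact ⟨M, .refl M, Fin.elim0, fun j => j.elim0, fun j => j.elim0⟩
  | succ n ih =>
    obtain ⟨M₁, e₁, Q, hQ, h⟩ := ih fun j => hF j.castSucc
    obtain ⟨M₂, e₂, v, hv, hve, hvF⟩ := (hF (Fin.last n)).exists_fresh hb hDn M₁
    refine ⟨M₂, e₁.trans e₂, Fin.snoc (e₂.e ∘ Q) v, ?_, fun j => ?_⟩
    · rw [Fin.snoc_injective_iff]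
      refine ⟨e₂.injective.comp hQ, ?_⟩
      rintro ⟨j, rfl⟩
      exact hve ⟨_, rfl⟩
    · refine Fin.lastCases ?_ (fun j => ?_) j
      · rw [Fin.snoc_last]
        refine ⟨hv, ?_, hvF⟩
        rintro ⟨x, rfl⟩
        exact hve ⟨_, rfl⟩
      · rw [Fin.snoc_castSucc]
        obtain ⟨h1, h2, h3⟩ := h j
        refine ⟨e₂.label_eq _ h1, ?_, ?_⟩
        · rintro ⟨x, hx⟩
          exact h2 ⟨x, e₂.injective hx⟩
        · rw [Function.comp_apply, e₂.F_eq]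
          exact h3

end IsConstructible

end Constructible

/-! ### Annuli in Euclidean space around a given ball. -/

section EuclideanAnnuli

variable {𝕜 : Type*} [RCLike 𝕜] {m : ℕ}

/-- The products of annuli in Euclidean space. -/
def euclideanAnnuli (c : 𝕜) (a b : Fin m → ℝ) : Set (EuclideanSpace 𝕜 (Fin m)) :=
  PiLp.homeomorph 2 (fun _ => 𝕜) ⁻¹' annuli c a b

/-- The walls of the annuli in Euclidean space. -/
def euclideanWall (c : 𝕜) (a b : Fin m → ℝ) : Set (EuclideanSpace 𝕜 (Fin m)) :=
  PiLp.homeomorph 2 (fun _ => 𝕜) ⁻¹' annuliWall c a b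

variable {c : 𝕜} {a b : Fin m → ℝ}

theorem isCompact_euclideanAnnuli : IsCompact (euclideanAnnuli c a b) :=
  (Homeomorph.isCompact_preimage _).2 isCompact_annuli

theorem isClosed_euclideanWall : IsClosed (euclideanWall c a b) :=
  isClosed_annuliWall.preimage (Homeomorph.continuous _)

theorem euclideanAnnuli_subset_closure (hb : ∀ i, 0 < b i) (hab : ∀ i, b i < a i) :
    euclideanAnnuli c a b ⊆ closure (euclideanAnnuli c a b \ euclideanWall c a b) := by
  have h := preimage_mono (f := PiLp.homeomorph 2 fun _ : Fin m => 𝕜)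
    (annuli_subset_closure (c := c) hb hab)
  rw [Homeomorph.preimage_closure] at h
  exact h

/-- The radii for which the annuli around `M + 1` contain the ball of radius `M` around `0`. -/
theorem closedBall_lt_annuli {O : EuclideanSpace 𝕜 (Fin m)} {r : ℝ} (hr : 0 < r)
    {x : EuclideanSpace 𝕜 (Fin m)} (hx : x ∈ Metric.closedBall O r) (i : Fin m) :
    1 ≤ ‖x i - ((‖O‖ + r + 1 : ℝ) : 𝕜)‖ ∧ ‖x i - ((‖O‖ + r + 1 : ℝ) : 𝕜)‖ ≤ 2 * (‖O‖ + r) + 1 := by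
  have h1 : ‖x‖ ≤ ‖O‖ + r := by
    have h := norm_add_le O (x - O)
    rw [add_sub_cancel] at h
    rw [mem_closedBall_iff_norm] at hx
    linarith
  have h2 := (PiLp.norm_apply_le x i).trans h1
  have h3 : ‖((‖O‖ + r + 1 : ℝ) : 𝕜)‖ = ‖O‖ + r + 1 := by
    rw [RCLike.norm_ofReal, abs_of_nonneg (by positivity)]
  have h4 := norm_sub_le (x i) ((‖O‖ + r + 1 : ℝ) : 𝕜)
  have h5 := norm_sub_norm_le ((‖O‖ + r + 1 : ℝ) : 𝕜) (x i)
  rw [norm_sub_rev] at h5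
  constructor <;> linarith

/-- The lengths of the upper arms, for inputs of size at most `M`. -/
def upperLen (M : ℝ) : ℝ := M + 5 / 4

/-- The lengths of the lower arms, for inputs of size at most `M`. -/
def lowerLen (M : ℝ) : ℝ := M + 3 / 4

theorem closedBall_subset_interior {O : EuclideanSpace 𝕜 (Fin m)} {r : ℝ} (hr : 0 < r) :
    Metric.closedBall O r ⊆ interior (euclideanAnnuli ((‖O‖ + r + 1 : ℝ) : 𝕜)
      (fun _ => upperLen (‖O‖ + r)) fun _ => lowerLen (‖O‖ + r)) := by
  intro x hx
  refine interior_maximal (fun x hx i => ⟨(hx i).1.le, (hx i).2.le⟩)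
    ((isOpen_lt_annuli (c := ((‖O‖ + r + 1 : ℝ) : 𝕜)) (a := fun _ : Fin m => upperLen (‖O‖ + r))
      (b := fun _ => lowerLen (‖O‖ + r))).preimage
        (PiLp.homeomorph 2 fun _ : Fin m => 𝕜).continuous) fun i => ?_
  obtain ⟨h1, h2⟩ := closedBall_lt_annuli hr hx i
  have : 0 ≤ ‖O‖ := norm_nonneg O
  -- With `M = ‖O‖ + r` the annulus has radii `1 / 2` and `2 * M + 2`, strictly outside the range
  -- from `1` to `2 * M + 1` that the ball occupies.
  simp only [upperLen, lowerLen]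
  constructor
  · exact lt_of_lt_of_le (by linarith) h1
  · exact lt_of_le_of_lt h2 (by linarith)

theorem closedBall_disjoint_wall {O : EuclideanSpace 𝕜 (Fin m)} {r : ℝ} (hr : 0 < r) :
    Disjoint (Metric.closedBall O r) (euclideanWall ((‖O‖ + r + 1 : ℝ) : 𝕜)
      (fun _ => upperLen (‖O‖ + r)) fun _ => lowerLen (‖O‖ + r)) := by
  rw [disjoint_left]
  rintro x hx ⟨i, hi⟩
  obtain ⟨h1, h2⟩ := closedBall_lt_annuli hr hx i
  have : 0 ≤ ‖O‖ := norm_nonneg O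
  simp only [upperLen, lowerLen] at hi
  have h3 : (PiLp.homeomorph 2 (fun _ : Fin m => 𝕜)) x i = x i := rfl
  rw [h3] at hi
  rcases hi with hi | hi <;> linarith

end EuclideanAnnuli

/-! ### Complex functional linkages from mechanisms. -/

section ComplexCase

variable {m n s : ℕ} {Z : Fin s → ℂ}

theorem inputMap_complex {V : Type*} (P : Fin m → V) (φ : V → ℂ) :
    inputMap ℂ P φ = WithLp.toLp 2 (φ ∘ P) := by
  ext i
  simp [inputMap]

/-- Deck transformations and sections are both indexed by families of signs, and by `sec_mul` the
former act on the latter by translation, hence simply transitively. -/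
theorem Mechanism.realizesOver {a b : Fin m → ℝ} {c : ℂ} (hb : ∀ i, 0 < b i) (hab : ∀ i, b i < a i)
    (M : Mechanism (Fin m) Z (annuli c a b) (annuliWall c a b)) {Q : Fin n → M.V}
    (hQ : Function.Injective Q) (hQP : ∀ j i, Q j ≠ M.inp i) (hQl : ∀ j, M.label (Q j) = none)
    {F : EuclideanSpace ℂ (Fin m) → EuclideanSpace ℂ (Fin n)}
    (hF : ∀ j, EqOn (M.F (Q j)) (fun y => F (WithLp.toLp 2 y) j) (annuli c a b))
    {O : EuclideanSpace ℂ (Fin m)} {r : ℝ} (hr : 0 < r)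
    (h1 : Metric.closedBall O r ⊆ interior (euclideanAnnuli c a b))
    (h2 : Disjoint (Metric.closedBall O r) (euclideanWall c a b)) :
    RealizesOver M.L Z M.inp Q F O (Metric.closedBall O r) := by
  have hs := M.sections
  have hproj : ∀ φ, WithLp.ofLp (inputMap ℂ M.inp φ) = φ ∘ M.inp := fun φ => by
    rw [inputMap_complex]
  refine realizesOver_of_sections (Λ := M.κ → ℤˣ) (Γ := M.κ → ℤˣ) (K := euclideanAnnuli c a b)
    (W := euclideanWall c a b) (Φ := fun ε x => M.sec ε x.ofLp)
    (act := labelAct M.label M.ax M.bx) hr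
    ⟨fun ε x hx => hs.mem ε _ hx, fun ε x hx => ?_, fun ε => ?_, fun ε x hx => ?_,
      fun φ hφ => ?_, fun x hx ε ε' h => hs.inj _ hx ε ε' h, fun ε x hx => ?_⟩
    isCompact_euclideanAnnuli isClosed_euclideanWall (euclideanAnnuli_subset_closure hb hab)
    M.reflective.isSchemeAction (fun δ φ => ?_) (fun φ hφ ψ hψ h => ?_) (fun δ φ hφ hW h => ?_)
    h1 h2 ?_ (fun φ hφ i => ?_) fun φ hφ j => ?_
  · rw [inputMap_complex]
    exact congrArg (WithLp.toLp 2) (hs.proj ε _ hx)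
  · exact (hs.cont ε).comp (PiLp.continuous_ofLp 2 _).continuousOn fun x hx => hx
  · refine (hs.analyticAt ε _ hx).fun_comp (g := M.sec ε)
      (f := fun x : EuclideanSpace ℂ (Fin m) => x.ofLp) ?_
    exact ((PiLp.continuousLinearEquiv 2 ℝ fun _ : Fin m => ℂ).toContinuousLinearMap).analyticAt x
  · rw [hproj]
    refine ⟨?_, hs.exists_eq φ hφ |>.2⟩
    have := (hs.exists_eq φ hφ).1
    rw [← hproj] at this
    exact this
  · have := hs.congrAt ε _ hx
    simp only [hproj]
    exact this
  · rw [inputMap_complex, inputMap_complex]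
    congr 1
    funext i
    exact labelAct_none _ _ (M.label_inp i)
  · obtain ⟨hy, ε, hε⟩ := hs.exists_eq φ hφ
    obtain ⟨-, ε', hε'⟩ := hs.exists_eq ψ hψ
    rw [← hproj, h, hproj] at hε hy
    -- The quotient of the signs of the two sections through `φ` and `ψ`.
    refine ⟨ε' * ε⁻¹, ?_⟩
    rw [hε, M.sec_mul _ _ _ hy, inv_mul_cancel_right]
    exact hε'.symm
  · obtain ⟨hy, ε, hε⟩ := hs.exists_eq φ hφ
    have hW' : φ ∘ M.inp ∉ annuliWall c a b := by rw [← hproj]; exact hW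
    rw [hε, M.sec_mul _ _ _ hy] at h
    exact mul_eq_right.1 (hs.inj _ ⟨hy, hW'⟩ _ _ h)
  · exact M.inp_injective.sumElim hQ fun i j h => hQP j i h.symm
  · simp [inputMap]
  · rw [M.core_eq hφ (hQl j), hF j (M.inp_mem hφ), inputMap_complex]
    simp

/-- Complex polynomial maps are realized as soon as their coefficients are constructible. -/
theorem exists_realizesOver_complex {i₀ i₁ : Fin s} {O : EuclideanSpace ℂ (Fin m)} {r : ℝ}
    (hr : 0 < r) (h₀ : Z i₀ = 0) (h₁ : Z i₁ = (‖O‖ + r + 1 : ℝ)) {R : Type*} [CommSemiring R]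
    [Algebra R ℂ]
    (hR : ∀ D : Set (Fin m → ℂ), IsConstructible.Base Z D →
      ∀ x : R, IsConstructible Z D fun _ => algebraMap R ℂ x)
    (f : Fin n → MvPolynomial (Fin m) R) :
    ∃ (V : Type) (_ : Fintype V) (L : MarkedLinkage V s) (P : Fin m → V) (Q : Fin n → V),
      L.graph.Adj (L.fixed i₀) (L.fixed i₁) ∧ L.len s(L.fixed i₀, L.fixed i₁) = ‖O‖ + r + 1 ∧
      RealizesOver L Z P Q (polyMap ℂ f) O (Metric.closedBall O r) := by
  have hl : 0 < ‖O‖ + r + 1 := by positivity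
  have hZ : Z i₀ ≠ Z i₁ := by
    rw [h₀, h₁]
    exact_mod_cast hl.ne
  have hb : ∀ _ : Fin m, 0 < lowerLen (‖O‖ + r) := fun _ => by unfold lowerLen; positivity
  have hab : ∀ _ : Fin m, lowerLen (‖O‖ + r) < upperLen (‖O‖ + r) := fun _ => by
    unfold lowerLen upperLen; linarith
  let M₀ := armMechanism Z hZ hb hab
  let D := annuli (Z i₁) (fun _ : Fin m => upperLen (‖O‖ + r)) fun _ => lowerLen (‖O‖ + r)
  have hball : Metric.closedBall O r ⊆ interior (euclideanAnnuli (Z i₁)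
      (fun _ => upperLen (‖O‖ + r)) fun _ => lowerLen (‖O‖ + r)) := by
    rw [h₁]
    exact closedBall_subset_interior hr
  have hdisj : Disjoint (Metric.closedBall O r) (euclideanWall (Z i₁)
      (fun _ => upperLen (‖O‖ + r)) fun _ => lowerLen (‖O‖ + r)) := by
    rw [h₁]
    exact closedBall_disjoint_wall hr
  have hO := interior_subset (hball (Metric.mem_closedBall_self hr.le))
  have hDn : D.Nonempty := ⟨O.ofLp, hO⟩
  have hB : IsConstructible.Base Z D :=
    ⟨isCompact_annuli, IsConstructible.ofReal isCompact_annuli h₀ hl.ne' h₁⟩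
  obtain ⟨M, e, Q, hQ, h⟩ := IsConstructible.exists_family hB hDn M₀
    (F := fun j y => MvPolynomial.aeval (fun i => y i) (f j))
    fun j => IsConstructible.aeval hB (hR D hB) (fun i => IsConstructible.coord i) (f j)
  have hadj : M₀.L.graph.Adj (M₀.L.fixed i₀) (M₀.L.fixed i₁) :=
    armLinkage_adj (hZ := hZ) (hb := hb) (hab := hab) .base
  refine ⟨M.V, inferInstance, M.L, M.inp, Q, ?_, ?_, ?_⟩
  · rw [← e.isLinkageMap.fixed, ← e.isLinkageMap.fixed]
    exact e.isLinkageMap.adj _ _ hadj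
  · rw [← e.isLinkageMap.fixed, ← e.isLinkageMap.fixed, e.isLinkageMap.len _ _ hadj]
    have : M₀.L.len s(M₀.L.fixed i₀, M₀.L.fixed i₁) = ‖Z i₀ - Z i₁‖ := rfl
    rw [this, h₀, h₁, zero_sub, norm_neg, Complex.norm_real, Real.norm_of_nonneg hl.le]
  · refine M.realizesOver hb hab hQ (fun j i hji => ?_) (fun j => (h j).1)
      (fun j => (h j).2.2) hr hball hdisj
    exact (h j).2.1 ⟨M₀.inp i, by rw [e.map_inp, hji]⟩

end ComplexCase

/-! ### Complex conjugation as a further action. -/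

section Actions

variable {V : Type*} [Fintype V] {s : ℕ} {L : MarkedLinkage V s} {Z : Fin s → ℂ}

/-- Complex conjugation of all positions. -/
def conjAct {V : Type*} (c : ℤˣ) (φ : V → ℂ) (v : V) : ℂ := if c = 1 then φ v else conj (φ v)

theorem conjAct_neg_one {V : Type*} (φ : V → ℂ) (v : V) : conjAct (-1) φ v = conj (φ v) :=
  if_neg (by decide)

theorem conjAct_one {V : Type*} (φ : V → ℂ) : conjAct 1 φ = φ := rfl

/-- Conjugation is an isometry and commutes with real affine combinations; the marking is preserved
because it is real. -/
theorem isSchemeAction_conjAct (hZ : ∀ j, conj (Z j) = Z j) :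
    IsSchemeAction L Z (conjAct : ℤˣ → (V → ℂ) → V → ℂ) where
  one φ := rfl
  mul c c' φ := by
    funext v
    rcases Int.units_eq_one_or c with rfl | rfl <;> rcases Int.units_eq_one_or c' with rfl | rfl <;>
      simp [conjAct]
  analyticAt c φ _ := by
    refine AnalyticAt.pi fun v => ?_
    rcases Int.units_eq_one_or c with rfl | rfl
    · exact analyticAt_eval v φ
    · simp only [conjAct_neg_one]
      exact analyticAt_conj (analyticAt_eval v φ)
  pullback c φ _ g hg := by
    rcases Int.units_eq_one_or c with rfl | rfl
    · exact MemIdealAt.of_mem hg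
    · have hsub : ∀ z w : ℂ, conj z - conj w = conj (z - w) := fun z w => (map_sub _ z w).symm
      have hsmul : ∀ (p : ℝ) (z : ℂ), p • conj z = conj (p • z) := fun p z => by
        simp [Complex.real_smul]
      have hadd : ∀ z w : ℂ, conj z + conj w = conj (z + w) := fun z w => (map_add _ z w).symm
      rcases hg with (⟨v, w, hvw, rfl⟩ | ⟨j, rfl | rfl⟩) | ⟨A, B, C, hT, rfl | rfl⟩
      · refine (MemIdealAt.of_mem (edgeEqs_subset ⟨v, w, hvw, rfl⟩)).congr (.of_forall fun ψ => ?_)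
        simp only [Function.comp_apply, conjAct_neg_one, hsub, Complex.normSq_conj]
      · refine (MemIdealAt.of_mem (fixedEqs_subset ⟨j, Or.inl rfl⟩)).congr (.of_forall fun ψ => ?_)
        simp only [Function.comp_apply, conjAct_neg_one]
        rw [← hZ j, hsub, hZ j, Complex.conj_re]
      · refine (MemIdealAt.of_mem (fixedEqs_subset ⟨j, Or.inr rfl⟩)).neg.congr
          (.of_forall fun ψ => ?_)
        simp only [Function.comp_apply, conjAct_neg_one]
        rw [← hZ j, hsub, hZ j, Complex.conj_im]
      · refine (MemIdealAt.of_mem (triangleEqs_subset ⟨A, B, C, hT, Or.inl rfl⟩)).congr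
          (.of_forall fun ψ => ?_)
        simp only [Function.comp_apply, conjAct_neg_one, hsub, hsmul, hadd, Complex.conj_re]
      · refine (MemIdealAt.of_mem (triangleEqs_subset ⟨A, B, C, hT, Or.inr rfl⟩)).neg.congr
          (.of_forall fun ψ => ?_)
        simp only [Function.comp_apply, conjAct_neg_one, hsub, hsmul, hadd, Complex.conj_im]

theorem IsSchemeAction.prod {Γ Γ' : Type*} [Group Γ] [Group Γ'] {act : Γ → (V → ℂ) → V → ℂ}
    {act' : Γ' → (V → ℂ) → V → ℂ} (h : IsSchemeAction L Z act) (h' : IsSchemeAction L Z act')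
    (hc : ∀ γ γ' φ, act' γ' (act γ φ) = act γ (act' γ' φ)) :
    IsSchemeAction L Z fun (γ : Γ × Γ') φ => act γ.1 (act' γ.2 φ) where
  one φ := by rw [Prod.fst_one, Prod.snd_one, h'.one, h.one]
  mul γ γ' φ := by rw [Prod.fst_mul, Prod.snd_mul, h'.mul, h.mul, hc]
  analyticAt γ φ hφ := (h.analyticAt γ.1 _ (h'.mapsTo γ.2 hφ)).comp (h'.analyticAt γ.2 φ hφ)
  pullback γ φ hφ g hg := (h.pullback γ.1 _ (h'.mapsTo γ.2 hφ) g hg).comp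
    (h'.analyticAt γ.2 φ hφ) (h'.pullback γ.2 φ hφ)

theorem conjAct_labelAct {V κ : Type*} {label : V → Option κ} {ax bx : κ → V}
    (δ : κ → ℤˣ) (c : ℤˣ) (φ : V → ℂ) : conjAct c (labelAct label ax bx δ φ) = labelAct label ax bx δ (conjAct c φ) := by
  rcases Int.units_eq_one_or c with rfl | rfl
  · rfl
  · funext v
    rw [conjAct_neg_one]
    rcases hv : label v with _ | k
    · rw [labelAct_none _ _ hv, labelAct_none _ _ hv, conjAct_neg_one]
    · rw [labelAct_some _ _ hv, labelAct_some _ _ hv, conj_twist, conjAct_neg_one, conjAct_neg_one,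
        conjAct_neg_one]

end Actions

/-! ### Adding bars between existing vertices. -/

section Bars

variable {V : Type*} {s : ℕ}

/-- Additional bars between the vertices of a linkage; lengths equal to zero mean that there is no
bar. -/
structure Bars (V : Type*) where
  len : V → V → ℝ
  nonneg : ∀ v w, 0 ≤ len v w
  comm : ∀ v w, len v w = len w v
  self : ∀ v, len v v = 0

open Classical in
/-- The linkage with additional bars. -/
def addBars (L : MarkedLinkage V s) (C : Bars V) : MarkedLinkage V s where
  graph :=
    { Adj := fun v w => L.graph.Adj v w ∨ C.len v w ≠ 0
      symm := ⟨fun v w h => h.imp (fun h => h.symm) fun h => by rwa [C.comm]⟩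
      loopless := ⟨fun v h => h.elim (L.graph.loopless.irrefl v) fun h => h (C.self v)⟩ }
  len := Sym2.lift ⟨fun v w => if C.len v w = 0 then L.len s(v, w) else C.len v w, fun v w => by
    simp only [C.comm v w, Sym2.eq_swap]⟩
  len_pos e := by
    induction e using Sym2.ind with
    | _ v w =>
      intro h
      change 0 < if C.len v w = 0 then L.len s(v, w) else C.len v w
      split_ifs with h0
      · exact L.len_pos s(v, w) (h.resolve_right fun h => h h0)
      · exact lt_of_le_of_ne (C.nonneg v w) (Ne.symm h0)
  fixed := L.fixed

variable {L : MarkedLinkage V s} {C : Bars V} {Z : Fin s → ℂ}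

theorem addBars_len (v w : V) : (addBars L C).len s(v, w) =
    open Classical in if C.len v w = 0 then L.len s(v, w) else C.len v w := rfl

theorem addBars_len_of_ne {v w : V} (h : C.len v w ≠ 0) : (addBars L C).len s(v, w) = C.len v w := by
  rw [addBars_len, if_neg h]

/-- A new bar overrides the old length, so existing edges must not receive bars. -/
theorem isLinkageMap_addBars (h : ∀ v w, L.graph.Adj v w → C.len v w = 0) :
    IsLinkageMap L (addBars L C) id where
  adj _ _ := Or.inl
  len v w hvw := by rw [id, id, addBars_len, if_pos (h v w hvw)]
  fixed _ := rfl

theorem mem_addBars_iff (h : ∀ v w, L.graph.Adj v w → C.len v w = 0) {φ : V → ℂ} :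
    φ ∈ configSpace (addBars L C) Z ↔ φ ∈ configSpace L Z ∧
      ∀ v w, C.len v w ≠ 0 → Complex.normSq (φ v - φ w) = C.len v w ^ 2 := by
  constructor
  · refine fun hφ => ⟨(isLinkageMap_addBars h).comp_mem_configSpace hφ, fun v w hvw => ?_⟩
    rw [← addBars_len_of_ne hvw]
    exact (mem_configSpace_iff.1 hφ).1 v w (Or.inr hvw)
  · rintro ⟨h1, h2⟩
    rw [mem_configSpace_iff] at h1 ⊢
    refine ⟨fun v w hvw => ?_, h1.2⟩
    rcases hvw with hvw | hvw
    · rw [addBars_len, if_pos (h v w hvw)]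
      exact h1.1 v w hvw
    · rw [addBars_len_of_ne hvw]
      exact h2 v w hvw

theorem schemeEqs_subset_addBars (h : ∀ v w, L.graph.Adj v w → C.len v w = 0) :
    schemeEqs L Z ⊆ schemeEqs (addBars L C) Z := fun _ hg =>
  (isLinkageMap_addBars h).comp_mem_schemeEqs hg

variable [Fintype V]

theorem addBars_memIdealAt (φ : V → ℂ) {v w : V} (hvw : C.len v w ≠ 0) :
    MemIdealAt (schemeEqs (addBars L C) Z) φ fun ψ =>
      Complex.normSq (ψ v - ψ w) - C.len v w ^ 2 := by
  rw [← addBars_len_of_ne (L := L) hvw]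
  exact MemIdealAt.of_mem (edgeEqs_subset ⟨v, w, Or.inr hvw, rfl⟩)

theorem IsReflective.addBars {κ : Type*} {label : V → Option κ} {ax bx : κ → V}
    (hr : IsReflective L Z label ax bx) (h : ∀ v w, L.graph.Adj v w → C.len v w = 0)
    (hl : ∀ v w, C.len v w ≠ 0 → label v = none ∧ label w = none) :
    IsReflective (addBars L C) Z label ax bx where
  label_ax := hr.label_ax
  label_bx := hr.label_bx
  label_fixed := hr.label_fixed
  axis_ne φ hφ := hr.axis_ne φ ((mem_addBars_iff h).1 hφ).1
  label_adj v w hvw k l hk hl' := by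
    rcases hvw with hvw | hvw
    · exact hr.label_adj v w hvw k l hk hl'
    · rw [(hl v w hvw).1] at hk
      cases hk
  onAxis φ hφ v w k hvw hv hw := by
    rcases hvw with hvw | hvw
    · exact (hr.onAxis φ ((mem_addBars_iff h).1 hφ).1 v w k hvw hv hw).mono
        (schemeEqs_subset_addBars h)
    · rw [(hl v w hvw).2] at hw
      cases hw

/-- The bars that fix the vertex `J` at a point at distance `h` from `f₀` and `q` from `f₁`, and keep
the vertices in `S` at distance `h` from `f₀`. -/
def straightLen {V : Type*} (f₀ f₁ J : V) (S : Set V) (h q : ℝ) (v w : V) : ℝ :=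
  open Classical in if v = f₀ ∧ (w = J ∨ w ∈ S) then h else if v = f₁ ∧ w = J then q else 0

theorem straightLen_nonneg {V : Type*} {f₀ f₁ J : V} {S : Set V} {h q : ℝ} (hh : 0 ≤ h) (hq : 0 ≤ q)
    (v w : V) : 0 ≤ straightLen f₀ f₁ J S h q v w := by
  unfold straightLen
  split_ifs
  exacts [hh, hq, le_rfl]

theorem straightLen_eq_zero {V : Type*} {f₀ f₁ J : V} {S : Set V} {h q : ℝ} {v : V} (w : V)
    (h₀ : v ≠ f₀) (h₁ : v ≠ f₁) : straightLen f₀ f₁ J S h q v w = 0 := by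
  simp [straightLen, h₀, h₁]

/-- The symmetric system of bars that keeps inputs on a line. -/
def straightBars {V : Type*} {f₀ f₁ J : V} {S : Set V} {h q : ℝ} (hh : 0 ≤ h) (hq : 0 ≤ q)
    (h₀ : f₀ ≠ J) (h₁ : f₁ ≠ J) (hS : f₀ ∉ S) : Bars V where
  len v w := max (straightLen f₀ f₁ J S h q v w) (straightLen f₀ f₁ J S h q w v)
  nonneg v w := le_max_of_le_left (straightLen_nonneg hh hq v w)
  comm v w := max_comm _ _
  self v := by
    rw [max_self]
    unfold straightLen
    rw [if_neg, if_neg]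
    · rintro ⟨rfl, h⟩
      exact h₁ h
    · rintro ⟨rfl, h | h⟩
      exacts [h₀ h, hS h]

end Bars

/-! ### Pinning a point at `± h * I`, and the inversion that takes the real axis to a circle. -/

section RealPoints

/-- The converse of Pythagoras: the two distances make a right angle at `0`. -/
theorem exists_eq_mul_I {l h : ℝ} (hl : l ≠ 0) {z : ℂ} (h₀ : Complex.normSq z = h ^ 2)
    (h₁ : Complex.normSq (l - z) = h ^ 2 + l ^ 2) :
    ∃ c : ℤˣ, z = (((c : ℤ) : ℝ) * h : ℝ) * Complex.I := by
  simp only [Complex.normSq_apply, Complex.sub_re, Complex.sub_im, Complex.ofReal_re,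
    Complex.ofReal_im] at h₀ h₁
  have hre : z.re = 0 := by
    have : l * z.re = 0 := by linarith
    exact (mul_eq_zero.1 this).resolve_left hl
  have him : z.im ^ 2 = h ^ 2 := by rw [hre] at h₀; linarith
  rcases sq_eq_sq_iff_eq_or_eq_neg.1 him with e | e
  · exact ⟨1, Complex.ext (by simp [hre]) (by simp [e])⟩
  · exact ⟨-1, Complex.ext (by simp [hre]) (by simp [e])⟩

theorem normSq_mul_I (c : ℤˣ) (h : ℝ) :
    Complex.normSq (((((c : ℤ) : ℝ) * h : ℝ) : ℂ) * Complex.I) = h ^ 2 := by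
  rcases Int.units_eq_one_or c with rfl | rfl <;> simp [Complex.normSq_apply] <;> ring

theorem normSq_sub_mul_I (c : ℤˣ) (h l : ℝ) :
    Complex.normSq (l - ((((c : ℤ) : ℝ) * h : ℝ) : ℂ) * Complex.I) = h ^ 2 + l ^ 2 := by
  rcases Int.units_eq_one_or c with rfl | rfl <;> simp [Complex.normSq_apply] <;> ring

/-- An inversion takes a line to a circle. -/
theorem normSq_add_div_conj (c : ℤˣ) (h : ℝ) {z : ℂ}
    (hz : z ≠ (((c : ℤ) : ℝ) * h : ℝ) * Complex.I) :
    (Complex.normSq ((((c : ℤ) : ℝ) * h : ℝ) * Complex.I + (2 * h ^ 2 : ℝ) /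
      conj (z - (((c : ℤ) : ℝ) * h : ℝ) * Complex.I)) - h ^ 2) *
      Complex.normSq (z - (((c : ℤ) : ℝ) * h : ℝ) * Complex.I) = ((c : ℤ) : ℝ) * (4 * h ^ 3) * z.im := by
  have hd : conj (z - (((c : ℤ) : ℝ) * h : ℝ) * Complex.I) ≠ 0 :=
    (map_ne_zero _).2 (sub_ne_zero.2 hz)
  set N : ℂ := (((c : ℤ) : ℝ) * h : ℝ) * Complex.I with hN
  have e : Complex.normSq (N + (2 * h ^ 2 : ℝ) / conj (z - N)) * Complex.normSq (z - N) =
      Complex.normSq (N * conj (z - N) + (2 * h ^ 2 : ℝ)) := by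
    rw [← Complex.normSq_conj (z - N), ← Complex.normSq_mul]
    congr 1
    field_simp
  rw [sub_mul, e, hN]
  rcases Int.units_eq_one_or c with rfl | rfl
  · simp [Complex.normSq_apply, pow_two]; ring
  · simp [Complex.normSq_apply, pow_two]; ring

end RealPoints

/-! ### Confining the inputs to the real axis. -/

section RealCase

variable {m n : ℕ} {Z : Fin 2 → ℂ} {l h q : ℝ} {a b : Option (Fin m) → ℝ}

/-- A mechanism with an additional input, which will be fixed at one of the points `± h i` of the
imaginary axis, and vertices `R i` at the images of the other inputs under an inversion around that
point. The inversion takes the real axis to the circle of radius `h`. -/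
structure IsStraightener
    (M : Mechanism (Option (Fin m)) Z (annuli (l : ℂ) a b) (annuliWall (l : ℂ) a b)) (h q : ℝ)
    (R : Fin m → M.V) : Prop where
  base_zero : Z 0 = 0
  base_one : Z 1 = l
  l_pos : 0 < l
  h_pos : 0 < h
  q_pos : 0 < q
  q_sq : q ^ 2 = h ^ 2 + l ^ 2
  a_none : a none = q
  b_pos : ∀ o, 0 < b o
  b_lt : ∀ o, b o < a o
  ne : ∀ y ∈ annuli (l : ℂ) a b, ∀ i, y (some i) ≠ y none
  label_R : ∀ i, M.label (R i) = none
  R_notMem : ∀ i, R i ∉ range M.L.fixed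
  inp_notMem : M.inp none ∉ range M.L.fixed
  F_R : ∀ i, EqOn (M.F (R i))
    (fun y => y none + (2 * h ^ 2 : ℝ) / conj (y (some i) - y none)) (annuli (l : ℂ) a b)

/-- Real inputs, and the additional input at `± h i`. -/
def realInput (h : ℝ) (c : ℤˣ) (x : EuclideanSpace ℝ (Fin m)) (o : Option (Fin m)) : ℂ :=
  o.elim ((((c : ℤ) : ℝ) * h : ℝ) * Complex.I) fun i => (x i : ℂ)

theorem continuous_realInput (c : ℤˣ) :
    Continuous (realInput h c : EuclideanSpace ℝ (Fin m) → Option (Fin m) → ℂ) := by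
  refine continuous_pi fun o => ?_
  rcases o with _ | i
  · exact continuous_const
  · exact Complex.continuous_ofReal.comp (EuclideanSpace.proj (𝕜 := ℝ) i).continuous

theorem analyticAt_realInput (c : ℤˣ) (x : EuclideanSpace ℝ (Fin m)) :
    AnalyticAt ℝ (realInput h c : EuclideanSpace ℝ (Fin m) → Option (Fin m) → ℂ) x := by
  refine AnalyticAt.pi fun o => ?_
  rcases o with _ | i
  · exact analyticAt_const
  · exact analyticAt_ofReal ((EuclideanSpace.proj (𝕜 := ℝ) i).analyticAt x)

theorem realInput_injective (hh : h ≠ 0) {c c' : ℤˣ} {x x' : EuclideanSpace ℝ (Fin m)}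
    (e : realInput h c x none = realInput h c' x' none) : c = c' := by
  have h1 := mul_right_cancel₀ Complex.I_ne_zero e
  have h2 := mul_right_cancel₀ hh (Complex.ofReal_injective h1)
  exact Units.ext (by exact_mod_cast h2)

theorem Mechanism.inputMap_sec {D Wall : Set (Option (Fin m) → ℂ)}
    (M : Mechanism (Option (Fin m)) Z D Wall) (ε : M.κ → ℤˣ) (c : ℤˣ)
    {x : EuclideanSpace ℝ (Fin m)} (hx : realInput h c x ∈ D) :
    inputMap ℝ (fun i => M.inp (some i)) (M.sec ε (realInput h c x)) = x := by
  ext i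
  have : M.sec ε (realInput h c x) (M.inp (some i)) = x i :=
    congrFun (M.sections.proj ε _ hx) (some i)
  simp [inputMap, this]

namespace IsStraightener

variable {M : Mechanism (Option (Fin m)) Z (annuli (l : ℂ) a b) (annuliWall (l : ℂ) a b)}
  {R : Fin m → M.V} (hM : IsStraightener M h q R)
include hM

theorem norm_sub (c : ℤˣ) (x : EuclideanSpace ℝ (Fin m)) : ‖realInput h c x none - l‖ = q := by
  have h1 : ‖realInput h c x none - l‖ ^ 2 = q ^ 2 := by
    rw [← Complex.normSq_eq_norm_sq, normSq_sub_comm, hM.q_sq]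
    exact normSq_sub_mul_I c h l
  exact (sq_eq_sq₀ (norm_nonneg _) hM.q_pos.le).1 h1

/-- The additional input stays on the middle circle of its annulus, since its distance `q` from `l`
is `a none`. So it imposes no condition and never reaches its wall. -/
theorem realInput_mem (c : ℤˣ) (x : EuclideanSpace ℝ (Fin m)) :
    realInput h c x ∈ annuli (l : ℂ) a b ↔
      x ∈ euclideanAnnuli l (fun i => a (some i)) fun i => b (some i) := by
  have hi : ∀ i, ‖realInput h c x (some i) - l‖ = ‖x i - l‖ := fun i => by
    rw [← Complex.norm_real, Complex.ofReal_sub]; rfl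
  constructor
  · intro hx i
    have := hx (some i)
    rw [hi] at this
    exact this
  · rintro hx (_ | i)
    · rw [hM.norm_sub, hM.a_none]
      have := hM.b_pos none
      constructor <;> linarith
    · rw [hi]
      exact hx i

theorem realInput_mem_wall (c : ℤˣ) (x : EuclideanSpace ℝ (Fin m)) :
    realInput h c x ∈ annuliWall (l : ℂ) a b ↔
      x ∈ euclideanWall l (fun i => a (some i)) fun i => b (some i) := by
  have hi : ∀ i, ‖realInput h c x (some i) - l‖ = ‖x i - l‖ := fun i => by
    rw [← Complex.norm_real, Complex.ofReal_sub]; rfl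
  constructor
  · rintro ⟨_ | i, hx⟩
    · rw [hM.norm_sub, hM.a_none] at hx
      have := hM.b_pos none
      rcases hx with hx | hx <;> linarith
    · rw [hi] at hx
      exact ⟨i, hx⟩
  · rintro ⟨i, hx⟩
    refine ⟨some i, ?_⟩
    rw [hi]
    exact hx

theorem fixed_ne_inp (j : Fin 2) : M.L.fixed j ≠ M.inp none := fun e => hM.inp_notMem ⟨j, e⟩

theorem fixed_notMem_R (j : Fin 2) : M.L.fixed j ∉ range R := by
  rintro ⟨i, e⟩
  exact hM.R_notMem i ⟨j, e.symm⟩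

/-- The bars that confine the inputs to the real axis. -/
def bars : Bars M.V :=
  straightBars hM.h_pos.le hM.q_pos.le (hM.fixed_ne_inp 0) (hM.fixed_ne_inp 1) (hM.fixed_notMem_R 0)

theorem bars_len (v w : M.V) : hM.bars.len v w =
    max (straightLen (M.L.fixed 0) (M.L.fixed 1) (M.inp none) (range R) h q v w)
      (straightLen (M.L.fixed 0) (M.L.fixed 1) (M.inp none) (range R) h q w v) := rfl

theorem bars_len_fixed {w : M.V} (hw : w = M.inp none ∨ w ∈ range R) (j : Fin 2) :
    hM.bars.len (M.L.fixed j) w =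
      straightLen (M.L.fixed 0) (M.L.fixed 1) (M.inp none) (range R) h q (M.L.fixed j) w := by
  have hwf : ∀ k, w ≠ M.L.fixed k := by
    rintro k rfl
    exact hw.elim (hM.fixed_ne_inp k) (hM.fixed_notMem_R k)
  rw [hM.bars_len, straightLen_eq_zero (v := w) _ (hwf 0) (hwf 1)]
  exact max_eq_left (straightLen_nonneg hM.h_pos.le hM.q_pos.le _ _)

theorem bars_len_zero {w : M.V} (hw : w = M.inp none ∨ w ∈ range R) :
    hM.bars.len (M.L.fixed 0) w = h := by
  rw [hM.bars_len_fixed hw]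
  exact if_pos ⟨rfl, hw⟩

theorem bars_len_one : hM.bars.len (M.L.fixed 1) (M.inp none) = q := by
  rw [hM.bars_len_fixed (Or.inl rfl)]
  have : M.L.fixed 1 ≠ M.L.fixed 0 := fun e => by simpa using M.L.fixed.injective e
  rw [straightLen, if_neg fun e => this e.1, if_pos ⟨rfl, rfl⟩]

theorem bars_cases {v w : M.V} (hvw : hM.bars.len v w ≠ 0) :
    ∃ x y, (v = x ∧ w = y ∨ v = y ∧ w = x) ∧
      (x = M.L.fixed 0 ∧ (y = M.inp none ∨ y ∈ range R) ∧ hM.bars.len v w = h ∨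
        x = M.L.fixed 1 ∧ y = M.inp none ∧ hM.bars.len v w = q) := by
  have key : ∀ x y, straightLen (M.L.fixed 0) (M.L.fixed 1) (M.inp none) (range R) h q x y ≠ 0 →
      (x = M.L.fixed 0 ∧ (y = M.inp none ∨ y ∈ range R)) ∨ x = M.L.fixed 1 ∧ y = M.inp none := by
    intro x y hxy
    by_contra! hc
    refine hxy ?_
    rw [straightLen, if_neg, if_neg]
    · rintro ⟨rfl, h'⟩
      exact hc.2 rfl h'
    · rintro ⟨rfl, h' | h'⟩
      exacts [(hc.1 rfl).1 h', (hc.1 rfl).2 h']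
  have main : ∀ x y, straightLen (M.L.fixed 0) (M.L.fixed 1) (M.inp none) (range R) h q x y ≠ 0 →
      (x = M.L.fixed 0 ∧ (y = M.inp none ∨ y ∈ range R) ∧ hM.bars.len x y = h ∨
        x = M.L.fixed 1 ∧ y = M.inp none ∧ hM.bars.len x y = q) := by
    intro x y hxy
    rcases key x y hxy with ⟨rfl, hy⟩ | ⟨rfl, rfl⟩
    · exact Or.inl ⟨rfl, hy, hM.bars_len_zero hy⟩
    · exact Or.inr ⟨rfl, rfl, hM.bars_len_one⟩
  rcases max_choice (straightLen (M.L.fixed 0) (M.L.fixed 1) (M.inp none) (range R) h q v w)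
    (straightLen (M.L.fixed 0) (M.L.fixed 1) (M.inp none) (range R) h q w v) with e | e
  · refine ⟨v, w, Or.inl ⟨rfl, rfl⟩, main v w ?_⟩
    rwa [← e, ← hM.bars_len]
  · refine ⟨w, v, Or.inr ⟨rfl, rfl⟩, ?_⟩
    rw [hM.bars.comm v w]
    refine main w v ?_
    rwa [← e, ← hM.bars_len]

theorem bars_label {v w : M.V} (hvw : hM.bars.len v w ≠ 0) :
    M.label v = none ∧ M.label w = none := by
  have hlab : ∀ y, y = M.inp none ∨ y ∈ range R → M.label y = none := by
    rintro y (rfl | ⟨i, rfl⟩)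
    exacts [M.label_inp none, hM.label_R i]
  have hf := M.reflective.label_fixed
  obtain ⟨x, y, hxy, h1⟩ := hM.bars_cases hvw
  have : M.label x = none ∧ M.label y = none := by
    rcases h1 with ⟨rfl, hy, -⟩ | ⟨rfl, rfl, -⟩
    exacts [⟨hf 0, hlab y hy⟩, ⟨hf 1, hlab _ (Or.inl rfl)⟩]
  rcases hxy with ⟨rfl, rfl⟩ | ⟨rfl, rfl⟩
  exacts [this, this.symm]

/-- Edges between core vertices join fixed vertices, whereas every bar has a core end that is not
fixed. -/
theorem bars_len_of_adj (v w : M.V) (hvw : M.L.graph.Adj v w) : hM.bars.len v w = 0 := by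
  by_contra hne
  obtain ⟨hv, hw⟩ := hM.bars_label hne
  obtain ⟨h1, h2⟩ := M.core_adj v w hvw hv hw
  obtain ⟨x, y, hxy, h3⟩ := hM.bars_cases hne
  have hy : y ∉ range M.L.fixed := by
    rcases h3 with ⟨-, rfl | ⟨i, rfl⟩, -⟩ | ⟨-, rfl, -⟩
    exacts [hM.inp_notMem, hM.R_notMem i, hM.inp_notMem]
  rcases hxy with ⟨rfl, rfl⟩ | ⟨rfl, rfl⟩
  exacts [hy h2, hy h1]

theorem mem_iff {φ : M.V → ℂ} : φ ∈ configSpace (addBars M.L hM.bars) Z ↔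
    φ ∈ configSpace M.L Z ∧ Complex.normSq (φ (M.inp none)) = h ^ 2 ∧
      Complex.normSq (l - φ (M.inp none)) = h ^ 2 + l ^ 2 ∧
      ∀ i, Complex.normSq (φ (R i)) = h ^ 2 := by
  rw [mem_addBars_iff hM.bars_len_of_adj]
  refine and_congr_right fun hφ => ?_
  have f₀ : φ (M.L.fixed 0) = 0 := ((mem_configSpace_iff.1 hφ).2 0).trans hM.base_zero
  have f₁ : φ (M.L.fixed 1) = l := ((mem_configSpace_iff.1 hφ).2 1).trans hM.base_one
  constructor
  · intro hb
    have h0 : ∀ w, w = M.inp none ∨ w ∈ range R → Complex.normSq (φ w) = h ^ 2 := by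
      intro w hw
      have e := hM.bars_len_zero hw
      have := hb (M.L.fixed 0) w (by rw [e]; exact hM.h_pos.ne')
      rwa [e, f₀, zero_sub, Complex.normSq_neg] at this
    refine ⟨h0 _ (Or.inl rfl), ?_, fun i => h0 _ (Or.inr ⟨i, rfl⟩)⟩
    have := hb (M.L.fixed 1) (M.inp none) (by rw [hM.bars_len_one]; exact hM.q_pos.ne')
    rwa [hM.bars_len_one, f₁, hM.q_sq] at this
  · rintro ⟨h1, h2, h3⟩ v w hvw
    obtain ⟨x, y, hxy, h4⟩ := hM.bars_cases hvw
    have : Complex.normSq (φ x - φ y) = hM.bars.len v w ^ 2 := by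
      rcases h4 with ⟨rfl, rfl | ⟨i, rfl⟩, e⟩ | ⟨rfl, rfl, e⟩
      · rw [e, f₀, zero_sub, Complex.normSq_neg, h1]
      · rw [e, f₀, zero_sub, Complex.normSq_neg, h3]
      · rw [e, f₁, h2, hM.q_sq]
    rcases hxy with ⟨rfl, rfl⟩ | ⟨rfl, rfl⟩
    · exact this
    · rw [normSq_sub_comm]
      exact this

/-- Two bars pin the additional input to `± h * I`. The inversion identity then says that `R i` is
at distance `h` from `0` only if the imaginary part of the `i`-th input vanishes. -/
theorem exists_realInput {φ : M.V → ℂ} (hφ : φ ∈ configSpace (addBars M.L hM.bars) Z) :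
    ∃ c, φ ∘ M.inp = realInput h c (inputMap ℝ (fun i => M.inp (some i)) φ) := by
  obtain ⟨h0, h1, h2, h3⟩ := hM.mem_iff.1 hφ
  obtain ⟨c, hc⟩ := exists_eq_mul_I hM.l_pos.ne' h1 h2
  refine ⟨c, funext fun o => ?_⟩
  rcases o with _ | i
  · exact hc
  · have hD := M.inp_mem h0
    have hne := hM.ne _ hD i
    have hR := h3 i
    rw [M.core_eq h0 (hM.label_R i), hM.F_R i hD] at hR
    simp only [Function.comp_apply] at hR hne
    rw [hc] at hR hne
    have key := normSq_add_div_conj c h hne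
    rw [hR, sub_self, zero_mul] at key
    have hc0 : ((c : ℤ) : ℝ) ≠ 0 := by exact_mod_cast c.ne_zero
    have him : (φ (M.inp (some i))).im = 0 :=
      (mul_eq_zero.1 key.symm).resolve_left
        (mul_ne_zero hc0 (mul_ne_zero four_ne_zero (pow_ne_zero 3 hM.h_pos.ne')))
    refine Complex.ext ?_ ?_
    · simp [realInput, inputMap]
    · simp [realInput, him]

theorem sec_mem (ε : M.κ → ℤˣ) (c : ℤˣ) {x : EuclideanSpace ℝ (Fin m)}
    (hx : realInput h c x ∈ annuli (l : ℂ) a b) :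
    M.sec ε (realInput h c x) ∈ configSpace (addBars M.L hM.bars) Z := by
  have hJ : M.sec ε (realInput h c x) (M.inp none) = realInput h c x none :=
    congrFun (M.sections.proj ε _ hx) none
  rw [hM.mem_iff, hJ]
  refine ⟨M.sections.mem ε _ hx, normSq_mul_I c h, normSq_sub_mul_I c h l, fun i => ?_⟩
  rw [M.sec_core ε hx (hM.label_R i), hM.F_R i hx]
  have key := normSq_add_div_conj c h (hM.ne _ hx i)
  have e : (realInput h c x (some i)).im = 0 := Complex.ofReal_im _
  rw [e, mul_zero] at key
  exact sub_eq_zero.1 ((mul_eq_zero.1 key).resolve_right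
    (Complex.normSq_pos.2 (sub_ne_zero.2 (hM.ne _ hx i))).ne')

theorem congr_addBars {φ : M.V → ℂ} {u : (M.V → ℂ) → ℂ} (hu : CMem (schemeEqs M.L Z) φ u) :
    CMem (schemeEqs (addBars M.L hM.bars) Z) φ u :=
  hu.mono (schemeEqs_subset_addBars hM.bars_len_of_adj)

theorem fixed_congr (φ : M.V → ℂ) (j : Fin 2) :
    CMem (schemeEqs (addBars M.L hM.bars) Z) φ fun ψ => ψ (M.L.fixed j) - Z j :=
  hM.congr_addBars ⟨MemIdealAt.of_mem (fixedEqs_subset ⟨j, Or.inl rfl⟩),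
    MemIdealAt.of_mem (fixedEqs_subset ⟨j, Or.inr rfl⟩)⟩

theorem normSq_congr (φ : M.V → ℂ) {j : Fin 2} {w : M.V} {k : ℝ}
    (hk : k ≠ 0) (hw : hM.bars.len (M.L.fixed j) w = k) :
    MemIdealAt (schemeEqs (addBars M.L hM.bars) Z) φ fun ψ =>
      Complex.normSq (ψ w - Z j) - k ^ 2 := by
  have k1 := addBars_memIdealAt (L := M.L) (Z := Z) φ (C := hM.bars) (v := M.L.fixed j) (w := w)
    (by rw [hw]; exact hk)
  rw [hw] at k1
  have k2 : MemIdealAt (schemeEqs (addBars M.L hM.bars) Z) φ fun ψ =>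
      Complex.normSq (ψ (M.L.fixed j) - ψ w) - Complex.normSq (Z j - ψ w) :=
    CMem.normSq_sub ((analyticAt_eval _ _).sub (analyticAt_eval _ _))
      (analyticAt_const.sub (analyticAt_eval _ _))
      ((hM.fixed_congr φ j).congr (.of_forall fun ψ => by simp))
  refine (k1.sub k2).congr (.of_forall fun ψ => ?_)
  simp only [normSq_sub_comm (ψ w)]
  ring

theorem inp_none_congr {φ : M.V → ℂ} {c : ℤˣ}
    (hφ : φ (M.inp none) = (((c : ℤ) : ℝ) * h : ℝ) * Complex.I) :
    CMem (schemeEqs (addBars M.L hM.bars) Z) φ fun ψ =>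
      ψ (M.inp none) - (((c : ℤ) : ℝ) * h : ℝ) * Complex.I := by
  refine two_circles (A := fun _ => Z 0) (B := fun _ => Z 1)
    (v := fun _ => (((c : ℤ) : ℝ) * h : ℝ) * Complex.I) (analyticAt_eval _ _) analyticAt_const
    analyticAt_const analyticAt_const hφ ?_ ?_ ?_
  · refine (hM.normSq_congr φ hM.h_pos.ne' (hM.bars_len_zero (Or.inl rfl))).congr
      (.of_forall fun ψ => ?_)
    simp only
    rw [hM.base_zero, sub_zero (_ * Complex.I), normSq_mul_I]
  · refine (hM.normSq_congr φ hM.q_pos.ne' hM.bars_len_one).congr (.of_forall fun ψ => ?_)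
    simp only
    rw [hM.base_one, normSq_sub_comm (_ * Complex.I), normSq_sub_mul_I, hM.q_sq]
  · have hl := hM.l_pos.ne'
    have hh := hM.h_pos.ne'
    rw [hφ, hM.base_zero, hM.base_one]
    rcases Int.units_eq_one_or c with rfl | rfl <;> simp [hl, hh]

/-- By the inversion identity the imaginary part of the input is an analytic multiple of the
equation of the bar at `R i`, once `R i` and the additional input are replaced by congruent
functions. So inputs are real even modulo nilpotents. -/
theorem inp_some_congr {φ : M.V → ℂ} {c : ℤˣ} {x : EuclideanSpace ℝ (Fin m)}
    (hφ : φ ∈ configSpace M.L Z) (hφx : φ ∘ M.inp = realInput h c x)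
    (hx : realInput h c x ∈ annuli (l : ℂ) a b \ annuliWall (l : ℂ) a b) (i : Fin m) :
    CMem (schemeEqs (addBars M.L hM.bars) Z) φ fun ψ =>
      ψ (M.inp (some i)) - ((ψ (M.inp (some i))).re : ℂ) := by
  set N : ℂ := (((c : ℤ) : ℝ) * h : ℝ) * Complex.I with hN
  have hJ : φ (M.inp none) = N := congrFun hφx none
  have hne : φ (M.inp (some i)) ≠ N := by
    have := hM.ne _ hx.1 i
    rw [← hφx] at this
    exact this.trans_eq hJ
  have hne' : conj (φ (M.inp (some i)) - N) ≠ 0 := (map_ne_zero _).2 (sub_ne_zero.2 hne)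
  have hG : AnalyticAt ℝ (fun ψ : M.V → ℂ => N + (2 * h ^ 2 : ℝ) /
      conj (ψ (M.inp (some i)) - N)) φ :=
    analyticAt_const.add (analyticAt_const.div
      (analyticAt_conj ((analyticAt_eval _ _).sub analyticAt_const)) hne')
  have k1 : CMem (schemeEqs (addBars M.L hM.bars) Z) φ fun ψ => ψ (R i) -
      (ψ (M.inp none) + (2 * h ^ 2 : ℝ) / conj (ψ (M.inp (some i)) - ψ (M.inp none))) := by
    refine (hM.congr_addBars (M.core_congr φ hφ (R i) (hM.label_R i))).congr ?_
    -- The formula for `F (R i)` is known only on the annuli; off the wall they contain a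
    -- neighbourhood.
    have hev : ∀ᶠ y in 𝓝 (φ ∘ M.inp), y ∈ annuli (l : ℂ) a b := by
      rw [hφx]
      filter_upwards [isOpen_lt_annuli.mem_nhds (lt_of_mem_annuli_diff hx)] with y hy
      exact fun o => ⟨(hy o).1.le, (hy o).2.le⟩
    filter_upwards [(IsLinkageMap.analyticAt_precomp M.inp φ).continuousAt.eventually hev] with ψ hψ
    rw [hM.F_R i hψ]
    rfl
  have k2 : CMem (schemeEqs (addBars M.L hM.bars) Z) φ fun ψ =>
      (ψ (M.inp none) + (2 * h ^ 2 : ℝ) / conj (ψ (M.inp (some i)) - ψ (M.inp none))) -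
        (N + (2 * h ^ 2 : ℝ) / conj (ψ (M.inp (some i)) - N)) := by
    have hp : CongrAt (schemeEqs (addBars M.L hM.bars) Z) φ
        (fun ψ => (ψ (M.inp none), ψ (M.inp (some i)))) fun ψ => (N, ψ (M.inp (some i))) :=
      (congrAt_complex_iff.2 (hM.inp_none_congr hJ)).prod
        (CongrAt.of_eventuallyEq (EventuallyEq.refl _ _))
    refine congrAt_complex_iff.1 (hp.comp_left
      (h := fun z : ℂ × ℂ => z.1 + (2 * h ^ 2 : ℝ) / conj (z.2 - z.1))
      ((analyticAt_eval _ _).prod (analyticAt_eval _ _))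
      (analyticAt_const.prod (analyticAt_eval _ _)) (Prod.ext hJ rfl) ?_)
    refine analyticAt_fst.add (analyticAt_const.div
      (analyticAt_conj (analyticAt_snd.sub analyticAt_fst)) ?_)
    simp only [hJ]
    exact hne'
  have k3 := hM.normSq_congr φ hM.h_pos.ne' (hM.bars_len_zero (Or.inr ⟨i, rfl⟩))
  have k4 := CMem.normSq_sub (analyticAt_eval (R i) φ) hG (k1.trans k2)
  have k5 := ((k3.sub k4).mul_left (a := fun ψ => (((c : ℤ) : ℝ) * (4 * h ^ 3))⁻¹ *
    Complex.normSq (ψ (M.inp (some i)) - N)) (analyticAt_const.mul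
      (analyticAt_normSq ((analyticAt_eval _ _).sub analyticAt_const))))
  have k6 : MemIdealAt (schemeEqs (addBars M.L hM.bars) Z) φ fun ψ => (ψ (M.inp (some i))).im := by
    refine k5.congr ?_
    have hev : ∀ᶠ ψ : M.V → ℂ in 𝓝 φ, ψ (M.inp (some i)) ≠ N :=
      (analyticAt_eval (M.inp (some i)) φ).continuousAt.eventually_ne hne
    filter_upwards [hev] with ψ hψ
    have key := normSq_add_div_conj c h hψ
    have hc0 : ((c : ℤ) : ℝ) ≠ 0 := by exact_mod_cast c.ne_zero
    have h3 : ((c : ℤ) : ℝ) * (4 * h ^ 3) ≠ 0 :=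
      mul_ne_zero hc0 (mul_ne_zero four_ne_zero (pow_ne_zero 3 hM.h_pos.ne'))
    rw [← hN] at key
    rw [hM.base_zero, sub_zero (ψ (R i))]
    have e : Complex.normSq (ψ (R i)) - h ^ 2 - (Complex.normSq (ψ (R i)) -
        Complex.normSq (N + (2 * h ^ 2 : ℝ) / conj (ψ (M.inp (some i)) - N))) =
        Complex.normSq (N + (2 * h ^ 2 : ℝ) / conj (ψ (M.inp (some i)) - N)) - h ^ 2 := by ring
    rw [e, mul_assoc, mul_comm (Complex.normSq _) (_ - _), key, inv_mul_cancel_left₀ h3]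
  exact ⟨MemIdealAt.of_eventually_eq_zero (.of_forall fun ψ => by simp), k6.congr
    (.of_forall fun ψ => by simp)⟩

/-- The sections of `M`, restricted to real inputs with the additional input at `± h * I`. The
choice of this point doubles their number. -/
theorem sections : IsSectionFamily (addBars M.L hM.bars) Z
    (inputMap ℝ fun i => M.inp (some i))
    (euclideanAnnuli l (fun i => a (some i)) fun i => b (some i))
    (euclideanWall l (fun i => a (some i)) fun i => b (some i))
    fun (k : (M.κ → ℤˣ) × ℤˣ) x => M.sec k.1 (realInput h k.2 x) where
  mem k x hx := hM.sec_mem k.1 k.2 ((hM.realInput_mem k.2 x).2 hx)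
  proj k x hx := M.inputMap_sec k.1 k.2 ((hM.realInput_mem k.2 x).2 hx)
  cont k := (M.sections.cont k.1).comp (continuous_realInput k.2).continuousOn
    fun x hx => (hM.realInput_mem k.2 x).2 hx
  analyticAt k x hx := (M.sections.analyticAt k.1 _
    ⟨(hM.realInput_mem k.2 x).2 hx.1, fun hw => hx.2 ((hM.realInput_mem_wall k.2 x).1 hw)⟩).comp
      (analyticAt_realInput k.2 x)
  exists_eq φ hφ := by
    obtain ⟨c, hc⟩ := hM.exists_realInput hφ
    obtain ⟨hD, ε, hε⟩ := M.sections.exists_eq φ (hM.mem_iff.1 hφ).1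
    rw [hc] at hD hε
    exact ⟨(hM.realInput_mem c _).1 hD, (ε, c), hε⟩
  inj x hx k k' e := by
    have hD := fun c => (hM.realInput_mem c x).2 hx.1
    have e1 : realInput h k.2 x = realInput h k'.2 x := by
      rw [← M.sections.proj k.1 _ (hD k.2), ← M.sections.proj k'.1 _ (hD k'.2), e]
    have e2 : k.2 = k'.2 := realInput_injective hM.h_pos.ne' (congrFun e1 none)
    refine Prod.ext (M.sections.inj _ ⟨hD k.2, fun hw =>
      hx.2 ((hM.realInput_mem_wall k.2 x).1 hw)⟩ _ _ ?_) e2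
    rw [e, e1]
  congrAt k x hx := by
    have hy : realInput h k.2 x ∈ annuli (l : ℂ) a b \ annuliWall (l : ℂ) a b :=
      ⟨(hM.realInput_mem k.2 x).2 hx.1, fun hw => hx.2 ((hM.realInput_mem_wall k.2 x).1 hw)⟩
    have hproj := M.sections.proj k.1 _ hy.1
    have hx' := M.inputMap_sec k.1 k.2 hy.1
    have h1 := (M.sections.congrAt k.1 _ hy).mono
      (schemeEqs_subset_addBars (C := hM.bars) hM.bars_len_of_adj)
    -- Modulo the enlarged ideal the inputs are real and the additional one is constant;
    -- substitution into the section of `M` expresses every vertex by the real inputs.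
    have h2 : CongrAt (schemeEqs (addBars M.L hM.bars) Z) (M.sec k.1 (realInput h k.2 x))
        (fun ψ => ψ ∘ M.inp)
        fun ψ => realInput h k.2 (inputMap ℝ (fun i => M.inp (some i)) ψ) := by
      refine congrAt_pi_iff.2 fun o => ?_
      rcases o with _ | i
      · exact hM.inp_none_congr (congrFun hproj none)
      · refine (hM.inp_some_congr (M.sections.mem k.1 _ hy.1) hproj hy i).congr
          (.of_forall fun ψ => ?_)
        simp [realInput, inputMap]
    have h3 := h2.comp_left (h := M.sec k.1) (IsLinkageMap.analyticAt_precomp M.inp _)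
      ((analyticAt_realInput k.2 _).fun_comp (analyticAt_inputMap ℝ _ _))
      (hproj.trans (by rw [hx'])) (by rw [hproj]; exact M.sections.analyticAt k.1 _ hy)
    refine congrAt_pi_iff.2 fun v => ?_
    exact (congrAt_pi_iff.1 h1 v).trans (congrAt_pi_iff.1 h3 v)

/-- Conjugation commutes with the reflections because it also conjugates their axes, so the two
actions combine to one of the product group. -/
theorem isSchemeAction : IsSchemeAction (addBars M.L hM.bars) Z
    fun (γ : (M.κ → ℤˣ) × ℤˣ) φ => labelAct M.label M.ax M.bx γ.1 (conjAct γ.2 φ) := by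
  have hr := M.reflective.addBars hM.bars_len_of_adj fun v w => hM.bars_label
  refine hr.isSchemeAction.prod (isSchemeAction_conjAct fun j => ?_)
    fun δ c φ => conjAct_labelAct δ c φ
  fin_cases j
  · simp [hM.base_zero]
  · simp [hM.base_one]

theorem realizesOver {Q : Fin n → M.V} (hQ : Function.Injective Q)
    (hQP : ∀ j o, Q j ≠ M.inp o) (hQl : ∀ j, M.label (Q j) = none)
    {F : EuclideanSpace ℝ (Fin m) → EuclideanSpace ℝ (Fin n)}
    (hF : ∀ j, ∀ c x, realInput h c x ∈ annuli (l : ℂ) a b →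
      M.F (Q j) (realInput h c x) = (F x j : ℂ))
    {O : EuclideanSpace ℝ (Fin m)} {r : ℝ} (hr : 0 < r)
    (h1 : Metric.closedBall O r ⊆
      interior (euclideanAnnuli l (fun i => a (some i)) fun i => b (some i)))
    (h2 : Disjoint (Metric.closedBall O r)
      (euclideanWall l (fun i => a (some i)) fun i => b (some i))) :
    RealizesOver (addBars M.L hM.bars) Z (fun i => M.inp (some i)) Q F O
      (Metric.closedBall O r) := by
  have hact := hM.isSchemeAction
  have hp : ∀ (γ : (M.κ → ℤˣ) × ℤˣ) φ, inputMap ℝ (fun i => M.inp (some i))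
      (labelAct M.label M.ax M.bx γ.1 (conjAct γ.2 φ)) =
        inputMap ℝ (fun i => M.inp (some i)) φ := by
    intro γ φ
    ext i
    simp only [inputMap, labelAct_none _ _ (M.label_inp (some i))]
    rcases Int.units_eq_one_or γ.2 with e | e <;> rw [e]
    · rfl
    · simp [conjAct_neg_one]
  have hsec : ∀ φ ∈ configSpace (addBars M.L hM.bars) Z, ∃ (ε : M.κ → ℤˣ) (c : ℤˣ),
      realInput h c (inputMap ℝ (fun i => M.inp (some i)) φ) ∈ annuli (l : ℂ) a b ∧
      φ = M.sec ε (realInput h c (inputMap ℝ (fun i => M.inp (some i)) φ)) := by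
    intro φ hφ
    obtain ⟨hK, ⟨ε, c⟩, he⟩ := hM.sections.exists_eq φ hφ
    exact ⟨ε, c, (hM.realInput_mem c _).2 hK, he⟩
  refine realizesOver_of_sections hr hM.sections isCompact_euclideanAnnuli isClosed_euclideanWall
    (euclideanAnnuli_subset_closure (fun i => hM.b_pos _) fun i => hM.b_lt _) hact hp
    (fun φ hφ ψ hψ e => ?_) (fun γ φ hφ hW e => ?_) h1 h2 ?_ (fun φ hφ i => ?_) fun φ hφ j => ?_
  · obtain ⟨ε, c, hc, hε⟩ := hsec ψ hψ
    have key : ∀ φ' ∈ configSpace (addBars M.L hM.bars) Z,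
        inputMap ℝ (fun i => M.inp (some i)) φ' = inputMap ℝ (fun i => M.inp (some i)) ψ →
        φ' (M.inp none) = ψ (M.inp none) → ∃ δ, labelAct M.label M.ax M.bx δ φ' = ψ := by
      intro φ' hφ' e' hJ
      obtain ⟨ε', c', hc', hε'⟩ := hsec φ' hφ'
      rw [e'] at hc' hε'
      have hcc : c' = c := by
        rw [hε, hε'] at hJ
        have k1 := congrFun (M.sections.proj ε _ hc) none
        have k2 := congrFun (M.sections.proj ε' _ hc') none
        exact realInput_injective hM.h_pos.ne' (k2.symm.trans (hJ.trans k1))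
      subst hcc
      refine ⟨ε * ε'⁻¹, ?_⟩
      rw [hε', M.sec_mul _ _ _ hc', inv_mul_cancel_right]
      exact hε.symm
    obtain ⟨ε', c', hc', hε'⟩ := hsec φ hφ
    have hJ : φ (M.inp none) = (((c' : ℤ) : ℝ) * h : ℝ) * Complex.I := by
      have := congrFun (M.sections.proj ε' _ hc') none
      rw [← hε'] at this
      exact this
    have hJ' : ψ (M.inp none) = (((c : ℤ) : ℝ) * h : ℝ) * Complex.I := by
      have := congrFun (M.sections.proj ε _ hc) none
      rw [← hε] at this
      exact this
    -- The sign `c * c'` conjugates exactly if the additional inputs of `φ` and `ψ` differ;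
    -- afterwards they agree and reflections suffice.
    have hmem : conjAct (c * c') φ ∈ configSpace (addBars M.L hM.bars) Z := by
      have := hact.mapsTo (1, c * c') hφ
      rwa [M.reflective.isSchemeAction.one] at this
    have hpc := hp (1, c * c') φ
    rw [M.reflective.isSchemeAction.one] at hpc
    obtain ⟨δ, hδ⟩ := key _ hmem (hpc.trans e) (by
      rw [hJ', conjAct, hJ]
      rcases Int.units_eq_one_or c with rfl | rfl <;>
        rcases Int.units_eq_one_or c' with rfl | rfl <;> simp)
    exact ⟨(δ, c * c'), hδ⟩
  · obtain ⟨ε, c, hc, hε⟩ := hsec φ hφ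
    have hw := fun hw => hW ((hM.realInput_mem_wall c _).1 hw)
    have hJ : φ (M.inp none) = (((c : ℤ) : ℝ) * h : ℝ) * Complex.I := by
      have := congrFun (M.sections.proj ε _ hc) none
      rw [← hε] at this
      exact this
    -- A conjugation moves the additional input from one of `± h * I` to the other, and the
    -- reflections do not move it.
    have hγ : γ.2 = 1 := by
      have := congrFun e (M.inp none)
      rw [labelAct_none _ _ (M.label_inp none)] at this
      rcases Int.units_eq_one_or γ.2 with h' | h'
      · exact h'
      · rw [h', conjAct_neg_one, hJ] at this
        have hh := hM.h_pos.ne'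
        have him := congrArg Complex.im this
        rcases Int.units_eq_one_or c with rfl | rfl <;> simp at him <;> exfalso <;> linarith [hM.h_pos]
    rw [hγ, conjAct_one, hε, M.sec_mul _ _ _ hc] at e
    exact Prod.ext (mul_eq_right.1 (M.sections.inj _ ⟨hc, hw⟩ _ _ e)) hγ
  · refine Function.Injective.sumElim (fun i j hij => ?_) hQ fun i j hij => hQP j _ hij.symm
    exact Option.some_injective _ (M.inp_injective hij)
  · obtain ⟨c, hc⟩ := hM.exists_realInput hφ
    have := congrFun hc (some i)
    refine this.trans ?_
    simp [realInput]
  · obtain ⟨ε, c, hc, hε⟩ := hsec φ hφ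
    rw [hε, M.sec_core _ hc (hQl j), hF j c _ hc, M.inputMap_sec ε c hc]
    simp

end IsStraightener

end RealCase

/-! ### Construction of the real linkages, and the theorem. -/

section Conclusion

variable {m n : ℕ}

theorem aeval_ofReal (x : Fin m → ℝ) (p : MvPolynomial (Fin m) ℝ) :
    MvPolynomial.aeval (fun i => (x i : ℂ)) p = ((MvPolynomial.aeval x p : ℝ) : ℂ) :=
  (DFunLike.congr_fun (MvPolynomial.comp_aeval x (Algebra.ofId ℝ ℂ)) p).symm

theorem baseImage_eq {V : Type*} {L : MarkedLinkage V 2} {l : ℝ}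
    (hl : L.len s(L.fixed 0, L.fixed 1) = l) : baseImage L = ![0, (l : ℂ)] := by
  rw [baseImage, hl]

/-- Real polynomial maps are realized by based real functional linkages. -/
theorem exists_realizesOver_real (f : Fin n → MvPolynomial (Fin m) ℝ) (O : EuclideanSpace ℝ (Fin m))
    {r : ℝ} (hr : 0 < r) :
    ∃ (V : Type) (_ : Fintype V) (L : MarkedLinkage V 2) (P : Fin m → V) (Q : Fin n → V),
      IsBased L ∧
      RealizesOver L (baseImage L) P Q (polyMap ℝ f) O (Metric.closedBall O r) := by
  set B := ‖O‖ + r with hB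
  have hBpos : 0 < B := by positivity
  set l := B + 1 with hl
  -- Since `q ≥ h`, the inner radius `q - 1` of the annulus of the additional input exceeds the
  -- outer radius `2 * B + 2` of the others. So the centre of the inversions never meets the points
  -- inverted.
  set h := 2 * B + 4 with hh
  have hlpos : 0 < l := by positivity
  have hhpos : 0 < h := by positivity
  set q := Real.sqrt (h ^ 2 + l ^ 2) with hq
  have hqsq : q ^ 2 = h ^ 2 + l ^ 2 := Real.sq_sqrt (by positivity)
  have hqpos : 0 < q := Real.sqrt_pos.2 (by positivity)
  have hqh : h ≤ q := Real.le_sqrt_of_sq_le (by nlinarith)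
  let a : Option (Fin m) → ℝ := fun o => o.elim q fun _ => upperLen B
  let b : Option (Fin m) → ℝ := fun o => o.elim 1 fun _ => lowerLen B
  have hb : ∀ o, 0 < b o := by
    rintro (_ | i)
    · exact one_pos
    · change 0 < lowerLen B
      unfold lowerLen
      linarith
  have hab : ∀ o, b o < a o := by
    rintro (_ | i)
    · change 1 < q
      linarith
    · change lowerLen B < upperLen B
      unfold lowerLen upperLen
      linarith
  let Z : Fin 2 → ℂ := ![0, (l : ℂ)]
  have hZ : Z 0 ≠ Z 1 := by
    change (0 : ℂ) ≠ l
    exact_mod_cast hlpos.ne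
  let D : Set (Option (Fin m) → ℂ) := annuli (l : ℂ) a b
  let M₀ : Mechanism (Option (Fin m)) Z D (annuliWall (l : ℂ) a b) := armMechanism Z hZ hb hab
  have hball : Metric.closedBall O r ⊆ interior (euclideanAnnuli l
      (fun i => a (some i)) fun i => b (some i)) := closedBall_subset_interior hr
  have hdisj : Disjoint (Metric.closedBall O r) (euclideanWall l
      (fun i => a (some i)) fun i => b (some i)) := closedBall_disjoint_wall hr
  have hbase : IsConstructible.Base Z D :=
    ⟨isCompact_annuli, IsConstructible.ofReal (i₀ := 0) (i₁ := 1) isCompact_annuli rfl hlpos.ne' rfl⟩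
  have hne : ∀ y ∈ D, ∀ i, y (some i) ≠ y none := by
    intro y hy i e
    have h1 := (hy none).1
    have h2 := (hy (some i)).2
    rw [e] at h2
    change q - 1 ≤ _ at h1
    change _ ≤ upperLen B + lowerLen B at h2
    unfold upperLen lowerLen at h2
    linarith
  have hDn : D.Nonempty := by
    refine ⟨fun o => o.elim ((l : ℂ) + q) fun i => O i, ?_⟩
    rintro (_ | i)
    · change q - 1 ≤ ‖(l : ℂ) + q - l‖ ∧ ‖(l : ℂ) + q - l‖ ≤ q + 1
      rw [add_sub_cancel_left, Complex.norm_real, Real.norm_of_nonneg hqpos.le]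
      constructor <;> linarith
    · have hO := interior_subset (hball (Metric.mem_closedBall_self hr.le)) i
      change _ ≤ ‖(O i : ℂ) - l‖ ∧ ‖(O i : ℂ) - l‖ ≤ _
      rw [← Complex.ofReal_sub, Complex.norm_real]
      exact hO
  -- The inverted inputs are placed at fresh vertices, so that none of them is a fixed vertex and
  -- the new bars are genuine edges.
  obtain ⟨M₁, e₁, R, -, hR⟩ := IsConstructible.exists_family hbase hDn M₀
    (F := fun i y => y none + (2 * h ^ 2 : ℝ) / conj (y (some i) - y none)) fun i =>
      (IsConstructible.add hbase (.coord none) (IsConstructible.ofReal_mul hbase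
        (IsConstructible.inv_conj hbase (IsConstructible.sub hbase (.coord (some i)) (.coord none))
          fun y hy => sub_ne_zero.2 (hne y hy i)) (2 * h ^ 2))).congr fun y _ => by
            simp only [mul_one_div]
  obtain ⟨M₂, e₂, Q, hQ, hQF⟩ := IsConstructible.exists_family hbase hDn M₁
    (F := fun j y => MvPolynomial.aeval (fun i => y (some i)) (f j))
    fun j => IsConstructible.aeval hbase hbase.ofReal (fun i => .coord (some i)) (f j)
  have hfix : ∀ j, M₂.L.fixed j = e₂.e (e₁.e (M₀.L.fixed j)) := fun j => by
    rw [e₁.isLinkageMap.fixed, e₂.isLinkageMap.fixed]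
  have hM : IsStraightener M₂ h q (e₂.e ∘ R) :=
    { base_zero := rfl
      base_one := rfl
      l_pos := hlpos
      h_pos := hhpos
      q_pos := hqpos
      q_sq := hqsq
      a_none := rfl
      b_pos := hb
      b_lt := hab
      ne := hne
      label_R := fun i => e₂.label_eq _ (hR i).1
      R_notMem := by
        rintro i ⟨j, hj⟩
        rw [hfix] at hj
        exact (hR i).2.1 ⟨_, e₂.injective hj⟩
      inp_notMem := by
        rintro ⟨j, hj⟩
        rw [hfix, ← e₂.map_inp, ← e₁.map_inp] at hj
        exact absurd (e₁.injective (e₂.injective hj)) Sum.inl_ne_inr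
      F_R := fun i => by
        rw [Function.comp_apply, e₂.F_eq]
        exact (hR i).2.2 }
  have hadj₀ : M₀.L.graph.Adj (M₀.L.fixed 0) (M₀.L.fixed 1) :=
    armLinkage_adj (hZ := hZ) (hb := hb) (hab := hab) .base
  have hadj : M₂.L.graph.Adj (M₂.L.fixed 0) (M₂.L.fixed 1) := by
    rw [hfix, hfix]
    exact (e₁.trans e₂).isLinkageMap.adj _ _ hadj₀
  have hlen : M₂.L.len s(M₂.L.fixed 0, M₂.L.fixed 1) = l := by
    rw [hfix, hfix]
    refine ((e₁.trans e₂).isLinkageMap.len _ _ hadj₀).trans ?_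
    change ‖(0 : ℂ) - l‖ = l
    rw [zero_sub, norm_neg, Complex.norm_real, Real.norm_of_nonneg hlpos.le]
  have hlen' : (addBars M₂.L hM.bars).len
      s((addBars M₂.L hM.bars).fixed 0, (addBars M₂.L hM.bars).fixed 1) = l :=
    ((isLinkageMap_addBars hM.bars_len_of_adj).len _ _ hadj).trans hlen
  refine ⟨M₂.V, inferInstance, addBars M₂.L hM.bars, fun i => M₂.inp (some i), Q, Or.inl hadj, ?_⟩
  rw [baseImage_eq hlen']
  refine hM.realizesOver hQ (fun j o hj => (hQF j).2.1 ⟨M₁.inp o, by rw [e₂.map_inp, hj]⟩)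
    (fun j => (hQF j).1) (fun j c x hx => ?_) hr hball hdisj
  rw [(hQF j).2.2 hx]
  exact aeval_ofReal (fun i => x i) (f j)

end Conclusion

end Linkage


end

theorem theoremA :
    -- real functional linkages, real polynomial maps, based linkages
    (∀ (m n : ℕ) (f : Fin n → MvPolynomial (Fin m) ℝ) (O : EuclideanSpace ℝ (Fin m)) (r : ℝ),
      0 < r →
      ∃ (V : Type) (_ : Fintype V) (L : Linkage.MarkedLinkage V 2) (P : Fin m → V) (Q : Fin n → V),
        Linkage.IsBased L ∧
        Linkage.RealizesOver L (Linkage.baseImage L) P Q (Linkage.polyMap ℝ f) O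
          (Metric.closedBall O r)) ∧
    -- complex functional linkages, polynomial maps with real coefficients, based linkages
    (∀ (m n : ℕ) (f : Fin n → MvPolynomial (Fin m) ℝ) (O : EuclideanSpace ℂ (Fin m)) (r : ℝ),
      0 < r →
      ∃ (V : Type) (_ : Fintype V) (L : Linkage.MarkedLinkage V 2) (P : Fin m → V) (Q : Fin n → V),
        Linkage.IsBased L ∧
        Linkage.RealizesOver L (Linkage.baseImage L) P Q (Linkage.polyMap ℂ f) O
          (Metric.closedBall O r)) ∧
    -- complex functional linkages, complex coefficients, relative configuration spaces
    (∀ (m n : ℕ) (f : Fin n → MvPolynomial (Fin m) ℂ) (O : EuclideanSpace ℂ (Fin m)) (r : ℝ),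
      0 < r →
      ∃ (V : Type) (_ : Fintype V) (s : ℕ) (L : Linkage.MarkedLinkage V s) (Z : Fin s → ℂ)
        (P : Fin m → V) (Q : Fin n → V),
        Linkage.RealizesOver L Z P Q (Linkage.polyMap ℂ f) O (Metric.closedBall O r)) := by
  refine ⟨fun m n f O r hr => Linkage.exists_realizesOver_real f O hr,
    fun m n f O r hr => ?_, fun m n f O r hr => ?_⟩
  · obtain ⟨V, i, L, P, Q, hadj, hlen, h⟩ := Linkage.exists_realizesOver_complex
      (Z := ![0, ((‖O‖ + r + 1 : ℝ) : ℂ)]) (i₀ := 0) (i₁ := 1) (O := O) hr rfl rfl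
      (fun D hD => hD.ofReal) f
    refine ⟨V, i, L, P, Q, hadj, ?_⟩
    rw [Linkage.baseImage_eq hlen]
    exact h
  -- The third fixed vertex at `Complex.I` makes every complex constant constructible as `re + im *
  -- I`.
  · obtain ⟨V, i, L, P, Q, -, -, h⟩ := Linkage.exists_realizesOver_complex
      (Z := ![0, ((‖O‖ + r + 1 : ℝ) : ℂ), Complex.I]) (i₀ := 0) (i₁ := 1) (O := O) hr rfl rfl
      (fun D hD z => ((hD.ofReal z.re).add hD
        ((hD.ofReal z.im).mul hD (.fixed 2))).congr fun y _ => Complex.re_add_im z) f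
    exact ⟨V, i, 3, L, _, P, Q, h⟩
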